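/- Let $n\ge 1$ and let $\mathbb K$ be $\mathbb R$, $\mathbb C$ or $\mathbb H$; correspondingly let $G=\mathrm{SO}(n)$, $\mathrm{SU}(n)$ or $\mathrm{USp}(n)$ (the group of quaternionic $n\times n$ matrices $g$ with $g^*g=1$), acting by conjugation on the traceless self-adjoint $n\times n$ matrices over $\mathbb K$ (real symmetric, complex Hermitian, quaternionic self-dual). Let $\mathcal C_+$ be the cone of vectors $x\in\mathbb R^n$ with $x_1\ge\dots\ge x_n$ and $\sum_i x_i=0$, equipped with the Lebesgue measure of the hyperplane $\sum_i x_i=0$ of $\mathbb R^n$. Let $\alpha,\beta\in\mathcal C_+$ be regular, i.e. $\alpha_1>\dots>\alpha_n$ and $\beta_1>\dots>\beta_n$. Let $g_1,g_2$ be independent and distributed according to the Haar probability measure of $G$, put $A=g_1\,\mathrm{diag}(\alpha)\,g_1^{-1}$ and $B=g_2\,\mathrm{diag}(\beta)\,g_2^{-1}$, and let $\gamma=(\gamma_1\ge\dots\ge\gamma_n)\in\mathcal C_+$ be the sorted eigenvalues of $A+B$. Then the distribution of $\gamma$ has a piecewise real-analytic density with respect to Lebesgue measure on $\mathcal C_+$.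 More precisely, consider the finitely many hyperplanes $$\sum_{j\in K}\gamma_j=\sum_{j\in I}\alpha_j+\sum_{j\in J}\beta_j,\qquad I,J,K\subset\{1,\dots,n\},\quad 1\le |I|=|J|=|K|\le n-1,$$ of the space $\{\gamma\in\mathbb R^n:\sum_i\gamma_i=0\}$, which depend only on $\alpha$ and $\beta$ and hence are the same in the three cases. In each of the three cases there is a non-negative measurable density $p$ that is real-analytic at every point of $\mathcal C_+$ lying on none of these hyperplanes (at points of the boundary of $\mathcal C_+$: near the point, $p$ is the restriction to $\mathcal C_+$ of a real-analytic function). -/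

import Mathlib

open MeasureTheory Matrix
open scoped Quaternion

noncomputable section

namespace Horn

/-! ### The groups `SO(n)`, `SU(n)`, `USp(n)` and their Haar probability measures -/

/-- `SO(n)`: real orthogonal matrices of determinant one. -/
abbrev SO (n : ℕ) : Submonoid (Matrix (Fin n) (Fin n) ℝ) := specialOrthogonalGroup (Fin n) ℝ

/-- `SU(n)`: complex unitary matrices of determinant one. -/
abbrev SU (n : ℕ) : Submonoid (Matrix (Fin n) (Fin n) ℂ) := specialUnitaryGroup (Fin n) ℂ

/-- `USp(n)`: quaternionic `n × n` matrices `U` with `U* U = U U* = 1`. -/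
abbrev USp (n : ℕ) : Submonoid (Matrix (Fin n) (Fin n) ℍ[ℝ]) :=
  unitary (Matrix (Fin n) (Fin n) ℍ[ℝ])

instance (n : ℕ) : MeasurableSpace (SO n) := borel _
instance (n : ℕ) : BorelSpace (SO n) := ⟨rfl⟩
instance (n : ℕ) : MeasurableSpace (SU n) := borel _
instance (n : ℕ) : BorelSpace (SU n) := ⟨rfl⟩
instance (n : ℕ) : MeasurableSpace (USp n) := borel _
instance (n : ℕ) : BorelSpace (USp n) := ⟨rfl⟩

instance (n : ℕ) : IsTopologicalGroup (SO n) where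
  continuous_mul := by fun_prop
  continuous_inv := by
    rw [Topology.IsInducing.subtypeVal.continuous_iff]
    have h : Continuous (Subtype.val : SO n → Matrix (Fin n) (Fin n) ℝ) := continuous_subtype_val
    exact h.matrix_transpose

instance (n : ℕ) : IsTopologicalGroup (SU n) where
  continuous_mul := by fun_prop
  continuous_inv := by
    rw [Topology.IsInducing.subtypeVal.continuous_iff]
    have h : Continuous (Subtype.val : SU n → Matrix (Fin n) (Fin n) ℂ) := continuous_subtype_val
    exact h.matrix_conjTranspose

/-- A closed set of matrices whose entries are all bounded by one in norm is compact. -/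
theorem isCompact_of_entries {n : ℕ} {K : Type*} [NormedRing K] [ProperSpace K]
    {s : Set (Matrix (Fin n) (Fin n) K)} (hs : IsClosed s)
    (h : ∀ U ∈ s, ∀ i j, ‖U i j‖ ≤ 1) : IsCompact s := by
  have hc : IsCompact (Set.univ.pi fun _ : Fin n => Set.univ.pi fun _ : Fin n =>
      Metric.closedBall (0 : K) 1) :=
    isCompact_univ_pi fun _ => isCompact_univ_pi fun _ => isCompact_closedBall _ _
  refine IsCompact.of_isClosed_subset (X := Matrix (Fin n) (Fin n) K) hc hs ?_
  intro U hU i _ j _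
  simpa using h U hU i j

theorem mem_SO_iff {n : ℕ} {U : Matrix (Fin n) (Fin n) ℝ} :
    U ∈ SO n ↔ U * Uᵀ = 1 ∧ U.det = 1 := by
  rw [SO, mem_specialOrthogonalGroup_iff, mem_orthogonalGroup_iff]

instance (n : ℕ) : CompactSpace (SO n) := by
  refine isCompact_iff_compactSpace.1 ?_
  refine isCompact_of_entries ?_ ?_
  · have : ((SO n : Submonoid _) : Set (Matrix (Fin n) (Fin n) ℝ)) =
        {U | U * Uᵀ = 1} ∩ {U | U.det = 1} := by
      ext U
      exact mem_SO_iff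
    rw [this]
    exact (isClosed_eq (by fun_prop) continuous_const).inter
      (isClosed_eq (by fun_prop) continuous_const)
  · intro U hU i j
    refine entry_norm_bound_of_unitary (𝕜 := ℝ) ?_ i j
    rw [mem_unitaryGroup_iff, star_eq_conjTranspose, conjTranspose_eq_transpose_of_trivial]
    exact (mem_SO_iff.1 hU).1

instance (n : ℕ) : CompactSpace (SU n) := by
  refine isCompact_iff_compactSpace.1 ?_
  refine isCompact_of_entries ?_ ?_
  · have : ((SU n : Submonoid _) : Set (Matrix (Fin n) (Fin n) ℂ)) =
        {U | U * star U = 1} ∩ {U | U.det = 1} := by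
      ext U
      exact mem_specialUnitaryGroup_iff.trans (and_congr mem_unitaryGroup_iff Iff.rfl)
    rw [this]
    exact (isClosed_eq (by fun_prop) continuous_const).inter
      (isClosed_eq (by fun_prop) continuous_const)
  · intro U hU i j
    exact entry_norm_bound_of_unitary (𝕜 := ℂ) (mem_specialUnitaryGroup_iff.1 hU).1 i j

instance (n : ℕ) : CompactSpace (USp n) := by
  refine isCompact_iff_compactSpace.1 ?_
  refine isCompact_of_entries ?_ ?_
  · have : ((USp n : Submonoid _) : Set (Matrix (Fin n) (Fin n) ℍ[ℝ])) =
        {U | star U * U = 1} ∩ {U | U * star U = 1} := by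
      ext U
      exact Unitary.mem_iff
    rw [this]
    exact (isClosed_eq (by fun_prop) continuous_const).inter
      (isClosed_eq (by fun_prop) continuous_const)
  · intro U hU i j
    have h1 : (U * star U) i i = 1 := by
      rw [(Unitary.mem_iff.1 hU).2, one_apply_eq]
    have h2 : ∑ k, Quaternion.normSq (U i k) = 1 := by
      have h := congrArg (fun q : ℍ[ℝ] => q.re) h1
      simp only [mul_apply, star_apply, Quaternion.self_mul_star] at h
      have hc : ∀ s : Finset (Fin n), (∑ k ∈ s, ((Quaternion.normSq (U i k) : ℝ) : ℍ[ℝ])).re =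
          ∑ k ∈ s, Quaternion.normSq (U i k) := by
        intro s
        induction s using Finset.induction_on with
        | empty => simp
        | insert a s ha ih => simp [Finset.sum_insert ha, ih]
      rw [hc] at h
      simpa using h
    have h3 : Quaternion.normSq (U i j) ≤ 1 := by
      rw [← h2]
      exact Finset.single_le_sum (f := fun k => Quaternion.normSq (U i k))
        (fun k _ => Quaternion.normSq_nonneg) (Finset.mem_univ j)
    rw [Quaternion.normSq_eq_norm_mul_self] at h3
    nlinarith [norm_nonneg (U i j)]

/-- The Haar probability measure of a compact group. -/
def haarProb (G : Type*) [Group G] [TopologicalSpace G] [IsTopologicalGroup G] [CompactSpace G]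
    [MeasurableSpace G] [BorelSpace G] : Measure G :=
  Measure.haarMeasure ⊤

/-! ### Traceless spectra -/

/-- The hyperplane `∑ xᵢ = 0` of `ℝⁿ`, with the induced Euclidean structure; its `volume` is the
induced Lebesgue measure. -/
def traceless (n : ℕ) : Submodule ℝ (EuclideanSpace ℝ (Fin n)) where
  carrier := {x | ∑ i, x i = 0}
  add_mem' := by
    intro a b ha hb
    simp_all [Finset.sum_add_distrib]
  zero_mem' := by simp
  smul_mem' := by
    intro c a ha
    simp_all [← Finset.mul_sum]

/-- The cone `𝒞₊` of traceless vectors `x₁ ≥ ⋯ ≥ xₙ`. -/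
def chamber (n : ℕ) : Set (traceless n) := {x | Antitone fun i => x.1 i}

variable {n : ℕ} {K : Type*} [Ring K] [StarRing K] [Algebra ℝ K]

/-- The real diagonal matrix `diag(x₁, …, xₙ)` with entries viewed in `K`. -/
def diag (K : Type*) [Ring K] [Algebra ℝ K] (x : traceless n) : Matrix (Fin n) (Fin n) K :=
  diagonal fun i => algebraMap ℝ K (x.1 i)

/-- `γ₁ ≥ ⋯ ≥ γₙ` are the sorted eigenvalues, with multiplicity, of the self-adjoint traceless
matrix `C`: they are the diagonal entries of a unitary diagonalization of `C`. -/
def IsSortedSpectrum (C : Matrix (Fin n) (Fin n) K) (γ : traceless n) : Prop :=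
  γ ∈ chamber n ∧ ∃ U ∈ unitary (Matrix (Fin n) (Fin n) K), C = U * diag K γ * star U

/-- The vector of sorted eigenvalues of a self-adjoint traceless matrix over `K = ℝ, ℂ, ℍ`
(it exists and is unique by the spectral theorem). -/
def sortedSpectrum (C : Matrix (Fin n) (Fin n) K) : traceless n :=
  Classical.epsilon (IsSortedSpectrum C)

/-! ### The law of the spectrum of the sum of two random matrices -/

/-- The matrix `A + B` with `A = g₁ diag(α) g₁⁻¹` and `B = g₂ diag(β) g₂⁻¹`
(`g⁻¹ = g*` for the unitary `g`). -/
def hornSum (α β : traceless n) (g₁ g₂ : Matrix (Fin n) (Fin n) K) : Matrix (Fin n) (Fin n) K :=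
  g₁ * diag K α * star g₁ + g₂ * diag K β * star g₂

/-- The law of the sorted eigenvalues of `A + B`, for independent Haar distributed `g₁, g₂` in
`SO(n)`. -/
def hornSO (α β : traceless n) : Measure (traceless n) :=
  ((haarProb (SO n)).prod (haarProb (SO n))).map
    fun g => sortedSpectrum (hornSum α β g.1.1 g.2.1)

/-- The law of the sorted eigenvalues of `A + B`, for independent Haar distributed `g₁, g₂` in
`SU(n)`. -/
def hornSU (α β : traceless n) : Measure (traceless n) :=
  ((haarProb (SU n)).prod (haarProb (SU n))).map
    fun g => sortedSpectrum (hornSum α β g.1.1 g.2.1)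

/-- The law of the sorted eigenvalues of `A + B`, for independent Haar distributed `g₁, g₂` in
`USp(n)`. -/
def hornUSp (α β : traceless n) : Measure (traceless n) :=
  ((haarProb (USp n)).prod (haarProb (USp n))).map
    fun g => sortedSpectrum (hornSum α β g.1.1 g.2.1)

/-- The hyperplane `∑_{j ∈ K} γⱼ = ∑_{j ∈ I} αⱼ + ∑_{j ∈ J} βⱼ` in the space of traceless `γ`. -/
def hornHyperplane (α β : traceless n) (I J K : Finset (Fin n)) : Set (traceless n) :=
  {γ | ∑ j ∈ K, γ.1 j = ∑ j ∈ I, α.1 j + ∑ j ∈ J, β.1 j}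

/-- The union of these hyperplanes over all `I, J, K` with `1 ≤ |I| = |J| = |K| ≤ n - 1`. (For
`|K| = 0` or `n` the equation is void, by tracelessness, and does not define a hyperplane.) -/
def singularLocus (α β : traceless n) : Set (traceless n) :=
  {γ | ∃ I J K : Finset (Fin n), I.card = K.card ∧ J.card = K.card ∧ 1 ≤ K.card ∧ K.card < n ∧
    γ ∈ hornHyperplane α β I J K}

end Horn

end

/-! Work in coordinates on the space of traceless self-adjoint matrices. The pair `(g₁, g₂)` is sent
to `A + B`, and multiplying `g₁` or `g₂` on the right by plane rotations gives finitely many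
Haar-preserving flows on `G × G`. The velocities of `A + B` along these flows have a Gram
determinant `disc`. If `disc` vanishes at a pair, some nonzero `Y` is orthogonal to all velocities.
Since `α` and `β` are regular, `Y` is then diagonal in both frames, hence commutes with `A` and with
`B`. A spectral projection `P` of `Y` commutes with `A`, `B` and `A + B`. Computing the trace of `P
(A + B)` in three ways gives `∑_K γ = ∑_I α + ∑_J β` with `|I| = |J| = |K| = rank P`, which is one
of the hyperplane equations (`mem_singularLocus`). Away from the hyperplanes, compactness therefore
bounds `disc` below.

Where `disc` is bounded below, Cramer's rule writes a coordinate derivative of a test function as a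
combination of flow derivatives, and invariance of Haar measure moves them onto polynomial weights.
After `k` integrations by parts the weights are at most `M ^ k * k!`
(`exists_abs_locVal_wordPoly_le`), because all generators satisfy polynomial differential equations.
Taylor's formula then shows that the density `f` of `A + B` satisfies `f (y - v) = P_y(v) f (y)` for
almost every `y`, with `P_y` a power series in `v` whose radius is bounded below. Fixing one good
`y` near a given point produces a real-analytic version of `f` there
(`PolyFlow.exists_analyticAt_density`).

That the law of `A + B` has a density at all follows from a weaker estimate that needs no lower
bound on `disc`: the image of `disc² m` has a distributional gradient of finite mass, hence is
absolutely continuous (`map_φ_absolutelyContinuous`). Moreover `disc ≠ 0` almost surely, because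
almost surely all off-diagonal entries of a random conjugate of a regular diagonal matrix are
nonzero (`ae_ad_diag_apply_ne_zero`).

To pass from matrices to spectra one needs the Weyl integration formula: Lebesgue measure on
matrices is a multiple of the image of Haar measure times `∏ (xᵢ - xⱼ) ^ d dx` on the chamber, where
`d` is the real dimension of the field. It is proved by showing that the image measure annihilates
derivatives and so is translation invariant (`integral_fderiv_weylMeasure`). The spectral theorem
and continuity of the sorted spectrum follow from it, uniformly in the three fields. Since `f` is
invariant under conjugation off the singular locus, the density of `γ` is there `κ ∏ (γᵢ - γⱼ) ^ d f
(diag γ)`, which is analytic up to the walls of the chamber. -/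

noncomputable section

namespace Horn

open Filter Topology
open scoped ContDiff

set_option linter.unusedSectionVars false
set_option linter.unusedVariables false
set_option linter.unusedSimpArgs false

section

/-! ### Integration by parts along measure preserving flows -/

/-- The derivative of a bounded function along a measure preserving flow has integral zero. -/
theorem integral_flow_deriv_eq_zero {X : Type*} [MeasurableSpace X] {m : Measure X}
    [IsProbabilityMeasure m] {ρ : ℝ → X → X} (hρ : ∀ t, MeasurePreserving (ρ t) m m)
    {F F' : X → ℝ} (hF : Measurable F) (hF' : Measurable F') {C C' : ℝ}
    (hC : ∀ x, |F x| ≤ C) (hC' : ∀ x, |F' x| ≤ C')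
    (hd : ∀ x t, HasDerivAt (fun t => F (ρ t x)) (F' (ρ t x)) t) : ∫ x, F' x ∂m = 0 := by
  have h0 : ∀ (F : X → ℝ), Measurable F → ∀ t, ∫ x, F (ρ t x) ∂m = ∫ x, F x ∂m := by
    intro F hF t
    have := integral_map (hρ t).measurable.aemeasurable
      (hF.aestronglyMeasurable (μ := m.map (ρ t)))
    rw [(hρ t).map_eq] at this
    exact this.symm
  have h1 := h0 F hF
  have h2 := h0 F' hF' 0
  -- By invariance `t ↦ ∫ F ∘ ρ t` is constant; differentiating under the integral sign identifies
  -- its derivative with the integral of `F'`.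
  have h3 := (hasDerivAt_integral_of_dominated_loc_of_deriv_le (μ := m) (x₀ := (0 : ℝ))
    (F := fun t x => F (ρ t x)) (F' := fun t x => F' (ρ t x)) (bound := fun _ => C')
    univ_mem (Eventually.of_forall fun t => (hF.comp (hρ t).measurable).aestronglyMeasurable)
    (Integrable.of_bound (hF.comp (hρ 0).measurable).aestronglyMeasurable C
      (Eventually.of_forall fun x => hC _))
    (hF'.comp (hρ 0).measurable).aestronglyMeasurable
    (Eventually.of_forall fun x t _ => hC' _) (integrable_const _)
    (Eventually.of_forall fun x t _ => hd x t)).2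
  simp only [h1] at h3
  rw [← h2]
  exact h3.unique (hasDerivAt_const _ _)

/-- A probability space with finitely many measure preserving flows and finitely many bounded
functions `u`, whose derivatives along the flows are polynomials in the functions `u`, together
with a map to `κ → ℝ` whose coordinates are polynomials in the `u`. -/
structure PolyFlow {X : Type*} [MeasurableSpace X] (m : Measure X) (ι σ κ : Type*) where
  /-- the flows -/
  ρ : ι → ℝ → X → X
  measurePreserving : ∀ a t, MeasurePreserving (ρ a t) m m
  /-- the generating functions -/
  u : σ → X → ℝ
  measurable_u : ∀ k, Measurable (u k)
  bounded_u : ∀ k, ∃ C, ∀ x, |u k x| ≤ C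
  /-- the derivatives of the generators along the flows -/
  du : ι → σ → MvPolynomial σ ℝ
  hasDerivAt_u : ∀ a k x t, HasDerivAt (fun t => u k (ρ a t x))
    (MvPolynomial.aeval (fun k => u k (ρ a t x)) (du a k)) t
  /-- the coordinates of the map -/
  Φ : κ → MvPolynomial σ ℝ

section Evaluation

variable {X σ : Type*}

theorem measurable_aeval [MeasurableSpace X] {u : σ → X → ℝ} (hu : ∀ k, Measurable (u k))
    (p : MvPolynomial σ ℝ) :
    Measurable fun x => MvPolynomial.aeval (fun k => u k x) p := by
  induction p using MvPolynomial.induction_on with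
  | C a => simp
  | add p q hp hq =>
    simp only [map_add]
    exact hp.add hq
  | mul_X p k hp =>
    simp only [map_mul, MvPolynomial.aeval_X]
    exact hp.mul (hu k)

theorem bounded_aeval {u : σ → X → ℝ} (hu : ∀ k, ∃ C, ∀ x, |u k x| ≤ C)
    (p : MvPolynomial σ ℝ) :
    ∃ C, 0 ≤ C ∧ ∀ x, |MvPolynomial.aeval (fun k => u k x) p| ≤ C := by
  induction p using MvPolynomial.induction_on with
  | C a => exact ⟨|a|, abs_nonneg _, fun x => by simp⟩
  | add p q hp hq =>
    obtain ⟨C, hC, h⟩ := hp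
    obtain ⟨C', hC', h'⟩ := hq
    refine ⟨C + C', by positivity, fun x => ?_⟩
    rw [map_add]
    exact (abs_add_le _ _).trans (add_le_add (h x) (h' x))
  | mul_X p k hp =>
    obtain ⟨C, hC, h⟩ := hp
    obtain ⟨C', h'⟩ := hu k
    refine ⟨C * |C'|, by positivity, fun x => ?_⟩
    rw [map_mul, abs_mul, MvPolynomial.aeval_X]
    exact mul_le_mul (h x) ((h' x).trans (le_abs_self _)) (abs_nonneg _) hC

/-- The chain rule for polynomials. Differentiation along a flow becomes a derivation of the
polynomial ring, so iterated derivatives can be estimated algebraically. -/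
theorem hasDerivAt_aeval {c : ℝ → σ → ℝ} {t : ℝ} {d : σ → MvPolynomial σ ℝ}
    (h : ∀ k, HasDerivAt (fun t => c t k) (MvPolynomial.aeval (c t) (d k)) t)
    (p : MvPolynomial σ ℝ) :
    HasDerivAt (fun t => MvPolynomial.aeval (c t) p)
      (MvPolynomial.aeval (c t) (MvPolynomial.mkDerivation ℝ d p)) t := by
  induction p using MvPolynomial.induction_on with
  | C a => simpa using hasDerivAt_const t a
  | add p q hp hq =>
    simp only [map_add]
    exact hp.add hq
  | mul_X p k hp =>
    simp only [map_mul, MvPolynomial.aeval_X, Derivation.leibniz, MvPolynomial.mkDerivation_X,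
      map_add, smul_eq_mul]
    exact (hp.mul (h k)).congr_deriv (by ring)

end Evaluation

namespace PolyFlow

variable {X : Type*} [MeasurableSpace X] {m : Measure X} {ι σ κ : Type*} [Fintype ι]
  [Fintype κ] [DecidableEq κ] (S : PolyFlow m ι σ κ)

/-- Evaluation of a polynomial in the generators. -/
def val (x : X) : MvPolynomial σ ℝ →ₐ[ℝ] ℝ := MvPolynomial.aeval fun k => S.u k x

/-- The derivation of the polynomial ring induced by a flow. -/
def L (a : ι) : Derivation ℝ (MvPolynomial σ ℝ) (MvPolynomial σ ℝ) :=
  MvPolynomial.mkDerivation ℝ (S.du a)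

/-- The map to `κ → ℝ`. -/
def φ (x : X) : κ → ℝ := fun i => S.val x (S.Φ i)

/-- The Gram matrix of the velocities of the map along the flows. -/
def gram : Matrix κ κ (MvPolynomial σ ℝ) := of fun i j => ∑ a, S.L a (S.Φ i) * S.L a (S.Φ j)

/-- The Gram determinant. -/
def disc : MvPolynomial σ ℝ := S.gram.det

/-- The coefficients that express `disc` times a coordinate derivative through the flows. -/
def coef (i : κ) (a : ι) : MvPolynomial σ ℝ := ∑ j, S.gram.adjugate i j * S.L a (S.Φ j)

theorem measurable_val (p : MvPolynomial σ ℝ) : Measurable fun x => S.val x p :=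
  measurable_aeval S.measurable_u p

theorem bounded_val (p : MvPolynomial σ ℝ) : ∃ C, 0 ≤ C ∧ ∀ x, |S.val x p| ≤ C :=
  bounded_aeval S.bounded_u p

theorem hasDerivAt_val (p : MvPolynomial σ ℝ) (a : ι) (x : X) (t : ℝ) :
    HasDerivAt (fun t => S.val (S.ρ a t x) p) (S.val (S.ρ a t x) (S.L a p)) t :=
  hasDerivAt_aeval (c := fun t k => S.u k (S.ρ a t x)) (fun k => S.hasDerivAt_u a k x t) p

theorem measurable_φ : Measurable S.φ := measurable_pi_iff.2 fun i => S.measurable_val _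

theorem bounded_φ : ∃ C, 0 ≤ C ∧ ∀ x, ‖S.φ x‖ ≤ C := by
  choose C hC h using fun i => S.bounded_val (S.Φ i)
  refine ⟨∑ i, C i, Finset.sum_nonneg fun i _ => hC i, fun x => ?_⟩
  refine (pi_norm_le_iff_of_nonneg (Finset.sum_nonneg fun i _ => hC i)).2 fun i => ?_
  exact (h i x).trans (Finset.single_le_sum (f := C) (fun i _ => hC i) (Finset.mem_univ i))

theorem bounded_comp_φ {E : Type*} [NormedAddCommGroup E] {f : (κ → ℝ) → E} (hf : Continuous f) :
    ∃ C, 0 ≤ C ∧ ∀ x, ‖f (S.φ x)‖ ≤ C := by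
  obtain ⟨R, -, hR⟩ := S.bounded_φ
  obtain ⟨C, hC⟩ := (isCompact_closedBall (0 : κ → ℝ) R).exists_bound_of_continuousOn
    hf.continuousOn
  exact ⟨|C|, abs_nonneg _, fun x => (hC _ (by simpa using hR x)).trans (le_abs_self _)⟩

theorem hasDerivAt_φ (a : ι) (x : X) (t : ℝ) :
    HasDerivAt (fun t => S.φ (S.ρ a t x))
      (fun i => S.val (S.ρ a t x) (S.L a (S.Φ i))) t :=
  hasDerivAt_pi.2 fun i => S.hasDerivAt_val _ a x t

/-- Cramer's rule: the adjugate inverts the Gram matrix up to the factor `disc`, so the coefficients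
remain polynomials. -/
theorem sum_coef (i j : κ) :
    ∑ a, S.coef i a * S.L a (S.Φ j) = if i = j then S.disc else 0 := by
  have h := congrFun (congrFun (S.gram.adjugate_mul) i) j
  rw [Matrix.smul_apply, Matrix.one_apply, smul_eq_mul, mul_ite, mul_one, mul_zero] at h
  rw [disc, ← h, Matrix.mul_apply]
  simp only [coef, gram, of_apply, Finset.sum_mul, Finset.mul_sum]
  rw [Finset.sum_comm]
  simp only [mul_assoc]

/-- Applied with `l` the derivative of a test function, this exchanges a coordinate derivative times
`disc` for derivatives along the flows. -/
theorem sum_coef_apply (x : X) (i : κ) (l : (κ → ℝ) →L[ℝ] ℝ) :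
    ∑ a, l (fun j => S.val x (S.L a (S.Φ j))) * S.val x (S.coef i a) =
      l (Pi.single i 1) * S.val x S.disc := by
  have h : ∑ a, S.val x (S.coef i a) • (fun j => S.val x (S.L a (S.Φ j))) =
      S.val x S.disc • Pi.single i (1 : ℝ) := by
    funext j
    have := congrArg (S.val x) (S.sum_coef i j)
    simp only [map_sum, map_mul] at this
    simp only [Finset.sum_apply, Pi.smul_apply, smul_eq_mul, this, Pi.single_apply]
    by_cases hij : i = j <;> simp [hij, eq_comm]
  have h' := congrArg l h
  simp only [map_sum, map_smul, smul_eq_mul] at h'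
  simpa [mul_comm] using h'

/-- Integration by parts along the flows, with general coefficients. -/
theorem integral_by_parts [IsProbabilityMeasure m] {ψ : (κ → ℝ) → ℝ} (hψ : ContDiff ℝ 1 ψ)
    {q q' : ι → X → ℝ}
    (hq : ∀ a, Measurable (q a)) (hq' : ∀ a, Measurable (q' a))
    (bq : ∀ a, ∃ C, 0 ≤ C ∧ ∀ x, |q a x| ≤ C) (bq' : ∀ a, ∃ C, 0 ≤ C ∧ ∀ x, |q' a x| ≤ C)
    (hd : ∀ a x t, HasDerivAt (fun t => ψ (S.φ (S.ρ a t x)) * q a (S.ρ a t x))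
      (fderiv ℝ ψ (S.φ (S.ρ a t x)) (fun i => S.val (S.ρ a t x) (S.L a (S.Φ i))) * q a (S.ρ a t x)
        + ψ (S.φ (S.ρ a t x)) * q' a (S.ρ a t x)) t) :
    ∫ x, ∑ a, fderiv ℝ ψ (S.φ x) (fun i => S.val x (S.L a (S.Φ i))) * q a x ∂m =
      -∫ x, ψ (S.φ x) * ∑ a, q' a x ∂m := by
  have hψ' : Continuous (fderiv ℝ ψ) := hψ.continuous_fderiv one_ne_zero
  have mψ : Measurable fun x => ψ (S.φ x) := hψ.continuous.measurable.comp S.measurable_φ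
  obtain ⟨Cψ, hCψ, bψ⟩ := S.bounded_comp_φ hψ.continuous
  obtain ⟨Cd, hCd, bd⟩ := S.bounded_comp_φ hψ'
  have mξ : ∀ a, Measurable fun x => (fun i => S.val x (S.L a (S.Φ i))) := fun a =>
    measurable_pi_iff.2 fun i => S.measurable_val _
  have md : ∀ a, Measurable fun x =>
      fderiv ℝ ψ (S.φ x) (fun i => S.val x (S.L a (S.Φ i))) := fun a => by
    have : Continuous fun p : (κ → ℝ) × (κ → ℝ) => fderiv ℝ ψ p.1 p.2 :=
      (hψ'.comp continuous_fst).clm_apply continuous_snd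
    exact this.measurable.comp (S.measurable_φ.prodMk (mξ a))
  have bξ : ∀ a, ∃ C, 0 ≤ C ∧ ∀ x, ‖fun i => S.val x (S.L a (S.Φ i))‖ ≤ C := fun a => by
    choose C hC h using fun i => S.bounded_val (S.L a (S.Φ i))
    refine ⟨∑ i, C i, Finset.sum_nonneg fun i _ => hC i, fun x => ?_⟩
    refine (pi_norm_le_iff_of_nonneg (Finset.sum_nonneg fun i _ => hC i)).2 fun i => ?_
    exact (h i x).trans (Finset.single_le_sum (f := C) (fun i _ => hC i) (Finset.mem_univ i))
  have b1 : ∀ a, ∃ C, ∀ x, |fderiv ℝ ψ (S.φ x) (fun i => S.val x (S.L a (S.Φ i))) * q a x| ≤ C :=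
    fun a => by
      obtain ⟨C, hC, h⟩ := bq a
      obtain ⟨D, hD, h'⟩ := bξ a
      refine ⟨Cd * D * C, fun x => ?_⟩
      rw [abs_mul]
      exact mul_le_mul ((ContinuousLinearMap.le_opNorm _ _).trans
        (mul_le_mul (bd x) (h' x) (norm_nonneg _) hCd)) (h x) (abs_nonneg _) (by positivity)
  have b2 : ∀ a, ∃ C, ∀ x, |ψ (S.φ x) * q' a x| ≤ C := fun a => by
    obtain ⟨C, hC, h⟩ := bq' a
    refine ⟨Cψ * C, fun x => ?_⟩
    rw [abs_mul]
    exact mul_le_mul (bψ x) (h x) (abs_nonneg _) hCψ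
  have i1 : ∀ a, Integrable
      (fun x => fderiv ℝ ψ (S.φ x) (fun i => S.val x (S.L a (S.Φ i))) * q a x) m := fun a => by
    obtain ⟨C, h⟩ := b1 a
    exact Integrable.of_bound ((md a).mul (hq a)).aestronglyMeasurable C (Eventually.of_forall h)
  have i2 : ∀ a, Integrable (fun x => ψ (S.φ x) * q' a x) m := fun a => by
    obtain ⟨C, h⟩ := b2 a
    exact Integrable.of_bound (mψ.mul (hq' a)).aestronglyMeasurable C (Eventually.of_forall h)
  -- The product `ψ(φ) q_a` is differentiated along the `a`-th flow. Only the product has to be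
  -- differentiable, which later allows a weight `q_a` that jumps where `ψ(φ)` vanishes.
  have key : ∀ a, ∫ x, fderiv ℝ ψ (S.φ x) (fun i => S.val x (S.L a (S.Φ i))) * q a x ∂m +
      ∫ x, ψ (S.φ x) * q' a x ∂m = 0 := fun a => by
    rw [← integral_add (i1 a) (i2 a)]
    obtain ⟨C1, h1⟩ := b1 a
    obtain ⟨C2, h2⟩ := b2 a
    obtain ⟨C, hC, h⟩ := bq a
    refine integral_flow_deriv_eq_zero (S.measurePreserving a)
      (F := fun x => ψ (S.φ x) * q a x) (mψ.mul (hq a))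
      (((md a).mul (hq a)).add (mψ.mul (hq' a))) (C := Cψ * C) (C' := C1 + C2) (fun x => ?_)
      (fun x => (abs_add_le _ _).trans (add_le_add (h1 x) (h2 x))) (hd a)
    rw [abs_mul]
    exact mul_le_mul (bψ x) (h x) (abs_nonneg _) hCψ
  rw [integral_finsetSum _ fun a _ => i1 a]
  simp only [Finset.mul_sum]
  rw [integral_finsetSum _ fun a _ => i2 a, ← Finset.sum_neg_distrib]
  exact Finset.sum_congr rfl fun a _ => eq_neg_of_add_eq_zero_left (key a)

/-- One factor `disc` is consumed by Cramer's rule, the other is put into the coefficients. The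
square gives a nonnegative weight without any information on the sign of `disc`. -/
theorem integral_fderiv_mul_disc_sq [IsProbabilityMeasure m] {ψ : (κ → ℝ) → ℝ}
    (hψ : ContDiff ℝ 1 ψ) (i : κ) :
    ∫ x, fderiv ℝ ψ (S.φ x) (Pi.single i 1) * S.val x S.disc ^ 2 ∂m =
      -∫ x, ψ (S.φ x) * ∑ a, S.val x (S.L a (S.coef i a * S.disc)) ∂m := by
  rw [← S.integral_by_parts hψ (q := fun a x => S.val x (S.coef i a * S.disc))
    (q' := fun a x => S.val x (S.L a (S.coef i a * S.disc))) (fun a => S.measurable_val _)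
    (fun a => S.measurable_val _) (fun a => S.bounded_val _) (fun a => S.bounded_val _)]
  · refine integral_congr_ae (Eventually.of_forall fun x => ?_)
    simp only [map_mul, ← mul_assoc]
    rw [← Finset.sum_mul, S.sum_coef_apply]
    ring
  · intro a x t
    have h1 : HasDerivAt (fun t => ψ (S.φ (S.ρ a t x))) _ t :=
      ((hψ.differentiable one_ne_zero (S.φ (S.ρ a t x))).hasFDerivAt.comp_hasDerivAt t
        (S.hasDerivAt_φ a x t))
    exact h1.mul (S.hasDerivAt_val (S.coef i a * S.disc) a x t)

end PolyFlow

end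

section

/-! ### Absolute continuity of the image measure -/

/-- The indicator function of an open set is a limit of smooth functions supported in the set. -/
theorem exists_contDiff_tendsto_indicator {V : Type*} [NormedAddCommGroup V] [NormedSpace ℝ V]
    [FiniteDimensional ℝ V] {U : Set V} (hU : IsOpen U) :
    ∃ ψ : ℕ → V → ℝ, (∀ k, ContDiff ℝ ∞ (ψ k)) ∧ (∀ k y, 0 ≤ ψ k y ∧ ψ k y ≤ 1) ∧
      (∀ k y, y ∉ U → ψ k y = 0) ∧ ∀ y ∈ U, Tendsto (fun k => ψ k y) atTop (𝓝 1) := by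
  obtain ⟨f, hsupp, hf, hr⟩ := hU.exists_contDiff_support_eq (n := ⊤)
  have h0 : ∀ y, 0 ≤ f y := fun y => (hr (Set.mem_range_self y)).1
  refine ⟨fun k y => Real.smoothTransition (k * f y), fun k => ?_, fun k y =>
    ⟨Real.smoothTransition.nonneg _, Real.smoothTransition.le_one _⟩, fun k y hy => ?_,
    fun y hy => ?_⟩
  · exact Real.smoothTransition.contDiff.comp (contDiff_const.mul hf)
  · have : f y = 0 := by
      by_contra h
      exact hy (hsupp ▸ h)
    simp [this]
  · have hy' : 0 < f y := lt_of_le_of_ne (h0 y) (Ne.symm (by rw [← hsupp] at hy; exact hy))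
    refine tendsto_const_nhds.congr' ?_
    obtain ⟨N, hN⟩ := exists_nat_gt (1 / f y)
    filter_upwards [eventually_ge_atTop N] with k hk
    refine (Real.smoothTransition.one_of_one_le ?_).symm
    have : (N : ℝ) ≤ k := by exact_mod_cast hk
    have h2 : 1 / f y ≤ k := hN.le.trans this
    rwa [div_le_iff₀ hy'] at h2

theorem hasDerivAt_integral_translate {V : Type*} [NormedAddCommGroup V] [NormedSpace ℝ V]
    [MeasurableSpace V] [BorelSpace V] [FiniteDimensional ℝ V]
    {X : Type*} [MeasurableSpace X] {m : Measure X} [IsFiniteMeasure m] {φ : X → V}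
    (hφ : Measurable φ) {ψ : V → ℝ} (hψ : ContDiff ℝ 1 ψ) (hc : HasCompactSupport ψ)
    {q : X → ℝ} (hq : Measurable q) {C : ℝ} (hC : ∀ x, |q x| ≤ C) (v : V) (t : ℝ) :
    HasDerivAt (fun t : ℝ => ∫ x, ψ (φ x + t • v) * q x ∂m)
      (∫ x, fderiv ℝ ψ (φ x + t • v) v * q x ∂m) t := by
  have hψ' : Continuous (fderiv ℝ ψ) := hψ.continuous_fderiv one_ne_zero
  obtain ⟨B, hB⟩ := hc.exists_bound_of_continuous hψ.continuous
  obtain ⟨B', hB'⟩ := (hc.fderiv (𝕜 := ℝ)).exists_bound_of_continuous hψ'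
  have mt : ∀ t : ℝ, Measurable fun x => φ x + t • v := fun t => hφ.add_const _
  have B'0 : 0 ≤ B' := (norm_nonneg _).trans (hB' 0)
  refine (hasDerivAt_integral_of_dominated_loc_of_deriv_le (μ := m)
    (F := fun t x => ψ (φ x + t • v) * q x) (F' := fun t x => fderiv ℝ ψ (φ x + t • v) v * q x)
    (bound := fun _ => B' * ‖v‖ * C) univ_mem ?_ ?_ ?_ ?_ (integrable_const _) ?_).2
  · exact Eventually.of_forall fun t =>
      ((hψ.continuous.measurable.comp (mt t)).mul hq).aestronglyMeasurable
  · refine Integrable.of_bound ((hψ.continuous.measurable.comp (mt t)).mul hq).aestronglyMeasurable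
      (B * C) (Eventually.of_forall fun x => ?_)
    rw [norm_mul]
    exact mul_le_mul (hB _) (hC x) (abs_nonneg _) ((norm_nonneg _).trans (hB 0))
  · exact (((hψ'.clm_apply continuous_const).measurable.comp (mt t)).mul hq).aestronglyMeasurable
  · refine Eventually.of_forall fun x t _ => ?_
    rw [norm_mul]
    exact mul_le_mul ((ContinuousLinearMap.le_opNorm _ _).trans
      (mul_le_mul_of_nonneg_right (hB' _) (norm_nonneg _))) (hC x) (abs_nonneg _) (by positivity)
  · refine Eventually.of_forall fun x t _ => ?_
    have h1 : HasDerivAt (fun t : ℝ => φ x + t • v) v t := by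
      simpa using ((hasDerivAt_id t).smul_const v).const_add (φ x)
    exact ((hψ.differentiable one_ne_zero _).hasFDerivAt.comp_hasDerivAt t h1).mul_const (q x)

namespace PolyFlow

variable {X : Type*} [MeasurableSpace X] {m : Measure X} {ι σ κ : Type*} [Fintype ι]
  [Fintype κ] [DecidableEq κ] (S : PolyFlow m ι σ κ)

/-- The integrated-by-parts expression contains `ψ` but no derivative of it, so only the supremum of
`ψ` matters. This says that the image of `disc² m` has bounded variation. -/
theorem exists_abs_integral_fderiv_mul_disc_sq_le [IsProbabilityMeasure m] :
    ∃ C, 0 ≤ C ∧ ∀ ψ : (κ → ℝ) → ℝ, ContDiff ℝ 1 ψ → (∀ y, |ψ y| ≤ 1) → ∀ v,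
      |∫ x, fderiv ℝ ψ (S.φ x) v * S.val x S.disc ^ 2 ∂m| ≤ C * ‖v‖ := by
  choose C hC h using fun i => S.bounded_val (∑ a, S.L a (S.coef i a * S.disc))
  refine ⟨∑ i, C i, Finset.sum_nonneg fun i _ => hC i, fun ψ hψ h1 v => ?_⟩
  have e1 : ∀ x, fderiv ℝ ψ (S.φ x) v * S.val x S.disc ^ 2 =
      ∑ i, v i * (fderiv ℝ ψ (S.φ x) (Pi.single i 1) * S.val x S.disc ^ 2) := fun x => by
    have := LinearMap.pi_apply_eq_sum_univ (fderiv ℝ ψ (S.φ x) : (κ → ℝ) →ₗ[ℝ] ℝ) v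
    simp only [ContinuousLinearMap.coe_coe, smul_eq_mul] at this
    rw [this, Finset.sum_mul]
    refine Finset.sum_congr rfl fun i _ => ?_
    rw [mul_assoc]
    congr 3
    funext j
    simp [Pi.single_apply, eq_comm]
  have hψ' : Continuous (fderiv ℝ ψ) := hψ.continuous_fderiv one_ne_zero
  obtain ⟨D, hD, bD⟩ := S.bounded_comp_φ hψ'
  obtain ⟨E, hE, bE⟩ := S.bounded_val (S.disc ^ 2)
  simp only [map_pow] at bE
  have int : ∀ i, Integrable
      (fun x => v i * (fderiv ℝ ψ (S.φ x) (Pi.single i 1) * S.val x S.disc ^ 2)) m := fun i => by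
    refine (Integrable.of_bound (C := D * ‖(Pi.single i 1 : κ → ℝ)‖ * E)
      (((hψ'.clm_apply continuous_const).measurable.comp S.measurable_φ).mul
        ((S.measurable_val _).pow_const 2)).aestronglyMeasurable
      (Eventually.of_forall fun x => ?_)).const_mul _
    rw [Pi.mul_apply, norm_mul]
    exact mul_le_mul ((ContinuousLinearMap.le_opNorm _ _).trans
      (mul_le_mul_of_nonneg_right (bD _) (norm_nonneg _))) (bE x) (abs_nonneg _) (by positivity)
  simp only [e1]
  rw [integral_finsetSum _ fun i _ => int i, Finset.sum_mul]
  refine (Finset.abs_sum_le_sum_abs _ _).trans (Finset.sum_le_sum fun i _ => ?_)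
  rw [integral_const_mul, S.integral_fderiv_mul_disc_sq hψ, abs_mul, mul_comm, abs_neg]
  refine mul_le_mul ?_ (norm_le_pi_norm v i) (abs_nonneg _) (hC i)
  have := norm_integral_le_of_norm_le_const (μ := m) (C := C i)
    (f := fun x => ψ (S.φ x) * ∑ a, S.val x (S.L a (S.coef i a * S.disc)))
    (Eventually.of_forall fun x => ?_)
  · simpa using this
  · rw [← map_sum, norm_mul]
    exact (mul_le_mul (h1 _) (h i x) (abs_nonneg _) zero_le_one).trans (one_mul _).le

/-- If the Gram determinant is almost everywhere nonzero, the image measure is absolutely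
continuous. -/
theorem map_φ_absolutelyContinuous [IsProbabilityMeasure m]
    (h0 : ∀ᵐ x ∂m, S.val x S.disc ≠ 0) : m.map S.φ ≪ volume := by
  obtain ⟨C, hC, hder⟩ := S.exists_abs_integral_fderiv_mul_disc_sq_le
  obtain ⟨R, hR, bR⟩ := S.bounded_φ
  obtain ⟨E, hE, bE⟩ := S.bounded_val (S.disc ^ 2)
  simp only [map_pow] at bE
  have mq : Measurable fun x => S.val x S.disc ^ 2 := (S.measurable_val _).pow_const 2
  -- Mean value inequality along the segment of translates: moving the test function by `v` costs at
  -- most `C * ‖v‖`, uniformly over test functions bounded by one.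
  have trans : ∀ ψ : (κ → ℝ) → ℝ, ContDiff ℝ 1 ψ → HasCompactSupport ψ → (∀ y, |ψ y| ≤ 1) → ∀ v,
      ∫ x, ψ (S.φ x) * S.val x S.disc ^ 2 ∂m ≤
        ∫ x, ψ (S.φ x + v) * S.val x S.disc ^ 2 ∂m + C * ‖v‖ := by
    intro ψ hψ hc h1 v
    have hd := hasDerivAt_integral_translate (m := m) S.measurable_φ hψ hc mq bE v
    have key := norm_image_sub_le_of_norm_deriv_le_segment_01' (C := C * ‖v‖)
      (fun t _ => (hd t).hasDerivWithinAt) (fun t _ => ?_)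
    · simp only [one_smul, zero_smul, add_zero, Real.norm_eq_abs] at key
      linarith [neg_le_of_abs_le key]
    · have h2 : ∀ y, fderiv ℝ (fun y => ψ (y + t • v)) y = fderiv ℝ ψ (y + t • v) := fun y =>
        fderiv_comp_add_right (t • v)
      have := hder (fun y => ψ (y + t • v)) (hψ.comp (contDiff_id.add contDiff_const))
        (fun y => h1 _) v
      simpa only [h2, Real.norm_eq_abs] using this
  -- Average `trans` over `v` in a ball of radius `r`. By Fubini the averaged translate sees only
  -- the Lebesgue integral of the test function, hence the volume of `U`.
  have main : ∀ U : Set (κ → ℝ), IsOpen U → Bornology.IsBounded U → ∀ r : ℝ, 0 < r →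
      ∫ x, U.indicator 1 (S.φ x) * S.val x S.disc ^ 2 ∂m ≤
        E * volume.real U / volume.real (Metric.ball (0 : κ → ℝ) r) + C * r := by
    intro U hU hb r hr
    obtain ⟨ψ, hψ, h01, hz, hlim⟩ := exists_contDiff_tendsto_indicator hU
    have hUfin : volume U < ⊤ := hb.measure_lt_top
    have habs : ∀ k y, |ψ k y| ≤ 1 := fun k y => by
      rw [abs_of_nonneg (h01 k y).1]; exact (h01 k y).2
    have hle : ∀ k y, ψ k y ≤ U.indicator 1 y := fun k y => by
      by_cases hy : y ∈ U
      · simpa [hy] using (h01 k y).2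
      · simp [hy, hz k y hy]
    set B := Metric.ball (0 : κ → ℝ) r with hB
    have hBfin : volume B < ⊤ := Metric.isBounded_ball.measure_lt_top
    have hBpos : 0 < volume.real B :=
      ENNReal.toReal_pos (Metric.measure_ball_pos _ _ hr).ne' hBfin.ne
    have step : ∀ k, ∫ x, ψ k (S.φ x) * S.val x S.disc ^ 2 ∂m ≤
        E * volume.real U / volume.real B + C * r := by
      intro k
      have hc : HasCompactSupport (ψ k) := by
        refine HasCompactSupport.of_support_subset_isCompact hb.isCompact_closure ?_
        intro y hy
        by_contra h
        exact hy (hz k y fun hyU => h (subset_closure hyU))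
      have mψ : Measurable (ψ k) := (hψ k).continuous.measurable
      have mF : Measurable fun p : (κ → ℝ) × X =>
          ψ k (S.φ p.2 + p.1) * S.val p.2 S.disc ^ 2 :=
        (mψ.comp ((S.measurable_φ.comp measurable_snd).add measurable_fst)).mul
          (mq.comp measurable_snd)
      have : IsFiniteMeasure (volume.restrict B : Measure (κ → ℝ)) := ⟨by simpa using hBfin⟩
      have intF : Integrable (fun p : (κ → ℝ) × X =>
          ψ k (S.φ p.2 + p.1) * S.val p.2 S.disc ^ 2) ((volume.restrict B).prod m) := by
        refine Integrable.of_bound mF.aestronglyMeasurable (1 * E) (Eventually.of_forall fun p => ?_)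
        rw [norm_mul]
        exact mul_le_mul (habs k _) (bE _) (abs_nonneg _) zero_le_one
      have h1 : ∫ v in B, ∫ x, ψ k (S.φ x) * S.val x S.disc ^ 2 ∂m ≤
          ∫ v in B, (∫ x, ψ k (S.φ x + v) * S.val x S.disc ^ 2 ∂m + C * r) := by
        refine setIntegral_mono_on (integrable_const _)
          (intF.integral_prod_left.add (integrable_const _)) measurableSet_ball fun v hv => ?_
        refine (trans _ ((hψ k).of_le (by exact_mod_cast le_top)) hc (habs k) v).trans ?_
        have : ‖v‖ ≤ r := (mem_ball_zero_iff.1 hv).le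
        gcongr
      have h2 : ∫ v in B, ∫ x, ψ k (S.φ x + v) * S.val x S.disc ^ 2 ∂m ≤ E * volume.real U := by
        rw [integral_integral_swap intF]
        have h3 : ∀ x, ∫ v in B, ψ k (S.φ x + v) * S.val x S.disc ^ 2 ≤ E * volume.real U := by
          intro x
          rw [integral_mul_const, mul_comm]
          refine mul_le_mul ((le_abs_self _).trans (bE x)) ?_
            (integral_nonneg fun v => (h01 k _).1) hE
          have iψ : Integrable (fun v => ψ k (S.φ x + v)) :=
            ((hψ k).continuous.integrable_of_hasCompactSupport hc).comp_add_left _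
          calc ∫ v in B, ψ k (S.φ x + v) ≤ ∫ v, ψ k (S.φ x + v) :=
                setIntegral_le_integral iψ (Eventually.of_forall fun v => (h01 k _).1)
            _ = ∫ v, ψ k v := integral_add_left_eq_self _ _
            _ ≤ ∫ v, U.indicator 1 v := integral_mono
                ((hψ k).continuous.integrable_of_hasCompactSupport hc)
                ((integrable_indicator_iff hU.measurableSet).2
                  (integrableOn_const (C := (1 : ℝ)) hUfin.ne)) (hle k)
            _ = volume.real U := by rw [integral_indicator_one hU.measurableSet]
        calc _ ≤ ∫ x, E * volume.real U ∂m :=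
              integral_mono intF.integral_prod_right (integrable_const _) h3
          _ = _ := by simp
      rw [integral_add intF.integral_prod_left (integrable_const _)] at h1
      simp only [integral_const, measureReal_restrict_apply_univ, smul_eq_mul] at h1
      rw [← sub_le_iff_le_add, le_div_iff₀ hBpos]
      nlinarith
    refine le_of_tendsto (tendsto_integral_of_dominated_convergence (fun _ => E)
      (F := fun k x => ψ k (S.φ x) * S.val x S.disc ^ 2)
      (fun k => (((hψ k).continuous.measurable.comp S.measurable_φ).mul mq).aestronglyMeasurable)
      (integrable_const _) (fun k => Eventually.of_forall fun x => ?_)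
      (Eventually.of_forall fun x => ?_)) (Eventually.of_forall step)
    · rw [norm_mul]
      exact (mul_le_mul (habs k _) (bE x) (abs_nonneg _) zero_le_one).trans (one_mul _).le
    · refine Tendsto.mul_const _ ?_
      by_cases hx : S.φ x ∈ U
      · simpa [hx] using hlim _ hx
      · simp [hx, hz _ _ hx]
  refine Measure.AbsolutelyContinuous.mk fun N hN hN0 => ?_
  have mind : Measurable fun x => N.indicator (1 : (κ → ℝ) → ℝ) (S.φ x) :=
    (measurable_one.indicator hN).comp S.measurable_φ
  have hi01 : ∀ (U : Set (κ → ℝ)) y, 0 ≤ U.indicator (1 : (κ → ℝ) → ℝ) y ∧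
      U.indicator (1 : (κ → ℝ) → ℝ) y ≤ 1 := fun U y => by
    by_cases hy : y ∈ U <;> simp [hy]
  have int : ∀ U : Set (κ → ℝ), MeasurableSet U → Integrable
      (fun x => U.indicator (1 : (κ → ℝ) → ℝ) (S.φ x) * S.val x S.disc ^ 2) m := fun U hU => by
    refine Integrable.of_bound (((measurable_one.indicator hU).comp S.measurable_φ).mul
      mq).aestronglyMeasurable (1 * E) (Eventually.of_forall fun x => ?_)
    rw [norm_mul]
    refine mul_le_mul ?_ (bE x) (abs_nonneg _) zero_le_one
    rw [Real.norm_eq_abs, abs_of_nonneg (hi01 U _).1]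
    exact (hi01 U _).2
  have zero : ∫ x, N.indicator 1 (S.φ x) * S.val x S.disc ^ 2 ∂m = 0 := by
    refine le_antisymm ?_ (integral_nonneg fun x => mul_nonneg (hi01 N _).1 (sq_nonneg _))
    have bound : ∀ r : ℝ, 0 < r → ∫ x, N.indicator 1 (S.φ x) * S.val x S.disc ^ 2 ∂m ≤ C * r := by
      intro r hr
      set b := volume.real (Metric.ball (0 : κ → ℝ) r) with hb
      have bpos : 0 < b := ENNReal.toReal_pos (Metric.measure_ball_pos _ _ hr).ne'
        Metric.isBounded_ball.measure_lt_top.ne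
      have h : ∀ ε : ℝ, 0 < ε → ∫ x, N.indicator 1 (S.φ x) * S.val x S.disc ^ 2 ∂m ≤
          E * ε / b + C * r := by
        intro ε hε
        obtain ⟨U, hNU, hU, hUε⟩ := Set.exists_isOpen_lt_of_lt (μ := volume) N
          (ENNReal.ofReal ε) (by simpa [hN0] using hε)
        -- The image of `φ` lies in the closed ball of radius `R`, so intersecting with a larger
        -- ball makes the open set bounded without losing any mass.
        set U' := U ∩ Metric.ball 0 (R + 1) with hU'
        have oU' : IsOpen U' := hU.inter Metric.isOpen_ball
        have bU' : Bornology.IsBounded U' := Metric.isBounded_ball.subset Set.inter_subset_right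
        have vU' : volume.real U' ≤ ε := by
          refine ENNReal.toReal_le_of_le_ofReal hε.le ?_
          exact (measure_mono Set.inter_subset_left).trans hUε.le
        calc _ ≤ ∫ x, U'.indicator 1 (S.φ x) * S.val x S.disc ^ 2 ∂m := by
              refine integral_mono (int N hN) (int U' oU'.measurableSet) fun x => ?_
              refine mul_le_mul_of_nonneg_right ?_ (sq_nonneg _)
              by_cases hx : S.φ x ∈ N
              · have : S.φ x ∈ U' := ⟨hNU hx, by
                  rw [mem_ball_zero_iff]; linarith [bR x]⟩
                simp [hx, this]
              · rw [Set.indicator_of_notMem hx]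
                exact (hi01 U' _).1
          _ ≤ E * volume.real U' / b + C * r := main U' oU' bU' r hr
          _ ≤ _ := by gcongr
      have lim : Tendsto (fun ε : ℝ => E * ε / b + C * r) (𝓝[>] 0) (𝓝 (E * 0 / b + C * r)) :=
        (Continuous.tendsto (by fun_prop) 0).mono_left nhdsWithin_le_nhds
      have := ge_of_tendsto lim (eventually_mem_nhdsWithin.mono fun ε hε => h ε hε)
      simpa using this
    -- The order of limits matters: first the volume of the neighbourhood of `N` tends to zero at
    -- fixed `r`, then `r` does.
    have lim : Tendsto (fun r : ℝ => C * r) (𝓝[>] 0) (𝓝 (C * 0)) :=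
      (Continuous.tendsto (by fun_prop) 0).mono_left nhdsWithin_le_nhds
    have := ge_of_tendsto lim (eventually_mem_nhdsWithin.mono fun r hr => bound r hr)
    simpa using this
  rw [integral_eq_zero_iff_of_nonneg (fun x => mul_nonneg (hi01 N _).1 (sq_nonneg _)) (int N hN)]
    at zero
  rw [Measure.map_apply S.measurable_φ hN, measure_eq_zero_iff_ae_notMem]
  filter_upwards [zero, h0] with x hx hx0 hxN
  rw [Set.mem_preimage] at hxN
  simp [hxN, hx0] at hx

end PolyFlow

end

section

/-! ### Bounds for iterated derivations of polynomials -/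

/-- `PolyBound N c p`: the polynomial `p` has degree at most `N` and its coefficients have absolute
values with sum at most `c`. -/
inductive PolyBound {σ : Type*} : ℕ → ℝ → MvPolynomial σ ℝ → Prop
  | const {N : ℕ} {c a : ℝ} : |a| ≤ c → PolyBound N c (MvPolynomial.C a)
  | X_mul {N : ℕ} {c : ℝ} {p : MvPolynomial σ ℝ} (k : σ) :
      PolyBound N c p → PolyBound (N + 1) c (MvPolynomial.X k * p)
  | add {N : ℕ} {c c' : ℝ} {p q : MvPolynomial σ ℝ} :
      PolyBound N c p → PolyBound N c' q → PolyBound N (c + c') (p + q)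

namespace PolyBound

variable {σ : Type*} {N N' : ℕ} {c c' : ℝ} {p q : MvPolynomial σ ℝ}

theorem nonneg (h : PolyBound N c p) : 0 ≤ c := by
  induction h with
  | const h => exact (abs_nonneg _).trans h
  | X_mul k _ ih => exact ih
  | add _ _ h1 h2 => exact add_nonneg h1 h2

theorem mono (h : PolyBound N c p) (hN : N ≤ N') (hc : c ≤ c') : PolyBound N' c' p := by
  induction h generalizing N' c' with
  | const h => exact .const (h.trans hc)
  | X_mul k _ ih =>
    obtain ⟨M, rfl⟩ : ∃ M, N' = M + 1 := ⟨N' - 1, by omega⟩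
    exact .X_mul k (ih (by omega) hc)
  | @add N c₁ c₂ p q _ _ h1 h2 =>
    have := PolyBound.add (h1 (c' := c' - c₂) hN (by linarith)) (h2 hN le_rfl)
    simpa using this

theorem zero (h : 0 ≤ c) : PolyBound N c (0 : MvPolynomial σ ℝ) := by
  simpa using PolyBound.const (σ := σ) (N := N) (a := 0) (by simpa using h)

theorem C_mul (a : ℝ) (h : PolyBound N c p) : PolyBound N (|a| * c) (MvPolynomial.C a * p) := by
  induction h with
  | const h =>
    rw [← map_mul]
    exact .const (by rw [abs_mul]; gcongr)
  | X_mul k _ ih =>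
    rw [mul_left_comm]
    exact .X_mul k ih
  | add _ _ h1 h2 =>
    rw [mul_add, mul_add]
    exact h1.add h2

theorem mul (h : PolyBound N c p) (h' : PolyBound N' c' q) :
    PolyBound (N + N') (c * c') (p * q) := by
  induction h with
  | const h =>
    exact (h'.C_mul _).mono (by omega) (mul_le_mul_of_nonneg_right h h'.nonneg)
  | X_mul k _ ih =>
    rw [mul_assoc]
    exact (PolyBound.X_mul k ih).mono (by omega) le_rfl
  | add _ _ h1 h2 =>
    rw [add_mul, add_mul]
    exact h1.add h2

theorem sum {ι : Type*} (s : Finset ι) {c : ι → ℝ} {p : ι → MvPolynomial σ ℝ}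
    (h : ∀ i ∈ s, PolyBound N (c i) (p i)) : PolyBound N (∑ i ∈ s, c i) (∑ i ∈ s, p i) := by
  classical
  induction s using Finset.induction_on with
  | empty => simpa using PolyBound.zero le_rfl
  | insert a s ha ih =>
    rw [Finset.sum_insert ha, Finset.sum_insert ha]
    exact (h a (by simp)).add (ih fun i hi => h i (by simp [hi]))

theorem neg (h : PolyBound N c p) : PolyBound N c (-p) := by
  simpa using h.C_mul (-1)

theorem exists_bound (p : MvPolynomial σ ℝ) : ∃ N c, PolyBound N c p := by
  induction p using MvPolynomial.induction_on with
  | C a => exact ⟨0, _, .const le_rfl⟩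
  | add p q hp hq =>
    obtain ⟨N, c, h⟩ := hp
    obtain ⟨N', c', h'⟩ := hq
    exact ⟨max N N', _, (h.mono (le_max_left _ _) le_rfl).add (h'.mono (le_max_right _ _) le_rfl)⟩
  | mul_X p k hp =>
    obtain ⟨N, c, h⟩ := hp
    exact ⟨_, _, mul_comm p _ ▸ h.X_mul k⟩

theorem exists_uniform_bound {ι : Type*} [Finite ι] (p : ι → MvPolynomial σ ℝ) :
    ∃ N c, 0 ≤ c ∧ ∀ i, PolyBound N c (p i) := by
  have := Fintype.ofFinite ι
  choose N c h using fun i => exists_bound (p i)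
  refine ⟨∑ i, N i, ∑ i, c i, Finset.sum_nonneg fun i _ => (h i).nonneg, fun i =>
    (h i).mono (Finset.single_le_sum (f := N) (fun i _ => Nat.zero_le _) (Finset.mem_univ i))
      (Finset.single_le_sum (f := c) (fun i _ => (h i).nonneg) (Finset.mem_univ i))⟩

/-- The Leibniz rule yields one term for each of the at most `N` letters of a monomial. This factor
`N`, growing linearly under iteration, is the source of `k!`. -/
theorem derivation {d : σ → MvPolynomial σ ℝ} {D : ℕ} {K : ℝ}
    (hd : ∀ k, PolyBound D K (d k)) (hK : 0 ≤ K) (h : PolyBound N c p) :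
    PolyBound (N + D) (K * N * c) (MvPolynomial.mkDerivation ℝ d p) := by
  induction h with
  | const h =>
    rw [MvPolynomial.derivation_C]
    exact zero (mul_nonneg (by positivity) ((abs_nonneg _).trans h))
  | @X_mul N c p k hp ih =>
    rw [Derivation.leibniz, smul_eq_mul, smul_eq_mul, MvPolynomial.mkDerivation_X]
    refine ((ih.X_mul k).add ((hp.mul (hd k)).mono (Nat.le_succ _) le_rfl)).mono
      (by omega) (le_of_eq ?_)
    push_cast
    ring
  | add _ _ h1 h2 =>
    rw [map_add]
    exact (h1.add h2).mono le_rfl (le_of_eq (by ring))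

theorem abs_aeval_le {u : σ → ℝ} {R : ℝ} (hR : 1 ≤ R) (hu : ∀ k, |u k| ≤ R)
    (h : PolyBound N c p) : |MvPolynomial.aeval u p| ≤ c * R ^ N := by
  induction h with
  | const h =>
    simp only [MvPolynomial.aeval_C, Algebra.algebraMap_self, RingHom.id_apply]
    exact h.trans (le_mul_of_one_le_right ((abs_nonneg _).trans h) (one_le_pow₀ hR))
  | @X_mul N c p k hp ih =>
    rw [map_mul, abs_mul, MvPolynomial.aeval_X, pow_succ']
    calc |u k| * |MvPolynomial.aeval u p| ≤ R * (c * R ^ N) :=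
          mul_le_mul (hu k) ih (abs_nonneg _) (by linarith)
      _ = _ := by ring
  | add _ _ h1 h2 =>
    rw [map_add, add_mul]
    exact (abs_add_le _ _).trans (add_le_add h1 h2)

end PolyBound

/-! ### Conditional expectation given a map, and Taylor series -/

/-- `F` is the conditional expectation of `h` given `φ`, read as a function on the target.
Truncating it to `[-c, c]` turns the almost sure bound into one at every point, as needed for the
power series built from such functions. -/
theorem exists_conditional_expectation {X V : Type*} [MeasurableSpace X] [MeasurableSpace V]
    {m : Measure X} [IsFiniteMeasure m] {φ : X → V} (hφ : Measurable φ) {h : X → ℝ}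
    (hh : Measurable h) {c : ℝ} (hc : 0 ≤ c) (hb : ∀ x, |h x| ≤ c) :
    ∃ F : V → ℝ, Measurable F ∧ (∀ y, |F y| ≤ c) ∧ ∀ ψ : V → ℝ, Measurable ψ →
      (∃ B, ∀ y, |ψ y| ≤ B) → ∫ x, ψ (φ x) * h x ∂m = ∫ y, ψ y * F y ∂(m.map φ) := by
  have hle := hφ.comap_le
  have hi : Integrable h m := Integrable.of_bound hh.aestronglyMeasurable c (Eventually.of_forall hb)
  obtain ⟨F, hF, hFe⟩ := (stronglyMeasurable_condExp (f := h) (μ := m)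
    (m := MeasurableSpace.comap φ inferInstance)).exists_eq_measurable_comp
  have hbd := ae_bdd_abs_condExp_of_ae_bdd_abs (μ := m) (m := MeasurableSpace.comap φ inferInstance)
    (R := c) (Eventually.of_forall hb)
  have hF' : Measurable F := hF.measurable
  refine ⟨fun y => max (-c) (min c (F y)), measurable_const.max (measurable_const.min hF'),
    fun y => ?_, fun ψ hψ ⟨B, hB⟩ => ?_⟩
  · rw [abs_le]
    exact ⟨le_max_left _ _, max_le (by linarith) (min_le_left _ _)⟩
  · have i1 : Integrable ((fun x => ψ (φ x)) * h) m := by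
      refine Integrable.of_bound ((hψ.comp hφ).mul hh).aestronglyMeasurable (|B| * c)
        (Eventually.of_forall fun x => ?_)
      rw [Pi.mul_apply, norm_mul]
      exact mul_le_mul ((hB _).trans (le_abs_self _)) (hb x) (abs_nonneg _) (abs_nonneg _)
    have e1 := condExp_mul_of_stronglyMeasurable_left (μ := m)
      (m := MeasurableSpace.comap φ inferInstance)
      (f := fun x => ψ (φ x)) (g := h)
      (hψ.stronglyMeasurable.comp_measurable (comap_measurable φ)) i1 hi
    have e3 := integral_map (μ := m) hφ.aemeasurable (f := fun y => ψ y * max (-c) (min c (F y)))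
      (hψ.mul (measurable_const.max (measurable_const.min hF'))).aestronglyMeasurable
    rw [e3]
    have e2 := integral_condExp (μ := m) hle (f := (fun x => ψ (φ x)) * h)
    refine (e2.symm.trans (integral_congr_ae ?_))
    filter_upwards [e1, hbd] with x hx hx'
    rw [hx, Pi.mul_apply, hFe]
    rw [hFe] at hx'
    have h1 : |F (φ x)| ≤ c := hx'
    rw [abs_le] at h1
    simp [h1.1, h1.2]

/-- A smooth function on the unit interval whose derivatives grow like `q ^ k * k!` with `q < 1`
is the sum of its Taylor series. -/
theorem hasSum_taylor {I : ℕ → ℝ → ℝ} {M q : ℝ} (hq0 : 0 ≤ q) (hq : q < 1)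
    (hd : ∀ k, ∀ t ∈ Set.Icc (0 : ℝ) 1, HasDerivAt (I k) (I (k + 1) t) t)
    (hb : ∀ k, ∀ t ∈ Set.Icc (0 : ℝ) 1, |I k t| ≤ M * (q ^ k * k.factorial)) :
    HasSum (fun k => I k 0 / k.factorial) (I 0 1) := by
  have hM : 0 ≤ M := by simpa using (abs_nonneg _).trans (hb 0 0 (by simp))
  have hsum : Summable fun k => I k 0 / k.factorial := by
    refine Summable.of_norm_bounded (g := fun k => M * q ^ k)
      ((summable_geometric_of_lt_one hq0 hq).mul_left M) fun k => ?_
    rw [norm_div, Real.norm_natCast, div_le_iff₀ (by positivity)]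
    exact (hb k 0 (by simp)).trans (le_of_eq (by ring))
  -- The Taylor polynomial about `t`, evaluated at `1`, is viewed as a function of the centre `t`;
  -- its derivative telescopes to a single term. At `t = 1` it equals `I 0 1`, at `t = 0` it is the
  -- partial sum sought.
  have hR : ∀ N, ∀ t ∈ Set.Icc (0 : ℝ) 1, HasDerivAt
      (fun t => ∑ k ∈ Finset.range (N + 1), I k t * ((1 - t) ^ k / k.factorial))
      (I (N + 1) t * ((1 - t) ^ N / N.factorial)) t := by
    intro N t ht
    induction N with
    | zero => simpa using hd 0 t ht
    | succ N ih =>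
      simp only [Finset.sum_range_succ _ (N + 1)]
      have h1 : HasDerivAt (fun t : ℝ => (1 - t) ^ (N + 1) / ((N + 1).factorial : ℝ))
          (-((1 - t) ^ N / N.factorial)) t := by
        have := (((hasDerivAt_id t).const_sub 1).fun_pow (N + 1)).div_const
          ((N + 1).factorial : ℝ)
        refine this.congr_deriv ?_
        have : (N.factorial : ℝ) ≠ 0 := by positivity
        rw [Nat.factorial_succ]
        push_cast
        field_simp
        simp
      refine (ih.add ((hd (N + 1) t ht).mul h1)).congr_deriv ?_
      ring
  have hlim : Tendsto (fun N => ∑ k ∈ Finset.range (N + 1), I k 0 / k.factorial) atTop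
      (𝓝 (I 0 1)) := by
    rw [tendsto_iff_norm_sub_tendsto_zero]
    -- The factor `N + 1` is `(N + 1)! / N!`, from the bound on `I (N + 1)` and the weight `(1 - t)
    -- ^ N / N!`.
    have hz : Tendsto (fun N : ℕ => M * (((N : ℝ) + 1) * q ^ (N + 1))) atTop (𝓝 0) := by
      have := ((tendsto_self_mul_const_pow_of_lt_one hq0 hq).comp (tendsto_add_atTop_nat 1)).const_mul
        M
      simpa using this
    refine squeeze_zero (fun _ => norm_nonneg _) (fun N => ?_) hz
    have key := norm_image_sub_le_of_norm_deriv_le_segment_01'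
      (C := M * (((N : ℝ) + 1) * q ^ (N + 1)))
      (fun t ht => (hR N t ht).hasDerivWithinAt) (fun t ht => ?_)
    · rw [norm_sub_rev]
      have e1 : ∑ k ∈ Finset.range (N + 1), I k 1 * ((1 - 1) ^ k / (k.factorial : ℝ)) = I 0 1 := by
        rw [Finset.sum_range_succ']
        simp
      have e2 : ∑ k ∈ Finset.range (N + 1), I k 0 * ((1 - 0) ^ k / (k.factorial : ℝ)) =
          ∑ k ∈ Finset.range (N + 1), I k 0 / k.factorial :=
        Finset.sum_congr rfl fun k _ => by simp [div_eq_mul_inv]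
      rwa [e1, e2] at key
    · have ht' : t ∈ Set.Icc (0 : ℝ) 1 := ⟨ht.1, ht.2.le⟩
      have h1 : |(1 - t) ^ N / N.factorial| ≤ 1 / N.factorial := by
        rw [abs_of_nonneg (div_nonneg (pow_nonneg (by linarith [ht.2]) _) (by positivity))]
        gcongr
        exact pow_le_one₀ (by linarith [ht.2]) (by linarith [ht.1])
      rw [norm_mul]
      refine (mul_le_mul (hb _ t ht') h1 (abs_nonneg _) (by positivity)).trans (le_of_eq ?_)
      have : (N.factorial : ℝ) ≠ 0 := by positivity
      rw [Nat.factorial_succ]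
      push_cast
      field_simp
  exact (hsum.hasSum_iff_tendsto_nat).2 ((tendsto_add_atTop_iff_nat 1).1 hlim)

end

section

/-! ### Analyticity of the density of the image measure -/

/-- The formal power series `∑ₖ 1/k! ∑_w c_w v_{w₁} ⋯ v_{wₖ}` on `κ → ℝ`, for coefficients indexed
by words. -/
def wordSeries {κ : Type*} [Fintype κ] (c : ∀ k : ℕ, (Fin k → κ) → ℝ) :
    FormalMultilinearSeries ℝ (κ → ℝ) ℝ := fun k =>
  (k.factorial : ℝ)⁻¹ • ∑ w : Fin k → κ, c k w •
    (ContinuousMultilinearMap.mkPiAlgebra ℝ (Fin k) ℝ).compContinuousLinearMap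
      (fun i => ContinuousLinearMap.proj (R := ℝ) (φ := fun _ : κ => ℝ) (w i))

theorem wordSeries_apply {κ : Type*} [Fintype κ] (c : ∀ k : ℕ, (Fin k → κ) → ℝ) (k : ℕ)
    (v : Fin k → κ → ℝ) : wordSeries c k v =
      (k.factorial : ℝ)⁻¹ * ∑ w : Fin k → κ, c k w * ∏ i, v i (w i) := by
  simp [wordSeries]

/-- There are `(card κ) ^ k` words of length `k`, and the factorial in the bound on `c` cancels the
one in the series. -/
theorem norm_wordSeries_le {κ : Type*} [Fintype κ] {c : ∀ k : ℕ, (Fin k → κ) → ℝ} {M : ℝ}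
    (hM : 0 ≤ M) (hc : ∀ k w, |c k w| ≤ M ^ k * k.factorial) (k : ℕ) :
    ‖wordSeries c k‖ ≤ (M * Fintype.card κ) ^ k := by
  refine ContinuousMultilinearMap.opNorm_le_bound (by positivity) fun v => ?_
  rw [wordSeries_apply, norm_mul, norm_inv, Real.norm_natCast, inv_mul_le_iff₀ (by positivity)]
  refine (norm_sum_le _ _).trans ?_
  have : ∀ w : Fin k → κ, ‖c k w * ∏ i, v i (w i)‖ ≤ M ^ k * k.factorial * ∏ i, ‖v i‖ := fun w => by
    rw [norm_mul]
    refine mul_le_mul (hc k w) ?_ (norm_nonneg _) (by positivity)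
    rw [norm_prod]
    exact Finset.prod_le_prod (fun _ _ => norm_nonneg _) fun i _ => norm_le_pi_norm (v i) (w i)
  refine (Finset.sum_le_sum fun w _ => this w).trans (le_of_eq ?_)
  simp only [Finset.sum_const, Finset.card_univ, Fintype.card_fun, Fintype.card_fin, nsmul_eq_mul]
  push_cast
  ring

namespace PolyFlow

variable {X : Type*} [MeasurableSpace X] {m : Measure X} {ι σ κ : Type*} [Fintype ι]
  [Fintype κ] [DecidableEq κ] (S : PolyFlow m ι σ κ) (B : Set (κ → ℝ))

open Classical in
/-- The generators together with the inverse of the Gram determinant, the latter cut off outside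
of the preimage of `B`. -/
def locGen : Option σ → X → ℝ
  | none => fun x => if S.φ x ∈ B then (S.val x S.disc)⁻¹ else 0
  | some k => S.u k

/-- Evaluation of a polynomial in the generators and the inverse Gram determinant. -/
def locVal (x : X) : MvPolynomial (Option σ) ℝ →ₐ[ℝ] ℝ :=
  MvPolynomial.aeval fun k => S.locGen B k x

/-- Derivatives of the extended generators. -/
def locDeriv (a : ι) : Option σ → MvPolynomial (Option σ) ℝ
  | none => -(MvPolynomial.X none ^ 2 * MvPolynomial.rename some (S.L a S.disc))
  | some k => MvPolynomial.rename some (S.du a k)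

/-- The derivation of the extended polynomial ring induced by a flow. -/
def locL (a : ι) : Derivation ℝ (MvPolynomial (Option σ) ℝ) (MvPolynomial (Option σ) ℝ) :=
  MvPolynomial.mkDerivation ℝ (S.locDeriv a)

/-- The adjoint of the `i`-th coordinate derivative. -/
def adj (i : κ) : MvPolynomial (Option σ) ℝ →ₗ[ℝ] MvPolynomial (Option σ) ℝ :=
  -∑ a, (S.locL a).toLinearMap ∘ₗ LinearMap.mulLeft ℝ
    (MvPolynomial.rename some (S.coef i a) * MvPolynomial.X none)

theorem adj_apply (i : κ) (p : MvPolynomial (Option σ) ℝ) : S.adj i p =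
    -∑ a, S.locL a (MvPolynomial.rename some (S.coef i a) * MvPolynomial.X none * p) := by
  simp only [adj, LinearMap.neg_apply, LinearMap.sum_apply, LinearMap.comp_apply,
    LinearMap.mulLeft_apply]
  rfl

variable {B} in
theorem locGen_none {x : X} (hx : S.φ x ∈ B) : S.locGen B none x = (S.val x S.disc)⁻¹ :=
  if_pos hx

@[simp] theorem locVal_rename (x : X) (p : MvPolynomial σ ℝ) :
    S.locVal B x (MvPolynomial.rename some p) = S.val x p := by
  rw [locVal, MvPolynomial.aeval_rename]
  rfl

variable {B}

theorem measurable_locGen (hB : IsOpen B) (k : Option σ) : Measurable (S.locGen B k) := by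
  cases k with
  | none =>
    exact Measurable.ite (S.measurable_φ hB.measurableSet) (S.measurable_val _).inv measurable_const
  | some k => exact S.measurable_u k

theorem bounded_locGen {δ : ℝ} (hδ : 0 < δ) (hlow : ∀ x, S.φ x ∈ B → δ ≤ S.val x S.disc)
    (k : Option σ) : ∃ C, ∀ x, |S.locGen B k x| ≤ C := by
  cases k with
  | none =>
    refine ⟨δ⁻¹, fun x => ?_⟩
    by_cases h : S.φ x ∈ B
    · rw [S.locGen_none h, abs_of_nonneg (inv_nonneg.2 (hδ.le.trans (hlow x h)))]
      exact inv_anti₀ hδ (hlow x h)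
    · have : S.locGen B none x = 0 := if_neg h
      simpa [this] using hδ.le
  | some k => exact S.bounded_u k

/-- The new generator obeys the quotient rule `(1/disc)' = -(1/disc)² disc'`, again polynomial in
the generators. Since `B` is open, the cutoff is inactive at nearby times. -/
theorem hasDerivAt_locVal (hB : IsOpen B) {δ : ℝ} (hδ : 0 < δ)
    (hlow : ∀ x, S.φ x ∈ B → δ ≤ S.val x S.disc) (p : MvPolynomial (Option σ) ℝ) (a : ι) (x : X)
    (t : ℝ) (hx : S.φ (S.ρ a t x) ∈ B) :
    HasDerivAt (fun t => S.locVal B (S.ρ a t x) p)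
      (S.locVal B (S.ρ a t x) (S.locL a p)) t := by
  refine hasDerivAt_aeval (c := fun t k => S.locGen B k (S.ρ a t x)) (fun k => ?_) p
  cases k with
  | none =>
    have hne : S.val (S.ρ a t x) S.disc ≠ 0 := (hδ.trans_le (hlow _ hx)).ne'
    have h1 := (S.hasDerivAt_val S.disc a x t).inv hne
    have hev : (fun t => S.locGen B none (S.ρ a t x)) =ᶠ[𝓝 t]
        (fun t => S.val (S.ρ a t x) S.disc)⁻¹ := by
      filter_upwards [(S.hasDerivAt_φ a x t).continuousAt (hB.mem_nhds hx)] with s hs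
      exact S.locGen_none hs
    refine (h1.congr_of_eventuallyEq hev).congr_deriv ?_
    change _ = S.locVal B (S.ρ a t x) (S.locDeriv a none)
    rw [locDeriv, map_neg, map_mul, map_pow, locVal_rename]
    have : S.locVal B (S.ρ a t x) (MvPolynomial.X none) = (S.val (S.ρ a t x) S.disc)⁻¹ := by
      rw [locVal, MvPolynomial.aeval_X, S.locGen_none hx]
    rw [this]
    field_simp
  | some k =>
    refine (S.hasDerivAt_u a k x t).congr_deriv ?_
    change S.val _ _ = S.locVal B (S.ρ a t x) (S.locDeriv a (some k))
    rw [locDeriv, locVal_rename]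

theorem measurable_locVal (hB : IsOpen B) (p : MvPolynomial (Option σ) ℝ) :
    Measurable fun x => S.locVal B x p :=
  measurable_aeval (S.measurable_locGen hB) p

theorem bounded_locVal {δ : ℝ} (hδ : 0 < δ) (hlow : ∀ x, S.φ x ∈ B → δ ≤ S.val x S.disc)
    (p : MvPolynomial (Option σ) ℝ) : ∃ C, 0 ≤ C ∧ ∀ x, |S.locVal B x p| ≤ C :=
  bounded_aeval (S.bounded_locGen hδ hlow) p

/-- Here the factor `disc` from Cramer's rule is divided out, which is harmless because `ψ` lives
where `disc ≥ δ`. The result has the same shape as the left side without the derivative, so it can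
be iterated. -/
theorem integral_fderiv_mul_locVal [IsProbabilityMeasure m] (hB : IsOpen B) {δ : ℝ} (hδ : 0 < δ)
    (hlow : ∀ x, S.φ x ∈ B → δ ≤ S.val x S.disc) {ψ : (κ → ℝ) → ℝ} (hψ : ContDiff ℝ 1 ψ)
    (hsupp : tsupport ψ ⊆ B) (i : κ) (p : MvPolynomial (Option σ) ℝ) :
    ∫ x, fderiv ℝ ψ (S.φ x) (Pi.single i 1) * S.locVal B x p ∂m =
      ∫ x, ψ (S.φ x) * S.locVal B x (S.adj i p) ∂m := by
  have key := S.integral_by_parts hψ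
    (q := fun a x => S.locVal B x (MvPolynomial.rename some (S.coef i a) * MvPolynomial.X none * p))
    (q' := fun a x => S.locVal B x (S.locL a
      (MvPolynomial.rename some (S.coef i a) * MvPolynomial.X none * p)))
    (fun a => S.measurable_locVal hB _) (fun a => S.measurable_locVal hB _)
    (fun a => S.bounded_locVal hδ hlow _) (fun a => S.bounded_locVal hδ hlow _) ?_
  · have e1 : ∀ x, ψ (S.φ x) * S.locVal B x (S.adj i p) =
        -(ψ (S.φ x) * ∑ a, S.locVal B x (S.locL a
          (MvPolynomial.rename some (S.coef i a) * MvPolynomial.X none * p))) := fun x => by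
      rw [adj_apply, map_neg, map_sum, mul_neg]
    simp only [e1]
    rw [integral_neg, ← key]
    refine integral_congr_ae (Eventually.of_forall fun x => ?_)
    simp only [map_mul, locVal_rename, ← mul_assoc]
    rw [← Finset.sum_mul, ← Finset.sum_mul, S.sum_coef_apply]
    by_cases hx : S.φ x ∈ B
    · have : S.locVal B x (MvPolynomial.X none) = (S.val x S.disc)⁻¹ := by
        rw [locVal, MvPolynomial.aeval_X, S.locGen_none hx]
      rw [this, mul_assoc (fderiv ℝ ψ (S.φ x) (Pi.single i 1)),
        mul_inv_cancel₀ (hδ.trans_le (hlow _ hx)).ne', mul_one]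
    · have : fderiv ℝ ψ (S.φ x) = 0 := by
        by_contra h
        exact hx (hsupp (support_fderiv_subset ℝ h))
      simp [this]
  · intro a x t
    by_cases hx : S.φ (S.ρ a t x) ∈ B
    · have h1 : HasDerivAt (fun t => ψ (S.φ (S.ρ a t x))) _ t :=
        ((hψ.differentiable one_ne_zero (S.φ (S.ρ a t x))).hasFDerivAt.comp_hasDerivAt t
          (S.hasDerivAt_φ a x t))
      exact h1.mul (S.hasDerivAt_locVal hB hδ hlow _ a x t hx)
    -- Outside `B` the inverse determinant may jump, but the orbit stays off the closed support of
    -- `ψ` for nearby times and the product is locally zero.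
    · have hx' : S.φ (S.ρ a t x) ∉ tsupport ψ := fun h => hx (hsupp h)
      have h0 : fderiv ℝ ψ (S.φ (S.ρ a t x)) = 0 := by
        by_contra h
        exact hx' (support_fderiv_subset ℝ h)
      have h1 : ψ (S.φ (S.ρ a t x)) = 0 := image_eq_zero_of_notMem_tsupport hx'
      rw [h0, h1]
      refine ((hasDerivAt_const t (0 : ℝ)).congr_of_eventuallyEq ?_).congr_deriv (by simp)
      filter_upwards [(S.hasDerivAt_φ a x t).continuousAt
        ((isClosed_tsupport ψ).isOpen_compl.mem_nhds hx')] with s hs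
      rw [image_eq_zero_of_notMem_tsupport hs, zero_mul]

/-- The adjoint of a directional derivative. -/
def adjDir (v : κ → ℝ) : MvPolynomial (Option σ) ℝ →ₗ[ℝ] MvPolynomial (Option σ) ℝ :=
  ∑ i, v i • S.adj i

theorem integral_fderiv_mul_locVal_dir [IsProbabilityMeasure m] (hB : IsOpen B) {δ : ℝ}
    (hδ : 0 < δ) (hlow : ∀ x, S.φ x ∈ B → δ ≤ S.val x S.disc) {ψ : (κ → ℝ) → ℝ}
    (hψ : ContDiff ℝ 1 ψ) (hsupp : tsupport ψ ⊆ B) (v : κ → ℝ) (p : MvPolynomial (Option σ) ℝ) :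
    ∫ x, fderiv ℝ ψ (S.φ x) v * S.locVal B x p ∂m =
      ∫ x, ψ (S.φ x) * S.locVal B x (S.adjDir v p) ∂m := by
  have e1 : ∀ x, fderiv ℝ ψ (S.φ x) v * S.locVal B x p =
      ∑ i, v i * (fderiv ℝ ψ (S.φ x) (Pi.single i 1) * S.locVal B x p) := fun x => by
    have := LinearMap.pi_apply_eq_sum_univ (fderiv ℝ ψ (S.φ x) : (κ → ℝ) →ₗ[ℝ] ℝ) v
    simp only [ContinuousLinearMap.coe_coe, smul_eq_mul] at this
    rw [this, Finset.sum_mul]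
    refine Finset.sum_congr rfl fun i _ => ?_
    rw [mul_assoc]
    congr 3
    funext j
    simp [Pi.single_apply, eq_comm]
  have e2 : ∀ x, ψ (S.φ x) * S.locVal B x (S.adjDir v p) =
      ∑ i, v i * (ψ (S.φ x) * S.locVal B x (S.adj i p)) := fun x => by
    simp only [adjDir, LinearMap.sum_apply, LinearMap.smul_apply, map_sum, map_smul, smul_eq_mul,
      Finset.mul_sum]
    exact Finset.sum_congr rfl fun i _ => by ring
  have hψ' : Continuous (fderiv ℝ ψ) := hψ.continuous_fderiv one_ne_zero
  obtain ⟨D, hD, bD⟩ := S.bounded_comp_φ hψ'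
  obtain ⟨D', hD', bD'⟩ := S.bounded_comp_φ hψ.continuous
  simp only [e1, e2]
  rw [integral_finsetSum, integral_finsetSum]
  · refine Finset.sum_congr rfl fun i _ => ?_
    rw [integral_const_mul, integral_const_mul, S.integral_fderiv_mul_locVal hB hδ hlow hψ hsupp]
  · intro i _
    obtain ⟨E, hE, bE⟩ := S.bounded_locVal hδ hlow (S.adj i p)
    refine (Integrable.of_bound (C := D' * E)
      ((hψ.continuous.measurable.comp S.measurable_φ).mul
        (S.measurable_locVal hB _)).aestronglyMeasurable
      (Eventually.of_forall fun x => ?_)).const_mul _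
    rw [Pi.mul_apply, norm_mul]
    exact mul_le_mul (bD' x) (bE x) (abs_nonneg _) hD'
  · intro i _
    obtain ⟨E, hE, bE⟩ := S.bounded_locVal hδ hlow p
    refine (Integrable.of_bound (C := D * ‖(Pi.single i 1 : κ → ℝ)‖ * E)
      (((hψ'.clm_apply continuous_const).measurable.comp S.measurable_φ).mul
        (S.measurable_locVal hB _)).aestronglyMeasurable
      (Eventually.of_forall fun x => ?_)).const_mul _
    rw [Pi.mul_apply, norm_mul]
    exact mul_le_mul ((ContinuousLinearMap.le_opNorm _ _).trans
      (mul_le_mul_of_nonneg_right (bD _) (norm_nonneg _))) (bE x) (abs_nonneg _) (by positivity)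

/-- Iterated adjoint coordinate derivatives of `1`, indexed by words. -/
def wordPoly : ∀ k : ℕ, (Fin k → κ) → MvPolynomial (Option σ) ℝ
  | 0, _ => 1
  | k + 1, w => S.adj (w 0) (wordPoly k (Fin.tail w))

/-- Words are used instead of multi-indices because the operators `adj i` are not known to commute.
-/
theorem adjDir_iterate (v : κ → ℝ) (k : ℕ) :
    (S.adjDir v)^[k] 1 = ∑ w : Fin k → κ, (∏ i, v (w i)) • S.wordPoly k w := by
  induction k with
  | zero => simp [wordPoly]
  | succ k ih =>
    rw [Function.iterate_succ_apply', ih, ← Equiv.sum_comp (Fin.consEquiv fun _ => κ)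
      (fun w : Fin (k + 1) → κ => (∏ i, v (w i)) • S.wordPoly (k + 1) w), Fintype.sum_prod_type]
    simp only [adjDir, LinearMap.sum_apply, LinearMap.smul_apply, map_sum, map_smul,
      Finset.smul_sum]
    rw [Finset.sum_comm]
    refine Finset.sum_congr rfl fun i _ => Finset.sum_congr rfl fun w _ => ?_
    rw [smul_comm]
    simp [wordPoly, Fin.consEquiv, Fin.prod_univ_succ, mul_smul]

/-- Each `adj i` raises the degree by a fixed amount and multiplies the sum of coefficients by a
constant times the current degree, which is linear in the number of steps. Hence `k` steps cost a
geometric factor times `k!`, the growth of derivatives of an analytic function. -/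
theorem exists_abs_locVal_wordPoly_le [Finite σ] {δ : ℝ} (hδ : 0 < δ)
    (hlow : ∀ x, S.φ x ∈ B → δ ≤ S.val x S.disc) :
    ∃ M, 0 ≤ M ∧ ∀ k w x, |S.locVal B x (S.wordPoly k w)| ≤ M ^ k * k.factorial := by
  obtain ⟨N₁, c₁, hc₁, h₁⟩ := PolyBound.exists_uniform_bound
    (fun q : ι × Option σ => S.locDeriv q.1 q.2)
  obtain ⟨N₂, c₂, hc₂, h₂⟩ := PolyBound.exists_uniform_bound
    (fun q : κ × ι => MvPolynomial.rename some (S.coef q.1 q.2) * MvPolynomial.X none)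
  choose C hC using S.bounded_locGen hδ hlow
  have := Fintype.ofFinite σ
  set R : ℝ := 1 + ∑ k, |C k| with hR
  have hR1 : 1 ≤ R := le_add_of_nonneg_right (Finset.sum_nonneg fun _ _ => abs_nonneg _)
  have hu : ∀ k x, |S.locGen B k x| ≤ R := fun k x => by
    have := Finset.single_le_sum (f := fun k => |C k|) (fun _ _ => abs_nonneg _)
      (Finset.mem_univ k)
    have h2 := (hC k x).trans (le_abs_self _)
    linarith
  -- `N₂` is the degree gained by multiplying with the coefficient, `N₁` the degree gained by the
  -- derivation. The factor `D + 1` in `A` bounds the degree `N₂ + N` of the differentiated product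
  -- by `(D + 1) * (k + 1)`.
  set D := N₁ + N₂ with hD
  set A : ℝ := Fintype.card ι * (c₁ * (D + 1) * c₂) with hA
  have hA0 : 0 ≤ A := by positivity
  have hstep : ∀ (N : ℕ) (c : ℝ) (p : MvPolynomial (Option σ) ℝ) (i : κ) (k : ℕ), N ≤ D * k →
      PolyBound N c p → PolyBound (D * (k + 1)) (A * (k + 1) * c) (S.adj i p) := by
    intro N c p i k hN hp
    rw [adj_apply]
    have hc := hp.nonneg
    have h3 : ∀ a ∈ (Finset.univ : Finset ι), PolyBound (D * (k + 1))
        (c₁ * (D + 1) * c₂ * (k + 1) * c)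
        (S.locL a (MvPolynomial.rename some (S.coef i a) * MvPolynomial.X none * p)) := fun a _ => by
      refine (((h₂ (i, a)).mul hp).derivation (d := S.locDeriv a)
        (fun k => h₁ (a, k)) hc₁).mono (by rw [mul_add]; omega) ?_
      have hN' : ((N₂ + N : ℕ) : ℝ) ≤ (D + 1) * (k + 1) := by
        have : N₂ + N ≤ (D + 1) * (k + 1) := by nlinarith
        exact_mod_cast this
      calc c₁ * ((N₂ + N : ℕ) : ℝ) * (c₂ * c) ≤ c₁ * ((D + 1) * (k + 1)) * (c₂ * c) := by gcongr
        _ = _ := by ring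
    refine (PolyBound.sum _ h3).neg.mono le_rfl (le_of_eq ?_)
    simp only [Finset.sum_const, Finset.card_univ, nsmul_eq_mul, hA]
    ring
  have hword : ∀ k (w : Fin k → κ), PolyBound (D * k) (A ^ k * k.factorial) (S.wordPoly k w) := by
    intro k
    induction k with
    | zero =>
      intro w
      rw [wordPoly, ← MvPolynomial.C_1]
      exact .const (by simp)
    | succ k ih =>
      intro w
      rw [wordPoly]
      refine (hstep _ _ _ _ k le_rfl (ih (Fin.tail w))).mono le_rfl (le_of_eq ?_)
      rw [Nat.factorial_succ]
      push_cast
      ring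
  refine ⟨A * R ^ D, by positivity, fun k w x => ?_⟩
  refine ((hword k w).abs_aeval_le hR1 (fun k => hu k x)).trans (le_of_eq ?_)
  rw [mul_pow A, ← pow_mul]
  ring

end PolyFlow

end

/-! ### Translations as power series, and the analytic density. -/

section

namespace PolyFlow

variable {X : Type*} [MeasurableSpace X] {m : Measure X} {ι σ κ : Type*} [Fintype ι]
  [Fintype κ] [DecidableEq κ] (S : PolyFlow m ι σ κ)

/-- Translations act on the image measure through a convergent power series. -/
theorem hasSum_integral_translate [IsProbabilityMeasure m] {c₀ : κ → ℝ}
    {r δ M : ℝ} (hr : 0 < r) (hδ : 0 < δ)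
    (hlow : ∀ x, S.φ x ∈ Metric.ball c₀ (2 * r) → δ ≤ S.val x S.disc)
    (hM : 0 ≤ M)
    (hword : ∀ k w x, |S.locVal (Metric.ball c₀ (2 * r)) x (S.wordPoly k w)| ≤ M ^ k * k.factorial)
    {ψ : (κ → ℝ) → ℝ} (hψ : ContDiff ℝ ∞ ψ) (hc : HasCompactSupport ψ)
    (hsupp : tsupport ψ ⊆ Metric.ball c₀ r) {v : κ → ℝ} (hv : ‖v‖ < r)
    (hMv : M * Fintype.card κ * ‖v‖ < 1) :
    HasSum (fun k : ℕ => (k.factorial : ℝ)⁻¹ * ∑ w : Fin k → κ, (∏ i, v (w i)) *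
      ∫ x, ψ (S.φ x) * S.locVal (Metric.ball c₀ (2 * r)) x (S.wordPoly k w) ∂m)
      (∫ x, ψ (S.φ x + v) ∂m) := by
  set B := Metric.ball c₀ (2 * r) with hBdef
  have hB : IsOpen B := Metric.isOpen_ball
  have hψ1 : ContDiff ℝ 1 ψ := hψ.of_le (by exact_mod_cast le_top)
  obtain ⟨P, hP⟩ := hc.exists_bound_of_continuous hψ.continuous
  have hP0 : 0 ≤ P := (norm_nonneg _).trans (hP 0)
  have hexp : ∀ k x, S.locVal B x ((S.adjDir v)^[k] 1) =
      ∑ w : Fin k → κ, (∏ i, v (w i)) * S.locVal B x (S.wordPoly k w) := fun k x => by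
    rw [adjDir_iterate]
    simp
  have hbd : ∀ k x, |S.locVal B x ((S.adjDir v)^[k] 1)| ≤
      (M * Fintype.card κ * ‖v‖) ^ k * k.factorial := fun k x => by
    rw [hexp]
    refine (Finset.abs_sum_le_sum_abs _ _).trans ?_
    have : ∀ w : Fin k → κ, |(∏ i, v (w i)) * S.locVal B x (S.wordPoly k w)| ≤
        ‖v‖ ^ k * (M ^ k * k.factorial) := fun w => by
      rw [abs_mul]
      refine mul_le_mul ?_ (hword k w x) (abs_nonneg _) (by positivity)
      rw [Finset.abs_prod]
      refine (Finset.prod_le_prod (fun _ _ => abs_nonneg _)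
        fun i _ => norm_le_pi_norm v (w i)).trans (le_of_eq ?_)
      simp
    refine (Finset.sum_le_sum fun w _ => this w).trans (le_of_eq ?_)
    simp only [Finset.sum_const, Finset.card_univ, Fintype.card_fun, Fintype.card_fin, nsmul_eq_mul]
    push_cast
    ring
  -- Taylor expansion in `t` of the integral of `ψ (φ + t v)`; each derivative in `t` is moved from
  -- `ψ` onto the weight by one more application of `adjDir v`.
  have key := hasSum_taylor (M := P) (q := M * Fintype.card κ * ‖v‖) (by positivity) hMv
    (I := fun k t => ∫ x, ψ (S.φ x + t • v) * S.locVal B x ((S.adjDir v)^[k] 1) ∂m)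
    (fun k t ht => ?_) (fun k t ht => ?_)
  · simp only [zero_smul, add_zero, Function.iterate_zero, id_eq, map_one, mul_one, one_smul] at key
    convert key using 2 with k
    rw [div_eq_inv_mul]
    congr 1
    simp only [hexp, Finset.mul_sum]
    rw [integral_finsetSum]
    · refine Finset.sum_congr rfl fun w _ => ?_
      rw [← integral_const_mul]
      exact integral_congr_ae (Eventually.of_forall fun x => by ring)
    · intro w _
      refine Integrable.of_bound (C := P * (|∏ i, v (w i)| * (M ^ k * k.factorial)))
        ((hψ.continuous.measurable.comp S.measurable_φ).mul
          (measurable_const.mul (S.measurable_locVal hB _))).aestronglyMeasurable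
        (Eventually.of_forall fun x => ?_)
      rw [norm_mul, norm_mul]
      exact mul_le_mul (hP _) (mul_le_mul_of_nonneg_left (hword k w x) (abs_nonneg _))
        (by positivity) hP0
  · have h1 := hasDerivAt_integral_translate (m := m) S.measurable_φ hψ1 hc
      (S.measurable_locVal hB ((S.adjDir v)^[k] 1)) (hbd k) v t
    refine h1.congr_deriv ?_
    -- The ball on which `disc` is controlled has twice the radius of the one supporting `ψ`: this
    -- leaves room for all translates by `t • v` with `‖v‖ < r`.
    have hs : tsupport (fun y => ψ (y + t • v)) ⊆ B := by
      have h2 : tsupport (fun y => ψ (y + t • v)) ⊆ (fun y => y + t • v) ⁻¹' tsupport ψ :=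
        closure_minimal (fun y hy => subset_tsupport ψ hy)
          ((isClosed_tsupport ψ).preimage (by fun_prop))
      intro y hy
      have h3 := hsupp (h2 hy)
      rw [Metric.mem_ball, dist_eq_norm] at h3 ⊢
      have h4 : ‖t • v‖ < r := by
        rw [norm_smul, Real.norm_eq_abs, abs_of_nonneg ht.1]
        nlinarith [ht.2, norm_nonneg v]
      calc ‖y - c₀‖ = ‖(y + t • v - c₀) - t • v‖ := by congr 1; abel
        _ ≤ ‖y + t • v - c₀‖ + ‖t • v‖ := norm_sub_le _ _
        _ < 2 * r := by linarith
    have h5 := S.integral_fderiv_mul_locVal_dir hB hδ hlow (ψ := fun y => ψ (y + t • v))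
      (hψ1.comp (contDiff_id.add contDiff_const)) hs v ((S.adjDir v)^[k] 1)
    have h2 : ∀ y, fderiv ℝ (fun y => ψ (y + t • v)) y = fderiv ℝ ψ (y + t • v) := fun y =>
      fderiv_comp_add_right (t • v)
    simp only [h2] at h5
    rw [h5, Function.iterate_succ_apply']
  · have h1 := norm_integral_le_of_norm_le_const (μ := m)
      (f := fun x => ψ (S.φ x + t • v) * S.locVal B x ((S.adjDir v)^[k] 1))
      (C := P * ((M * Fintype.card κ * ‖v‖) ^ k * k.factorial))
      (Eventually.of_forall fun x => by
        rw [norm_mul]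
        exact mul_le_mul (hP _) (hbd k x) (abs_nonneg _) hP0)
    simpa using h1

set_option maxHeartbeats 1000000 in
/-- Near a point at which the Gram determinant is bounded below, the density of the image measure
coincides almost everywhere with a real analytic function. -/
theorem exists_analyticAt_density [IsProbabilityMeasure m] [Finite σ]
    (hac : m.map S.φ ≪ volume) {c₀ : κ → ℝ}
    {r δ : ℝ} (hr : 0 < r) (hδ : 0 < δ)
    (hlow : ∀ x, S.φ x ∈ Metric.ball c₀ (2 * r) → δ ≤ S.val x S.disc) :
    ∃ a : (κ → ℝ) → ℝ, AnalyticAt ℝ a c₀ ∧ ∃ ε > 0, ∀ᵐ y, y ∈ Metric.ball c₀ ε →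
      ((m.map S.φ).rnDeriv volume y).toReal = a y := by
  have : IsProbabilityMeasure (m.map S.φ) :=
    Measure.isProbabilityMeasure_map S.measurable_φ.aemeasurable
  obtain ⟨M, hM, hword⟩ := S.exists_abs_locVal_wordPoly_le hδ hlow
  set B := Metric.ball c₀ (2 * r) with hBdef
  have hB : IsOpen B := Metric.isOpen_ball
  -- Replacing the weights on `X` by their conditional expectations given `φ` turns the integrals
  -- over `X` into integrals over the target, where they can be compared with the density.
  choose F mF bF hF using fun k (w : Fin k → κ) => exists_conditional_expectation (m := m)
    S.measurable_φ (S.measurable_locVal hB (S.wordPoly k w)) (by positivity) (hword k w)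
  set f : (κ → ℝ) → ℝ := fun y => ((m.map S.φ).rnDeriv volume y).toReal with hf
  have mf : Measurable f := (Measure.measurable_rnDeriv _ _).ennreal_toReal
  have if' : Integrable f := Measure.integrable_toReal_rnDeriv
  have hfd : ∀ g : (κ → ℝ) → ℝ, ∫ y, g y ∂(m.map S.φ) = ∫ y, g y * f y := fun g => by
    rw [← integral_rnDeriv_smul hac]
    exact integral_congr_ae (Eventually.of_forall fun y => by simp [f, mul_comm])
  set Q : ℝ := M * Fintype.card κ with hQ
  have hQ0 : 0 ≤ Q := by positivity
  -- `s` lies inside the radius of convergence of all the series `p y` at once, and within the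
  -- translations allowed by `r`.
  obtain ⟨s, hs0, hsr, hQs⟩ : ∃ s > 0, s ≤ r ∧ Q * s < 1 := by
    refine ⟨min r (1 / (2 * (Q + 1))), lt_min hr (by positivity), min_le_left _ _, ?_⟩
    calc Q * min r (1 / (2 * (Q + 1))) ≤ Q * (1 / (2 * (Q + 1))) := by
          gcongr; exact min_le_right _ _
      _ < 1 := by
        rw [mul_one_div, div_lt_one (by positivity)]
        linarith
  obtain ⟨p, bp, pv⟩ : ∃ p : (κ → ℝ) → FormalMultilinearSeries ℝ (κ → ℝ) ℝ,
      (∀ y k, ‖p y k‖ ≤ Q ^ k) ∧ ∀ y k v, p y k (fun _ => v) =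
        (k.factorial : ℝ)⁻¹ * ∑ w : Fin k → κ, F k w y * ∏ i, v (w i) :=
    ⟨fun y => wordSeries fun k w => F k w y,
      fun y k => norm_wordSeries_le hM (fun k w => bF k w y) k, fun y k v => wordSeries_apply _ _ _⟩
  have bpv : ∀ y k v, ‖p y k (fun _ => v)‖ ≤ (Q * ‖v‖) ^ k := fun y k v => by
    refine ((p y k).le_opNorm _).trans ?_
    rw [mul_pow]
    simpa using mul_le_mul_of_nonneg_right (bp y k) (pow_nonneg (norm_nonneg v) k)
  have hsm : ∀ y v, ‖v‖ < s → HasSum (fun k => p y k (fun _ => v)) ((p y).sum v) := fun y v hv => by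
    refine Summable.hasSum (Summable.of_norm_bounded (g := fun k => (Q * ‖v‖) ^ k)
      (summable_geometric_of_lt_one (by positivity) ?_) (bpv y · v))
    exact lt_of_le_of_lt (by gcongr) hQs
  have mpv : ∀ k, Measurable fun q : (κ → ℝ) × (κ → ℝ) => p q.1 k (fun _ => q.2) := fun k => by
    simp only [pv]
    refine measurable_const.mul (Finset.measurable_fun_sum _ fun w _ => ?_)
    refine ((mF k w).comp measurable_fst).mul (Finset.measurable_fun_prod _ fun i _ => ?_)
    exact (measurable_pi_apply (w i)).comp measurable_snd
  have mpv' : ∀ k v, Measurable fun y => p y k (fun _ => v) := fun k v =>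
    (mpv k).comp (measurable_id.prodMk (measurable_const (a := v)))
  -- the transformation law of the density under translations
  have hae : ∀ v, ‖v‖ < s → ∀ᵐ y, y ∈ Metric.ball c₀ r → f (y - v) = (p y).sum v * f y := by
    intro v hv
    have hQv : Q * ‖v‖ < 1 := lt_of_le_of_lt (by gcongr) hQs
    have msum : Measurable fun y => ∑' k, p y k (fun _ => v) := by
      refine measurable_of_tendsto_metrizable
        (f := fun N y => ∑ k ∈ Finset.range N, p y k (fun _ => v)) (fun N => ?_)
        (tendsto_pi_nhds.2 fun y => (hsm y v hv).tendsto_sum_nat)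
      exact Finset.measurable_fun_sum _ fun k _ => mpv' k v
    have bsum : ∀ y, ‖(p y).sum v‖ ≤ (1 - Q * ‖v‖)⁻¹ := fun y =>
      tsum_of_norm_bounded (hasSum_geometric_of_lt_one (by positivity) hQv) (bpv y · v)
    have i1 : Integrable fun y => f (y - v) := if'.comp_sub_right v
    have i2 : Integrable fun y => (p y).sum v * f y :=
      if'.bdd_mul (c := (1 - Q * ‖v‖)⁻¹) msum.aestronglyMeasurable (Eventually.of_forall bsum)
    -- It suffices to test against smooth `ψ` supported in the ball. One side is the translate of
    -- the law; the other is the power series of `hasSum_integral_translate`, summed under the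
    -- integral by dominated convergence.
    have key := Metric.isOpen_ball.ae_eq_zero_of_integral_contDiff_smul_eq_zero (μ := volume)
      (U := Metric.ball c₀ r) (f := fun y => f (y - v) - (p y).sum v * f y)
      ((i1.sub i2).locallyIntegrable.locallyIntegrableOn _) fun ψ hψ hc hsupp => ?_
    · filter_upwards [key] with y hy hyB
      exact sub_eq_zero.1 (hy hyB)
    obtain ⟨P, hP⟩ := hc.exists_bound_of_continuous hψ.continuous
    have hP0 : 0 ≤ P := (norm_nonneg _).trans (hP 0)
    have mψ : Measurable ψ := hψ.continuous.measurable
    have e1 := S.hasSum_integral_translate hr hδ hlow hM hword hψ hc hsupp (hv.trans_le hsr) hQv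
    have e2 : ∫ x, ψ (S.φ x + v) ∂m = ∫ y, ψ y * f (y - v) := by
      rw [← integral_map (f := fun y => ψ (y + v)) S.measurable_φ.aemeasurable
        (mψ.comp (measurable_id.add_const v)).aestronglyMeasurable, hfd,
        ← integral_sub_right_eq_self _ v]
      simp
    have e3 : ∀ k : ℕ, (k.factorial : ℝ)⁻¹ * ∑ w : Fin k → κ, (∏ i, v (w i)) *
        ∫ x, ψ (S.φ x) * S.locVal B x (S.wordPoly k w) ∂m =
        ∫ y, ψ y * p y k (fun _ => v) * f y := by
      intro k
      have e4 : ∀ y, ψ y * p y k (fun _ => v) * f y = (k.factorial : ℝ)⁻¹ *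
          ∑ w : Fin k → κ, (∏ i, v (w i)) * (ψ y * F k w y * f y) := fun y => by
        rw [pv, mul_left_comm, mul_assoc, Finset.mul_sum, Finset.sum_mul]
        congr 1
        exact Finset.sum_congr rfl fun w _ => by ring
      simp only [e4]
      rw [integral_const_mul, integral_finsetSum]
      · congr 1
        refine Finset.sum_congr rfl fun w _ => ?_
        rw [integral_const_mul, hF k w ψ mψ ⟨P, hP⟩, hfd]
      · intro w _
        refine (if'.bdd_mul (c := P * (M ^ k * k.factorial))
          (mψ.mul (mF k w)).aestronglyMeasurable (Eventually.of_forall fun y => ?_)).const_mul _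
        rw [Pi.mul_apply, norm_mul]
        exact mul_le_mul (hP y) (bF k w y) (abs_nonneg _) hP0
    rw [funext e3] at e1
    have e5 : HasSum (fun k => ∫ y, ψ y * p y k (fun _ => v) * f y)
        (∫ y, ψ y * (p y).sum v * f y) := by
      refine hasSum_integral_of_dominated_convergence
        (bound := fun k y => P * (Q * ‖v‖) ^ k * ‖f y‖) (fun k => ?_)
        (fun k => Eventually.of_forall fun y => ?_) (Eventually.of_forall fun y => ?_) ?_
        (Eventually.of_forall fun y => ?_)
      · exact ((mψ.mul (mpv' k v)).mul mf).aestronglyMeasurable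
      · rw [norm_mul, norm_mul]
        gcongr
        · exact hP y
        · exact bpv y k v
      · exact ((summable_geometric_of_lt_one (by positivity) hQv).mul_left P).mul_right _
      · simp only [tsum_mul_right]
        exact if'.norm.const_mul _
      · exact ((hsm y v hv).mul_left _).mul_right _
    have e6 := e1.unique e5
    rw [e2] at e6
    have i3 : Integrable fun y => ψ y * f (y - v) :=
      i1.bdd_mul (c := P) mψ.aestronglyMeasurable (Eventually.of_forall hP)
    have i4 : Integrable fun y => ψ y * ((p y).sum v * f y) :=
      i2.bdd_mul (c := P) mψ.aestronglyMeasurable (Eventually.of_forall hP)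
    simp only [smul_eq_mul, mul_sub]
    rw [integral_sub i3 i4, e6, sub_eq_zero]
    exact integral_congr_ae (Eventually.of_forall fun y => by ring)
  -- choose a good base point by Fubini
  have hfub : ∀ᵐ y : κ → ℝ, ∀ᵐ v : κ → ℝ, y ∈ Metric.ball c₀ r → ‖v‖ < s →
      f (y - v) = (p y).sum v * f y := by
    -- Cutting the sum off at `‖v‖ < s` makes the partial sums converge at every pair `(y, v)`,
    -- which gives the joint measurability required by Fubini.
    let g : (κ → ℝ) × (κ → ℝ) → ℝ := fun q => if ‖q.2‖ < s then (p q.1).sum q.2 else 0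
    have mg : Measurable g := by
      refine measurable_of_tendsto_metrizable
        (f := fun N q => if ‖q.2‖ < s then ∑ k ∈ Finset.range N, p q.1 k (fun _ => q.2) else 0)
        (fun N => ?_) (tendsto_pi_nhds.2 fun q => ?_)
      · exact Measurable.ite (measurableSet_lt (measurable_snd.norm) measurable_const)
          (Finset.measurable_fun_sum _ fun k _ => mpv k) measurable_const
      · by_cases hq : ‖q.2‖ < s
        · simpa only [g, hq, if_true] using (hsm q.1 q.2 hq).tendsto_sum_nat
        · simp [g, hq]
    have hms : MeasurableSet {q : (κ → ℝ) × (κ → ℝ) | q.1 ∈ Metric.ball c₀ r → ‖q.2‖ < s →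
        f (q.1 - q.2) = g q * f q.1} := by
      have m1 : MeasurableSet {q : (κ → ℝ) × (κ → ℝ) | f (q.1 - q.2) = g q * f q.1} :=
        measurableSet_eq_fun (mf.comp (measurable_fst.sub measurable_snd))
          (mg.mul (mf.comp measurable_fst))
      have m2 : MeasurableSet {q : (κ → ℝ) × (κ → ℝ) | q.1 ∈ Metric.ball c₀ r} :=
        measurable_fst measurableSet_ball
      have m3 : MeasurableSet {q : (κ → ℝ) × (κ → ℝ) | ‖q.2‖ < s} :=
        measurableSet_lt measurable_snd.norm measurable_const
      exact m2.imp (m3.imp m1)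
    have h1 : ∀ᵐ v : κ → ℝ, ∀ᵐ y : κ → ℝ, y ∈ Metric.ball c₀ r → ‖v‖ < s →
        f (y - v) = g (y, v) * f y := by
      refine Eventually.of_forall fun v => ?_
      by_cases hv : ‖v‖ < s
      · filter_upwards [hae v hv] with y hy hyB _
        simpa [g, hv] using hy hyB
      · exact Eventually.of_forall fun y _ h => absurd h hv
    have h2 := (Measure.ae_ae_comm (μ := (volume : Measure (κ → ℝ)))
      (ν := (volume : Measure (κ → ℝ)))
      (p := fun y v => y ∈ Metric.ball c₀ r → ‖v‖ < s → f (y - v) = g (y, v) * f y) hms).2 h1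
    filter_upwards [h2] with y hy
    filter_upwards [hy] with v hv hyB hvs
    simpa [g, hvs] using hv hyB hvs
  -- With `y₀` within `s / 2` of `c₀`, every `z` within `s / 2` of `c₀` has the form `y₀ - v` with
  -- `‖v‖ < s`.
  obtain ⟨y₀, hy₀, hy₀'⟩ : ∃ y₀ ∈ Metric.ball c₀ (s / 2), ∀ᵐ v : κ → ℝ,
      y₀ ∈ Metric.ball c₀ r → ‖v‖ < s → f (y₀ - v) = (p y₀).sum v * f y₀ := by
    by_contra hcon
    simp only [not_exists, not_and] at hcon
    have h0 : volume (Metric.ball c₀ (s / 2)) = 0 := by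
      rw [measure_eq_zero_iff_ae_notMem]
      filter_upwards [hfub] with y hy hyB
      exact hcon y hyB hy
    exact (Metric.measure_ball_pos volume c₀ (half_pos hs0)).ne' h0
  have hrad : ENNReal.ofReal s ≤ (p y₀).radius := by
    refine (p y₀).le_radius_of_bound 1 (r := s.toNNReal) fun k => ?_
    rw [Real.coe_toNNReal s hs0.le]
    calc ‖p y₀ k‖ * s ^ k ≤ Q ^ k * s ^ k := by gcongr; exact bp y₀ k
      _ = (Q * s) ^ k := (mul_pow _ _ _).symm
      _ ≤ 1 := pow_le_one₀ (by positivity) hQs.le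
  have hpow := (p y₀).hasFPowerSeriesOnBall
    (lt_of_lt_of_le (by simpa using hs0) hrad)
  -- Substitute `v = y₀ - z` in the translation law: `f z` is the fixed power series of `y₀`
  -- evaluated at `y₀ - z`, times the constant `f y₀`.
  refine ⟨fun z => (p y₀).sum (y₀ - z) * f y₀, ?_, s / 2, half_pos hs0, ?_⟩
  · have h1 : AnalyticAt ℝ (p y₀).sum (y₀ - c₀) := by
      refine hpow.analyticAt_of_mem ?_
      refine Metric.eball_subset_eball hrad ?_
      rw [Metric.eball_ofReal, mem_ball_zero_iff, ← dist_eq_norm]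
      exact (Metric.mem_ball.1 hy₀).trans (by linarith)
    have h2 : AnalyticAt ℝ (fun z : κ → ℝ => y₀ - z) c₀ := analyticAt_const.sub analyticAt_id
    exact (AnalyticAt.comp (g := (p y₀).sum) h1 h2).mul analyticAt_const
  · have h3 := (Measure.measurePreserving_sub_left (volume : Measure (κ → ℝ)) y₀).quasiMeasurePreserving.ae
      hy₀'
    filter_upwards [h3] with z hz hzB
    have h4 : ‖y₀ - z‖ < s := by
      rw [← dist_eq_norm]
      have := dist_triangle_right y₀ z c₀
      rw [Metric.mem_ball] at hzB hy₀
      linarith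
    simpa [f] using hz (Metric.ball_subset_ball (by linarith) hy₀) h4

end PolyFlow

end

section

/-! ### Measures determined by smooth test functions -/

section Smooth

variable {V : Type*} [NormedAddCommGroup V] [NormedSpace ℝ V] [FiniteDimensional ℝ V]
  [MeasurableSpace V] [BorelSpace V]

/-- Indicators of bounded open sets are dominated limits of test functions, and bounded open sets
determine an outer regular measure. -/
theorem measure_ext_of_contDiff {μ ν : Measure V} [IsFiniteMeasureOnCompacts μ]
    [IsFiniteMeasureOnCompacts ν]
    (h : ∀ ψ : V → ℝ, ContDiff ℝ ∞ ψ → HasCompactSupport ψ → ∫ y, ψ y ∂μ = ∫ y, ψ y ∂ν) :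
    μ = ν := by
  have : ProperSpace V := FiniteDimensional.proper ℝ V
  refine Measure.OuterRegular.ext_isOpen_isBounded fun U hU hb => ?_
  obtain ⟨ψ, hψ, h01, hz, hlim⟩ := exists_contDiff_tendsto_indicator hU
  have key : ∀ (μ : Measure V) [IsFiniteMeasureOnCompacts μ],
      Tendsto (fun k => ∫ y, ψ k y ∂μ) atTop (𝓝 (μ.real U)) := by
    intro μ _
    rw [← integral_indicator_one hU.measurableSet]
    refine tendsto_integral_of_dominated_convergence (U.indicator 1)
      (fun k => (hψ k).continuous.aestronglyMeasurable)
      ((integrable_indicator_iff hU.measurableSet).2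
        (integrableOn_const (C := (1 : ℝ)) hb.measure_lt_top.ne))
      (fun k => Eventually.of_forall fun y => ?_) (Eventually.of_forall fun y => ?_)
    · rw [Real.norm_eq_abs, abs_of_nonneg (h01 k y).1]
      by_cases hy : y ∈ U
      · simpa [hy] using (h01 k y).2
      · simp [hy, hz k y hy]
    · by_cases hy : y ∈ U
      · simpa [hy] using hlim y hy
      · simp [hy, hz _ y hy]
  have hc : ∀ k, HasCompactSupport (ψ k) := fun k => by
    refine HasCompactSupport.of_support_subset_isCompact hb.isCompact_closure fun y hy => ?_
    by_contra h
    exact hy (hz k y fun hyU => h (subset_closure hyU))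
  have e : μ.real U = ν.real U := by
    refine tendsto_nhds_unique (key μ) ?_
    simp only [h _ (hψ _) (hc _)]
    exact key ν
  exact (measureReal_eq_measureReal_iff hb.measure_lt_top.ne hb.measure_lt_top.ne).1 e

/-- A measure annihilating all derivatives of test functions is translation invariant. -/
theorem isAddLeftInvariant_of_integral_fderiv_eq_zero {μ : Measure V}
    [IsFiniteMeasureOnCompacts μ]
    (h : ∀ ψ : V → ℝ, ContDiff ℝ ∞ ψ → HasCompactSupport ψ → ∀ v, ∫ y, fderiv ℝ ψ y v ∂μ = 0) :
    μ.IsAddLeftInvariant := by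
  have : ProperSpace V := FiniteDimensional.proper ℝ V
  refine ⟨fun v => ?_⟩
  have : IsFiniteMeasureOnCompacts (μ.map (v + ·)) := ⟨fun K hK => by
    rw [Measure.map_apply (measurable_const_add v) hK.measurableSet]
    exact ((Homeomorph.addLeft v).isCompact_preimage.2 hK).measure_lt_top⟩
  refine measure_ext_of_contDiff fun ψ hψ hc => ?_
  rw [integral_map (measurable_const_add v).aemeasurable hψ.continuous.aestronglyMeasurable]
  have hψ1 : ContDiff ℝ 1 ψ := hψ.of_le (by exact_mod_cast le_top)
  obtain ⟨R, hR⟩ := hc.isCompact.isBounded.subset_closedBall (0 : V)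
  -- All translates of `ψ` along the segment vanish outside `B`, so the possibly infinite measure
  -- may be replaced by its finite restriction when differentiating under the integral.
  set B := Metric.closedBall (0 : V) (R + 2 * ‖v‖) with hB
  have hfin : IsFiniteMeasure (μ.restrict B) :=
    ⟨by simpa using (isCompact_closedBall _ _).measure_lt_top⟩
  have hts : ∀ t ∈ Set.Icc (0 : ℝ) 1, ∀ y ∉ B, y + t • v ∉ tsupport ψ := by
    intro t ht y hy hmem
    have h1 := hR hmem
    rw [mem_closedBall_zero_iff] at h1
    apply hy
    rw [hB, mem_closedBall_zero_iff]
    have h2 : ‖t • v‖ ≤ ‖v‖ := by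
      rw [norm_smul, Real.norm_eq_abs, abs_of_nonneg ht.1]
      nlinarith [ht.2, norm_nonneg v]
    calc ‖y‖ = ‖(y + t • v) - t • v‖ := by congr 1; abel
      _ ≤ ‖y + t • v‖ + ‖t • v‖ := norm_sub_le _ _
      _ ≤ R + 2 * ‖v‖ := by linarith [norm_nonneg v]
  have hI : ∀ t ∈ Set.Icc (0 : ℝ) 1, ∫ y in B, ψ (y + t • v) * 1 ∂μ = ∫ y, ψ (y + t • v) ∂μ := by
    intro t ht
    simp only [mul_one]
    refine setIntegral_eq_integral_of_forall_compl_eq_zero fun y hy => ?_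
    exact image_eq_zero_of_notMem_tsupport (hts t ht y hy)
  have hd : ∀ t ∈ Set.Icc (0 : ℝ) 1,
      HasDerivWithinAt (fun t : ℝ => ∫ y in B, ψ (y + t • v) * 1 ∂μ) 0 (Set.Icc 0 1) t := by
    intro t ht
    have h1 := hasDerivAt_integral_translate (m := μ.restrict B) (φ := fun y => y) measurable_id
      hψ1 hc (q := fun _ => 1) measurable_const (C := 1) (by simp) v t
    refine (h1.congr_deriv ?_).hasDerivWithinAt
    have h2 : ∀ y, fderiv ℝ (fun y => ψ (y + t • v)) y = fderiv ℝ ψ (y + t • v) := fun y =>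
      fderiv_comp_add_right (t • v)
    have h3 := h (fun y => ψ (y + t • v)) (hψ.comp (contDiff_id.add contDiff_const))
      (hc.comp_homeomorph (Homeomorph.addRight (t • v))) v
    simp only [h2] at h3
    simp only [mul_one]
    rw [← h3]
    refine setIntegral_eq_integral_of_forall_compl_eq_zero fun y hy => ?_
    have : fderiv ℝ ψ (y + t • v) = 0 := by
      by_contra hne
      exact hts t ht y hy (support_fderiv_subset ℝ hne)
    simp [this]
  have key := norm_image_sub_le_of_norm_deriv_le_segment_01' (C := 0) hd (by simp)
  rw [hI 1 (by simp), hI 0 (by simp)] at key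
  simp only [one_smul, zero_smul, add_zero] at key
  have := sub_eq_zero.1 (norm_le_zero_iff.1 key)
  rw [← this]
  simp only [add_comm]

/-- The integral over a convex set of a derivative of a function vanishing on the boundary. -/
theorem setIntegral_fderiv_eq_zero_of_convex {μ : Measure V} [μ.IsAddHaarMeasure] {C : Set V}
    (hC : Convex ℝ C) (hm : MeasurableSet C) {H : V → ℝ} (hH : ContDiff ℝ 1 H)
    (hc : HasCompactSupport H) (h0 : ∀ x ∈ frontier C, H x = 0) (u : V) :
    ∫ x in C, fderiv ℝ H x u ∂μ = 0 := by
  obtain ⟨L, hL⟩ := ContDiff.lipschitzWith_of_hasCompactSupport hc hH one_ne_zero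
  -- A segment from a point of `C` to a point outside meets the frontier, where `H` vanishes. Hence
  -- cutting `H` off outside `C` keeps it Lipschitz.
  have hcross : ∀ x ∈ C, ∀ y ∉ C, |H x| ≤ L * dist x y := by
    intro x hx y hy
    obtain ⟨z, hz, hzf⟩ : ∃ z ∈ segment ℝ x y, z ∈ frontier C := by
      by_contra! hcon
      have hcov : segment ℝ x y ⊆ interior C ∪ interior Cᶜ := fun z hz => by
        have := hcon z hz
        rw [frontier, Set.mem_sdiff, not_and_not_right] at this
        by_cases hzc : z ∈ closure C
        · exact Or.inl (this hzc)
        · exact Or.inr (by rwa [interior_compl])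
      obtain ⟨z, -, hz1, hz2⟩ := (convex_segment x y).isPreconnected _ _ isOpen_interior
        isOpen_interior hcov
        ⟨x, left_mem_segment ℝ x y, (hcov (left_mem_segment ℝ x y)).resolve_right
          fun h => interior_subset h hx⟩
        ⟨y, right_mem_segment ℝ x y, (hcov (right_mem_segment ℝ x y)).resolve_left
          fun h => hy (interior_subset h)⟩
      exact interior_subset hz2 (interior_subset hz1)
    have h1 := hL.dist_le_mul x z
    rw [h0 z hzf, Real.dist_eq, sub_zero] at h1
    refine h1.trans (mul_le_mul_of_nonneg_left ?_ L.2)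
    have := dist_add_dist_of_mem_segment hz
    linarith [dist_nonneg (x := z) (y := y)]
  have hlip : LipschitzWith L (C.indicator H) := by
    refine LipschitzWith.of_dist_le_mul fun x y => ?_
    by_cases hx : x ∈ C <;> by_cases hy : y ∈ C
    · simpa [hx, hy] using hL.dist_le_mul x y
    · simpa [hx, hy, Real.dist_eq] using hcross x hx y hy
    · simpa [hx, hy, Real.dist_eq, dist_comm] using hcross y hy x hx
    · simp only [hx, hy, not_false_eq_true, Set.indicator_of_notMem, dist_self]
      positivity
  have hcs : HasCompactSupport (C.indicator H) := hc.mono (by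
    intro x hx
    rw [Function.mem_support, Set.indicator_apply_ne_zero] at hx
    exact hx.2)
  -- Integration by parts for Lipschitz functions against the constant `1`; the direction `-u` is
  -- chosen because the formula reverses it.
  have key := LipschitzWith.integral_lineDeriv_mul_eq (μ := μ) (LipschitzWith.const (1 : ℝ))
    hlip hcs (-u)
  have hconst : ∀ (c : ℝ) (x v : V), lineDeriv ℝ (fun _ : V => c) x v = 0 := fun c x v => by
    simp [lineDeriv]
  simp only [hconst, zero_mul, integral_zero, neg_neg, mul_one] at key
  rw [key, ← integral_indicator hm]
  refine integral_congr_ae ?_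
  -- The frontier of a convex set is null, so almost every point is interior to `C` or to its
  -- complement, where the derivative of the cut-off function is evident.
  have hfr : ∀ᵐ x ∂μ, x ∉ frontier C := by
    rw [← measure_eq_zero_iff_ae_notMem]
    exact hC.addHaar_frontier μ
  filter_upwards [hfr] with x hx
  rw [frontier, Set.mem_sdiff, not_and_not_right] at hx
  by_cases hxc : x ∈ closure C
  · have hxi := hx hxc
    rw [Set.indicator_of_mem (interior_subset hxi)]
    have : C.indicator H =ᶠ[𝓝 x] H := by
      filter_upwards [isOpen_interior.mem_nhds hxi] with y hy
      rw [Set.indicator_of_mem (interior_subset hy)]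
    rw [this.lineDeriv_eq, (hH.differentiable one_ne_zero x).lineDeriv_eq_fderiv]
  · rw [Set.indicator_of_notMem fun h => hxc (subset_closure h)]
    have : C.indicator H =ᶠ[𝓝 x] fun _ => 0 := by
      filter_upwards [isClosed_closure.isOpen_compl.mem_nhds hxc] with y hy
      rw [Set.indicator_of_notMem fun h => hy (subset_closure h)]
    rw [this.lineDeriv_eq, hconst]

/-- Two functions that agree almost everywhere near a point at which both are continuous agree at
the point. -/
theorem eq_of_ae_eq_of_continuousAt {μ : Measure V} [μ.IsOpenPosMeasure] {c : V} {b b' : V → ℝ}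
    (hb : ContinuousAt b c) (hb' : ContinuousAt b' c) {r : ℝ} (hr : 0 < r)
    (hae : ∀ᵐ y ∂μ, y ∈ Metric.ball c r → b y = b' y) : b c = b' c := by
  by_contra hne
  have h1 : ∀ᶠ y in 𝓝 c, b y - b' y ≠ 0 :=
    (hb.sub hb').eventually_ne (sub_ne_zero.2 hne)
  obtain ⟨r', hr', hsub⟩ := Metric.eventually_nhds_iff_ball.1 h1
  have h0 : μ (Metric.ball c (min r r')) = 0 := by
    rw [measure_eq_zero_iff_ae_notMem]
    filter_upwards [hae] with y hy hyb
    exact hsub y (Metric.ball_subset_ball (min_le_right _ _) hyb)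
      (sub_eq_zero.2 (hy (Metric.ball_subset_ball (min_le_left _ _) hyb)))
  exact (Metric.measure_ball_pos μ c (lt_min hr hr')).ne' h0

/-- Locally defined analytic versions of a function glue. -/
theorem exists_analytic_version {μ : Measure V} [μ.IsOpenPosMeasure] {f : V → ℝ}
    (mf : Measurable f) (hf : ∀ y, 0 ≤ f y) {s : Set V}
    (h : ∀ c ∈ s, ∃ a : V → ℝ, AnalyticAt ℝ a c ∧ ∃ ε > 0, ∀ᵐ y ∂μ, y ∈ Metric.ball c ε →
      f y = a y) :
    ∃ g : V → ℝ, Measurable g ∧ (∀ y, 0 ≤ g y) ∧ g =ᵐ[μ] f ∧ ∀ c ∈ s, AnalyticAt ℝ g c := by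
  classical
  let O : Set V := {c | ∃ a : V → ℝ, AnalyticAt ℝ a c ∧ ∃ ε > 0, ∀ᵐ y ∂μ, y ∈ Metric.ball c ε →
      f y = a y}
  have hsO : s ⊆ O := h
  choose! a ha ε hε hfa using fun c (hc : c ∈ O) => hc
  -- Each point uses the value of its own local version at itself. Two local versions agree almost
  -- everywhere where both are defined, hence by continuity at the point, so `g` locally coincides
  -- with a single analytic function.
  let g : V → ℝ := fun c => if c ∈ O then a c c else f c
  have hloc : ∀ c ∈ O, ∃ r > 0, ∀ z ∈ Metric.ball c r, z ∈ O ∧ g z = a c z := by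
    intro c hc
    obtain ⟨r, hr, hball⟩ := Metric.eventually_nhds_iff_ball.1 (ha c hc).eventually_analyticAt
    refine ⟨min r (ε c), lt_min hr (hε c hc), fun z hz => ?_⟩
    have hzε : z ∈ Metric.ball c (ε c) := Metric.ball_subset_ball (min_le_right _ _) hz
    have hza := hball z (Metric.ball_subset_ball (min_le_left _ _) hz)
    obtain ⟨η, hη, hηs⟩ := Metric.isOpen_ball.mem_nhds hzε |> Metric.mem_nhds_iff.1
    have hzO : z ∈ O := ⟨a c, hza, η, hη, by
      filter_upwards [hfa c hc] with y hy hyb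
      exact hy (hηs hyb)⟩
    refine ⟨hzO, ?_⟩
    have : g z = a z z := if_pos hzO
    rw [this]
    refine eq_of_ae_eq_of_continuousAt (μ := μ) (ha z hzO).continuousAt hza.continuousAt
      (lt_min hη (hε z hzO)) ?_
    filter_upwards [hfa c hc, hfa z hzO] with y h1 h2 hyb
    rw [← h1 (hηs (Metric.ball_subset_ball (min_le_left _ _) hyb)),
      ← h2 (Metric.ball_subset_ball (min_le_right _ _) hyb)]
  have hOopen : IsOpen O := Metric.isOpen_iff.2 fun c hc => by
    obtain ⟨r, hr, h1⟩ := hloc c hc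
    exact ⟨r, hr, fun z hz => (h1 z hz).1⟩
  have hgan : ∀ c ∈ O, AnalyticAt ℝ g c := fun c hc => by
    obtain ⟨r, hr, h1⟩ := hloc c hc
    refine (ha c hc).congr ?_
    filter_upwards [Metric.ball_mem_nhds c hr] with z hz
    exact (h1 z hz).2.symm
  have hgf : ∀ᵐ y ∂μ, y ∈ O → g y = f y := by
    have hl : ∀ c ∈ O, ∃ r > 0, ∀ᵐ y ∂μ, y ∈ Metric.ball c r → g y = f y := fun c hc => by
      obtain ⟨r, hr, h1⟩ := hloc c hc
      refine ⟨min r (ε c), lt_min hr (hε c hc), ?_⟩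
      filter_upwards [hfa c hc] with y hy hyb
      rw [(h1 y (Metric.ball_subset_ball (min_le_left _ _) hyb)).2,
        hy (Metric.ball_subset_ball (min_le_right _ _) hyb)]
    choose! r hr hrae using hl
    -- The Lindelöf property reduces the uncountably many exceptional null sets to countably many.
    obtain ⟨t, htO, htc, hcov⟩ := TopologicalSpace.countable_cover_nhdsWithin (s := O)
      (f := fun c => Metric.ball c (r c))
      (fun c hc => mem_nhdsWithin_of_mem_nhds (Metric.ball_mem_nhds c (hr c hc)))
    have hall : ∀ᵐ y ∂μ, ∀ c ∈ t, y ∈ Metric.ball c (r c) → g y = f y :=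
      (ae_ball_iff htc).2 fun c hc => hrae c (htO hc)
    filter_upwards [hall] with y hy hyO
    obtain ⟨c, hc, hyc⟩ := Set.mem_iUnion₂.1 (hcov hyO)
    exact hy c hc hyc
  refine ⟨g, ?_, fun y => ?_, ?_, fun c hc => hgan c (hsO hc)⟩
  · refine measurable_of_restrict_of_restrict_compl hOopen.measurableSet ?_ ?_
    · have : ContinuousOn g O := fun c hc => (hgan c hc).continuousAt.continuousWithinAt
      exact this.domRestrict.measurable
    · have : Oᶜ.domRestrict g = Oᶜ.domRestrict f := funext fun y => if_neg y.2
      rw [this]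
      exact mf.comp measurable_subtype_coe
  · by_cases hy : y ∈ O
    -- A negative value would persist on a ball of positive measure, on which `g` agrees almost
    -- everywhere with the nonnegative `f`.
    · by_contra! hneg
      have h1 : ∀ᶠ z in 𝓝 y, g z < 0 := (hgan y hy).continuousAt.eventually_lt_const hneg
      obtain ⟨r, hr, hball⟩ := Metric.eventually_nhds_iff_ball.1
        (h1.and (hOopen.mem_nhds hy))
      have h0 : μ (Metric.ball y r) = 0 := by
        rw [measure_eq_zero_iff_ae_notMem]
        filter_upwards [hgf] with z hz hzb
        have := (hball z hzb).1
        rw [hz (hball z hzb).2] at this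
        exact absurd (hf z) (not_le.2 this)
      exact (Metric.measure_ball_pos μ y hr).ne' h0
    · have : g y = f y := if_neg hy
      rw [this]
      exact hf y
  · filter_upwards [hgf] with y hy
    by_cases hyO : y ∈ O
    · exact hy hyO
    · exact if_neg hyO

end Smooth

end

section

/-! ### Matrices over the reals, the complex numbers and the quaternions -/

/-- The common properties of `ℝ`, `ℂ` and `ℍ` that are used below: a real part and an orthonormal
basis `e` of units. -/
class HornField (K : Type*) [Ring K] [StarRing K] [Algebra ℝ K] [TopologicalSpace K] where
  /-- the real part -/
  re : K →ₗ[ℝ] ℝ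
  /-- the dimension over the reals -/
  deg : ℕ
  deg_pos : 0 < deg
  /-- the units -/
  e : Fin deg → K
  re_mul_comm : ∀ x y, re (x * y) = re (y * x)
  re_star : ∀ x, re (star x) = re x
  re_one : re 1 = 1
  eq_of_star_eq : ∀ x, star x = x → x = algebraMap ℝ K (re x)
  expand : ∀ x, x = ∑ k, re (star (e k) * x) • e k
  star_e_mul : ∀ k, star (e k) * e k = 1
  e_mul_star : ∀ k, e k * star (e k) = 1
  re_star_mul_self_nonneg : ∀ x, 0 ≤ re (star x * x)
  eq_zero_of_re : ∀ x, re (star x * x) = 0 → x = 0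
  star_smul_real : ∀ (r : ℝ) (x : K), star (r • x) = r • star x
  continuous_re : Continuous re

section Matrices

open HornField

variable {n : ℕ} {K : Type*} [Ring K] [StarRing K] [Algebra ℝ K] [TopologicalSpace K]
  [HornField K]

/-- Square matrices over `K`. -/
abbrev Mat (n : ℕ) (K : Type*) := Matrix (Fin n) (Fin n) K

theorem star_algebraMap_real (r : ℝ) : star (algebraMap ℝ K r) = algebraMap ℝ K r := by
  rw [Algebra.algebraMap_eq_smul_one, star_smul_real, star_one]

theorem re_algebraMap (r : ℝ) : re (algebraMap ℝ K r) = r := by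
  rw [Algebra.algebraMap_eq_smul_one, map_smul, re_one, smul_eq_mul, mul_one]

theorem re_algebraMap_mul (r : ℝ) (x : K) : re (algebraMap ℝ K r * x) = r * re x := by
  rw [← Algebra.smul_def, map_smul, smul_eq_mul]

theorem star_smul_mat (r : ℝ) (A : Mat n K) : star (r • A) = r • star A := by
  ext i j
  simp [star_apply, star_smul_real]

/-- The real part of the trace. -/
def retr : Mat n K →ₗ[ℝ] ℝ := re ∘ₗ traceLinearMap (Fin n) ℝ K

theorem retr_apply (A : Mat n K) : retr A = ∑ i, re (A i i) := by
  simp [retr, trace]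

theorem retr_mul_comm (A B : Mat n K) : retr (A * B) = retr (B * A) := by
  simp only [retr_apply, mul_apply, map_sum]
  rw [Finset.sum_comm]
  exact Finset.sum_congr rfl fun i _ => Finset.sum_congr rfl fun j _ => re_mul_comm _ _

theorem retr_conj {U : Mat n K} (hU : U ∈ unitary (Mat n K)) (A : Mat n K) :
    retr (U * A * star U) = retr A := by
  rw [retr_mul_comm, ← mul_assoc, (Unitary.mem_iff.1 hU).1, one_mul]

theorem retr_star_mul_self (A : Mat n K) :
    retr (star A * A) = ∑ i, ∑ j, re (star (A j i) * A j i) := by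
  simp [retr_apply, mul_apply, star_apply]

theorem eq_zero_of_retr_star_mul_self {A : Mat n K} (h : retr (star A * A) = 0) : A = 0 := by
  rw [retr_star_mul_self] at h
  ext j i
  rw [Finset.sum_eq_zero_iff_of_nonneg fun i _ => Finset.sum_nonneg fun j _ =>
    re_star_mul_self_nonneg _] at h
  have h1 := h i (Finset.mem_univ i)
  rw [Finset.sum_eq_zero_iff_of_nonneg fun j _ => re_star_mul_self_nonneg _] at h1
  exact eq_zero_of_re _ (h1 j (Finset.mem_univ j))

variable (n K) in
/-- Self-adjoint traceless matrices. -/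
def herm : Submodule ℝ (Mat n K) where
  carrier := {A | star A = A ∧ retr A = 0}
  add_mem' := by
    rintro A B ⟨h1, h2⟩ ⟨h3, h4⟩
    exact ⟨by rw [star_add, h1, h3], by rw [map_add, h2, h4, add_zero]⟩
  zero_mem' := ⟨star_zero _, map_zero _⟩
  smul_mem' := by
    rintro r A ⟨h1, h2⟩
    exact ⟨by rw [star_smul_mat, h1], by rw [map_smul, h2, smul_zero]⟩

theorem module_finite : Module.Finite ℝ K := by
  refine Module.Finite.of_surjective
    (∑ k, (LinearMap.proj k : (Fin (deg K) → ℝ) →ₗ[ℝ] ℝ).smulRight (e k : K)) fun x => ?_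
  exact ⟨fun k => re (star (e k) * x), by simpa using (expand x).symm⟩

instance module_finite_mat : Module.Finite ℝ (Mat n K) :=
  have : Module.Finite ℝ K := module_finite
  inferInstanceAs (Module.Finite ℝ (Fin n → Fin n → K))

theorem conj_mem_herm {U : Mat n K} (hU : U ∈ unitary (Mat n K)) {A : Mat n K}
    (hA : A ∈ herm n K) : U * A * star U ∈ herm n K := by
  refine ⟨?_, by rw [retr_conj hU, hA.2]⟩
  rw [star_mul, star_mul, star_star, hA.1, mul_assoc]

theorem diag_mem_herm (x : traceless n) : diag K x ∈ herm n K := by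
  refine ⟨?_, ?_⟩
  · rw [diag, star_eq_conjTranspose, diagonal_conjTranspose]
    congr 1
    funext i
    exact star_algebraMap_real _
  · rw [retr_apply]
    simp only [diag, diagonal_apply_eq, re_algebraMap]
    exact x.2

variable (n K) in
/-- The index type for coordinates on the space of self-adjoint traceless matrices. -/
abbrev Coord := Fin (Module.finrank ℝ (herm n K))

variable (n K) in
/-- A basis of the space of self-adjoint traceless matrices. -/
def hermBasis : Module.Basis (Coord n K) ℝ (herm n K) := Module.finBasis ℝ (herm n K)

/-- The coordinates of a matrix: its inner products with a basis of `herm n K`. -/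
def coords : Mat n K →ₗ[ℝ] (Coord n K → ℝ) :=
  LinearMap.pi fun i => retr ∘ₗ LinearMap.mulLeft ℝ (hermBasis n K i : Mat n K)

theorem coords_apply (A : Mat n K) (i : Coord n K) :
    coords A i = retr ((hermBasis n K i : Mat n K) * A) := rfl

theorem sum_mul_coords (y : Coord n K → ℝ) (A : Mat n K) :
    ∑ i, y i * coords A i = retr ((∑ i, y i • (hermBasis n K i : Mat n K)) * A) := by
  rw [Finset.sum_mul, map_sum]
  exact Finset.sum_congr rfl fun i _ => by rw [smul_mul_assoc, map_smul, coords_apply, smul_eq_mul]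

/-- The trace form is positive definite: vanishing coordinates make `A` orthogonal to the whole
basis, hence to itself. -/
theorem coords_injOn {A : Mat n K} (hA : A ∈ herm n K) (h : coords A = 0) : A = 0 := by
  refine eq_zero_of_retr_star_mul_self ?_
  have h1 := congrArg (Subtype.val) ((hermBasis n K).sum_repr ⟨A, hA⟩)
  simp only [Submodule.coe_sum, Submodule.coe_smul] at h1
  rw [hA.1]
  nth_rewrite 1 [← h1]
  rw [← sum_mul_coords, h]
  simp

variable (n K) in
/-- Coordinates as a linear equivalence. -/
def coordsEquiv : herm n K ≃ₗ[ℝ] (Coord n K → ℝ) :=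
  LinearMap.linearEquivOfInjective (coords ∘ₗ (herm n K).subtype)
    (by
      rw [← LinearMap.ker_eq_bot, LinearMap.ker_eq_bot']
      intro A h
      exact Subtype.ext (coords_injOn A.2 h))
    (by simp)

/-- The self-adjoint traceless matrix with given coordinates. -/
def ofCoords (c : Coord n K → ℝ) : Mat n K := (coordsEquiv n K).symm c

theorem ofCoords_mem (c : Coord n K → ℝ) : ofCoords c ∈ herm n K := ((coordsEquiv n K).symm c).2

theorem coords_ofCoords (c : Coord n K → ℝ) : coords (ofCoords c : Mat n K) = c :=
  (coordsEquiv n K).apply_symm_apply c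

theorem ofCoords_coords {A : Mat n K} (hA : A ∈ herm n K) : ofCoords (coords A) = A :=
  congrArg Subtype.val ((coordsEquiv n K).symm_apply_apply ⟨A, hA⟩)

/-! ### Plane rotations -/

/-- The generator of the rotation in the plane of the coordinates `i` and `j` with unit `e k`. -/
def rotGen (i j : Fin n) (k : Fin (deg K)) : Mat n K :=
  single i j (e k) - single j i (star (e k))

/-- The projection on the plane of the coordinates `i` and `j`. -/
def planeProj (n : ℕ) (K : Type*) [Ring K] (i j : Fin n) : Mat n K := single i i 1 + single j j 1

/-- The symmetric companion of `rotGen`. -/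
def symGen (i j : Fin n) (k : Fin (deg K)) : Mat n K :=
  single i j (e k) + single j i (star (e k))

/-- The rotation in the plane of the coordinates `i` and `j` with unit `e k`. -/
def rot (i j : Fin n) (k : Fin (deg K)) (t : ℝ) : Mat n K :=
  (1 - planeProj n K i j) + Real.cos t • planeProj n K i j + Real.sin t • rotGen i j k

variable {i j : Fin n}

theorem star_rotGen (k : Fin (deg K)) : star (rotGen i j k : Mat n K) = -rotGen i j k := by
  simp [rotGen, star_eq_conjTranspose, conjTranspose_single]

theorem star_planeProj : star (planeProj n K i j) = planeProj n K i j := by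
  simp [planeProj, star_eq_conjTranspose, conjTranspose_single]

theorem planeProj_mul_self (hij : i ≠ j) : planeProj n K i j * planeProj n K i j = planeProj n K i j := by
  simp [planeProj, mul_add, add_mul, single_mul_single_of_ne, hij, hij.symm]

theorem planeProj_mul_rotGen (hij : i ≠ j) (k : Fin (deg K)) : planeProj n K i j * rotGen i j k = rotGen i j k := by
  simp [planeProj, rotGen, mul_add, add_mul, mul_sub, single_mul_single_of_ne, hij, hij.symm]

theorem rotGen_mul_planeProj (hij : i ≠ j) (k : Fin (deg K)) : rotGen i j k * planeProj n K i j = rotGen i j k := by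
  simp [planeProj, rotGen, mul_add, sub_mul, single_mul_single_of_ne, hij, hij.symm]
  abel

/-- With `X` the generator and `P` the projection, `X² = -P` and `P X = X P = X`; so `rot` is the
one-parameter group `exp (t X)`. -/
theorem rotGen_mul_self (hij : i ≠ j) (k : Fin (deg K)) : (rotGen i j k * rotGen i j k : Mat n K) = -planeProj n K i j := by
  simp [planeProj, rotGen, mul_sub, sub_mul, single_mul_single_of_ne, hij, hij.symm,
    star_e_mul, e_mul_star]
  abel

theorem rot_zero (i j : Fin n) (k : Fin (deg K)) : (rot i j k 0 : Mat n K) = 1 := by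
  simp [rot]

theorem star_rot (k : Fin (deg K)) (t : ℝ) : star (rot i j k t : Mat n K) =
    (1 - planeProj n K i j) + Real.cos t • planeProj n K i j - Real.sin t • rotGen i j k := by
  rw [rot, star_add, star_add, star_smul_mat, star_smul_mat, star_sub, star_one, star_planeProj,
    star_rotGen, smul_neg, sub_eq_add_neg _ (Real.sin t • rotGen i j k)]

theorem rot_mul_star (hij : i ≠ j) (k : Fin (deg K)) (t : ℝ) : (rot i j k t * star (rot i j k t) : Mat n K) = 1 := by
  have h1 := planeProj_mul_self (K := K) hij
  have h2 := planeProj_mul_rotGen (K := K) hij k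
  have h3 := rotGen_mul_planeProj (K := K) hij k
  have h4 := rotGen_mul_self (K := K) hij k
  rw [star_rot, rot]
  generalize planeProj n K i j = P at *
  generalize (rotGen i j k : Mat n K) = X at *
  have hc := Real.sin_sq_add_cos_sq t
  have : (1 - P + Real.cos t • P + Real.sin t • X) * (1 - P + Real.cos t • P - Real.sin t • X) =
      1 + (Real.sin t ^ 2 + Real.cos t ^ 2 - 1) • P := by
    simp only [mul_add, add_mul, mul_sub, sub_mul, smul_mul_assoc, mul_smul_comm, one_mul, mul_one,
      h1, h2, h3, h4, smul_smul, smul_neg, smul_sub, smul_add]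
    module
  rw [this, hc]
  simp

theorem star_mul_rot (hij : i ≠ j) (k : Fin (deg K)) (t : ℝ) : (star (rot i j k t) * rot i j k t : Mat n K) = 1 := by
  have h1 := planeProj_mul_self (K := K) hij
  have h2 := planeProj_mul_rotGen (K := K) hij k
  have h3 := rotGen_mul_planeProj (K := K) hij k
  have h4 := rotGen_mul_self (K := K) hij k
  rw [star_rot, rot]
  generalize planeProj n K i j = P at *
  generalize (rotGen i j k : Mat n K) = X at *
  have hc := Real.sin_sq_add_cos_sq t
  have : (1 - P + Real.cos t • P - Real.sin t • X) * (1 - P + Real.cos t • P + Real.sin t • X) =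
      1 + (Real.sin t ^ 2 + Real.cos t ^ 2 - 1) • P := by
    simp only [mul_add, add_mul, mul_sub, sub_mul, smul_mul_assoc, mul_smul_comm, one_mul, mul_one,
      h1, h2, h3, h4, smul_smul, smul_neg, smul_sub, smul_add]
    module
  rw [this, hc]
  simp

theorem rot_mem_unitary (hij : i ≠ j) (k : Fin (deg K)) (t : ℝ) : (rot i j k t : Mat n K) ∈ unitary (Mat n K) :=
  Unitary.mem_iff.2 ⟨star_mul_rot hij k t, rot_mul_star hij k t⟩

theorem rot_mul_rotGen (hij : i ≠ j) (k : Fin (deg K)) (t : ℝ) : (rot i j k t * rotGen i j k : Mat n K) =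
    Real.cos t • rotGen i j k - Real.sin t • planeProj n K i j := by
  rw [rot]
  simp only [add_mul, sub_mul, smul_mul_assoc, one_mul, planeProj_mul_rotGen hij,
    rotGen_mul_self hij]
  module

theorem rotGen_mul_rot (hij : i ≠ j) (k : Fin (deg K)) (t : ℝ) : (rotGen i j k * rot i j k t : Mat n K) =
    Real.cos t • rotGen i j k - Real.sin t • planeProj n K i j := by
  rw [rot]
  simp only [mul_add, mul_sub, mul_smul_comm, mul_one, rotGen_mul_planeProj hij,
    rotGen_mul_self hij]
  module

theorem rotGen_mul_star_rot (hij : i ≠ j) (k : Fin (deg K)) (t : ℝ) : (rotGen i j k * star (rot i j k t) : Mat n K) =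
    Real.cos t • rotGen i j k + Real.sin t • planeProj n K i j := by
  rw [star_rot]
  simp only [mul_add, mul_sub, mul_smul_comm, mul_one, rotGen_mul_planeProj hij,
    rotGen_mul_self hij]
  module

theorem star_rot_mul_rotGen (hij : i ≠ j) (k : Fin (deg K)) (t : ℝ) : (star (rot i j k t) * rotGen i j k : Mat n K) =
    Real.cos t • rotGen i j k + Real.sin t • planeProj n K i j := by
  rw [star_rot]
  simp only [add_mul, sub_mul, smul_mul_assoc, one_mul, planeProj_mul_rotGen hij,
    rotGen_mul_self hij]
  module

/-- The derivative of a conjugate by a plane rotation. -/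
theorem hasDerivAt_conj_rot (hij : i ≠ j) (k : Fin (deg K)) (l : Mat n K →ₗ[ℝ] ℝ) (x : Mat n K) (t : ℝ) :
    HasDerivAt (fun t => l (rot i j k t * x * star (rot i j k t)))
      (l (rot i j k t * (rotGen i j k * x - x * rotGen i j k) * star (rot i j k t))) t := by
  -- Expanded in `cos t` and `sin t`, the conjugate has constant real coefficients after applying
  -- `l`, so only the derivatives of sine and cosine are needed.
  have h1 : ∀ t, l (rot i j k t * x * star (rot i j k t)) =
      l ((1 - planeProj n K i j) * x * (1 - planeProj n K i j)) +
      Real.cos t * l ((1 - planeProj n K i j) * x * planeProj n K i j +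
        planeProj n K i j * x * (1 - planeProj n K i j)) +
      Real.sin t * l (rotGen i j k * x * (1 - planeProj n K i j) -
        (1 - planeProj n K i j) * x * rotGen i j k) +
      Real.cos t * Real.cos t * l (planeProj n K i j * x * planeProj n K i j) +
      Real.cos t * Real.sin t * l (rotGen i j k * x * planeProj n K i j -
        planeProj n K i j * x * rotGen i j k) -
      Real.sin t * Real.sin t * l (rotGen i j k * x * rotGen i j k) := by
    intro t
    rw [star_rot, rot]
    generalize (1 - planeProj n K i j) = Q
    simp only [mul_add, add_mul, mul_sub, sub_mul, smul_mul_assoc, mul_smul_comm, smul_smul,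
      map_add, map_sub, map_smul, smul_eq_mul, smul_add, smul_sub]
    ring
  have h2 : l (rot i j k t * (rotGen i j k * x - x * rotGen i j k) * star (rot i j k t)) =
      l ((Real.cos t • rotGen i j k - Real.sin t • planeProj n K i j) * x *
          ((1 - planeProj n K i j) + Real.cos t • planeProj n K i j - Real.sin t • rotGen i j k) -
        ((1 - planeProj n K i j) + Real.cos t • planeProj n K i j + Real.sin t • rotGen i j k) * x *
          (Real.cos t • rotGen i j k + Real.sin t • planeProj n K i j)) := by
    rw [← rot_mul_rotGen hij, ← rotGen_mul_star_rot hij, ← star_rot, ← rot]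
    congr 1
    simp only [mul_sub, sub_mul, mul_assoc]
  simp only [h1, h2]
  have hc := Real.hasDerivAt_cos t
  have hs := Real.hasDerivAt_sin t
  generalize (1 - planeProj n K i j) = Q
  refine HasDerivAt.congr_deriv ((((((hasDerivAt_const t _).add (hc.mul_const _)).add
    (hs.mul_const _)).add ((hc.mul hc).mul_const _)).add ((hc.mul hs).mul_const _)).sub
    ((hs.mul hs).mul_const _)) ?_
  simp only [mul_add, add_mul, mul_sub, sub_mul, smul_mul_assoc, mul_smul_comm, smul_smul,
    map_add, map_sub, map_smul, smul_eq_mul, smul_add, smul_sub]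
  ring

/-- The root space relation. Its factor `xⱼ - xᵢ` is where regularity enters, and it also produces
the Vandermonde weight. -/
theorem rotGen_mul_diag (hij : i ≠ j) (k : Fin (deg K)) (x : traceless n) :
    rotGen i j k * diag K x - diag K x * rotGen i j k = (x.1 j - x.1 i) • symGen i j k := by
  ext a b
  simp only [rotGen, symGen, diag, Matrix.sub_apply, mul_diagonal, diagonal_mul, Matrix.smul_apply,
    Matrix.add_apply,
    ← Algebra.commutes (A := K), ← Algebra.smul_def, single_apply]
  by_cases h1 : i = a ∧ j = b
  · obtain ⟨rfl, rfl⟩ := h1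
    simp [hij, hij.symm, sub_smul]
  · by_cases h2 : j = a ∧ i = b
    · obtain ⟨rfl, rfl⟩ := h2
      simp [hij, hij.symm, sub_smul, smul_sub]
      abel
    · simp [h1, h2]

end Matrices

end

section

/-! ### The chamber and the Vandermonde weight -/

section Chamber

variable {n : ℕ}

/-- The coordinate functionals on the hyperplane of traceless vectors. -/
def entry (i : Fin n) : traceless n →L[ℝ] ℝ :=
  (EuclideanSpace.proj i : EuclideanSpace ℝ (Fin n) →L[ℝ] ℝ).comp (traceless n).subtypeL

theorem entry_apply (i : Fin n) (x : traceless n) : entry i x = x.1 i := rfl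

theorem continuous_entry (i : Fin n) : Continuous fun x : traceless n => x.1 i :=
  (entry i).continuous

theorem traceless_ext {x y : traceless n} (h : ∀ i, x.1 i = y.1 i) : x = y :=
  Subtype.ext (PiLp.ext h)

/-- A vector of sum zero as an element of the hyperplane. -/
def mkTraceless (v : Fin n → ℝ) (hv : ∑ i, v i = 0) : traceless n := ⟨WithLp.toLp 2 v, hv⟩

theorem norm_sq_traceless (x : traceless n) : ‖x‖ ^ 2 = ∑ i, x.1 i ^ 2 := by
  rw [Submodule.coe_norm, EuclideanSpace.norm_sq_eq]
  simp

theorem isClosed_chamber : IsClosed (chamber n) := by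
  have : chamber n = ⋂ (i : Fin n) (j : Fin n) (_ : i ≤ j), {x | x.1 j ≤ x.1 i} := by
    ext x
    simp [chamber, Antitone]
  rw [this]
  exact isClosed_iInter fun i => isClosed_iInter fun j => isClosed_iInter fun _ =>
    isClosed_le (continuous_entry j) (continuous_entry i)

theorem convex_chamber : Convex ℝ (chamber n) := by
  intro x hx y hy a b ha hb hab i j hij
  exact add_le_add (mul_le_mul_of_nonneg_left (hx hij) ha) (mul_le_mul_of_nonneg_left (hy hij) hb)

theorem isOpen_strictAnti : IsOpen {x : traceless n | StrictAnti fun i => x.1 i} := by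
  have : {x : traceless n | StrictAnti fun i => x.1 i} =
      ⋂ (i : Fin n) (j : Fin n) (_ : i < j), {x | x.1 j < x.1 i} := by
    ext x
    simp [StrictAnti]
  rw [this]
  exact isOpen_iInter_of_finite fun i => isOpen_iInter_of_finite fun j =>
    isOpen_iInter_of_finite fun _ => isOpen_lt (continuous_entry j) (continuous_entry i)

variable (n) in
/-- The pairs `i < j`. -/
def posPairs : Finset (Fin n × Fin n) := Finset.univ.filter fun p => p.1 < p.2

theorem mem_posPairs {p : Fin n × Fin n} : p ∈ posPairs n ↔ p.1 < p.2 := by simp [posPairs]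

/-- The weight `∏_{i<j} (xᵢ - xⱼ)^d`. -/
def weight (d : ℕ) (x : traceless n) : ℝ := ∏ p ∈ posPairs n, (x.1 p.1 - x.1 p.2) ^ d

/-- The weight with one factor `xᵢ - xⱼ` removed. -/
def subweight (d : ℕ) (q : Fin n × Fin n) (x : traceless n) : ℝ :=
  (∏ p ∈ (posPairs n).erase q, (x.1 p.1 - x.1 p.2) ^ d) * (x.1 q.1 - x.1 q.2) ^ (d - 1)

theorem weight_eq_mul {d : ℕ} (hd : 0 < d) {q : Fin n × Fin n} (hq : q ∈ posPairs n)
    (x : traceless n) : weight d x = (x.1 q.1 - x.1 q.2) * subweight d q x := by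
  rw [weight, ← Finset.prod_erase_mul _ _ hq, subweight]
  obtain ⟨d, rfl⟩ := Nat.exists_eq_succ_of_ne_zero hd.ne'
  simp only [Nat.succ_eq_add_one, Nat.add_sub_cancel, pow_succ]
  ring

theorem contDiff_weight (d : ℕ) : ContDiff ℝ ∞ (weight d : traceless n → ℝ) := by
  unfold weight
  refine contDiff_prod fun p _ => ContDiff.pow ?_ d
  exact (entry p.1).contDiff.sub (entry p.2).contDiff

theorem continuous_weight (d : ℕ) : Continuous (weight d : traceless n → ℝ) :=
  (contDiff_weight d).continuous

theorem continuous_subweight (d : ℕ) (q : Fin n × Fin n) :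
    Continuous (subweight d q : traceless n → ℝ) := by
  unfold subweight
  refine (continuous_finsetProd _ fun p _ => ?_).mul ?_
  · exact ((entry p.1).continuous.sub (entry p.2).continuous).pow d
  · exact ((entry q.1).continuous.sub (entry q.2).continuous).pow (d - 1)

theorem analyticAt_weight (d : ℕ) (x : traceless n) : AnalyticAt ℝ (weight d) x := by
  unfold weight
  refine Finset.analyticAt_fun_prod _ fun p _ => AnalyticAt.fun_pow ?_ d
  exact ((entry p.1).analyticAt x).fun_sub ((entry p.2).analyticAt x)

theorem fderiv_weight (d : ℕ) (x u : traceless n) :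
    fderiv ℝ (weight d) x u =
      ∑ q ∈ posPairs n, (d : ℝ) * ((u.1 q.1 - u.1 q.2) * subweight d q x) := by
  have h : HasFDerivAt (weight d) (∑ q ∈ posPairs n,
      (∏ p ∈ (posPairs n).erase q, (x.1 p.1 - x.1 p.2) ^ d) •
        ((d • (x.1 q.1 - x.1 q.2) ^ (d - 1)) • (entry q.1 - entry q.2))) x := by
    unfold weight
    refine HasFDerivAt.finsetProd fun p _ => ?_
    exact HasFDerivAt.pow ((entry p.1).hasFDerivAt.fun_sub (entry p.2).hasFDerivAt) d
  rw [h.fderiv, _root_.sum_apply]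
  refine Finset.sum_congr rfl fun q _ => ?_
  simp only [_root_.smul_apply, _root_.sub_apply, entry_apply, smul_eq_mul,
    nsmul_eq_mul, subweight]
  ring

theorem weight_nonneg (d : ℕ) {x : traceless n} (hx : x ∈ chamber n) : 0 ≤ weight d x :=
  Finset.prod_nonneg fun p hp =>
    pow_nonneg (sub_nonneg.2 (hx (mem_posPairs.1 hp).le)) d

theorem weight_pos (d : ℕ) {x : traceless n} (hx : StrictAnti fun i => x.1 i) : 0 < weight d x :=
  Finset.prod_pos fun p hp => pow_pos (sub_pos.2 (hx (mem_posPairs.1 hp))) d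

/-- A point of the chamber with strict inequalities is interior, so on the frontier two entries
coincide; a positive exponent then kills the weight. -/
theorem weight_eq_zero_of_mem_frontier {d : ℕ} (hd : 0 < d) {x : traceless n}
    (hx : x ∈ frontier (chamber n)) : weight d x = 0 := by
  by_contra hne
  have hxc : x ∈ chamber n := isClosed_chamber.frontier_subset hx
  have hs : StrictAnti fun i => x.1 i := by
    intro i j hij
    refine lt_of_le_of_ne (hxc hij.le) fun h => hne ?_
    rw [weight_eq_mul hd (mem_posPairs.2 hij : (i, j) ∈ posPairs n)]
    simp only at h
    simp [h]
  refine hx.2 (mem_interior.2 ⟨_, fun y hy => ?_, isOpen_strictAnti, hs⟩)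
  exact StrictAnti.antitone hy

end Chamber

end

section

/-! ### Haar probability measure -/

section Haar

variable {G : Type*} [Group G] [TopologicalSpace G] [IsTopologicalGroup G] [CompactSpace G]
  [SecondCountableTopology G] [MeasurableSpace G] [BorelSpace G]

instance isProbabilityMeasure_haarProb : IsProbabilityMeasure (haarProb G) :=
  ⟨Measure.haarMeasure_self (K₀ := (⊤ : TopologicalSpace.PositiveCompacts G))⟩

instance isHaarMeasure_haarProb : (haarProb G).IsHaarMeasure :=
  inferInstanceAs (Measure.haarMeasure _).IsHaarMeasure

/-- Compact groups are unimodular: a right translate of Haar measure is left invariant with total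
mass one, hence equal to it. -/
instance isMulRightInvariant_haarProb : (haarProb G).IsMulRightInvariant := by
  refine ⟨fun g => ?_⟩
  have hp : IsProbabilityMeasure ((haarProb G).map (· * g)) :=
    Measure.isProbabilityMeasure_map (measurable_mul_const g).aemeasurable
  have h := Measure.haarMeasure_unique ((haarProb G).map (· * g))
    (⊤ : TopologicalSpace.PositiveCompacts G)
  rw [TopologicalSpace.PositiveCompacts.coe_top, measure_univ, one_smul] at h
  exact h

theorem measurePreserving_mul_right_haarProb (g : G) :
    MeasurePreserving (fun x : G => x * g) (haarProb G) (haarProb G) :=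
  measurePreserving_mul_right _ g

theorem measurePreserving_mul_left_haarProb (g : G) :
    MeasurePreserving (fun x : G => g * x) (haarProb G) (haarProb G) :=
  measurePreserving_mul_left _ g

end Haar

/-! ### Diagonal and off-diagonal parts of self-adjoint matrices. -/

section Matrices

open HornField

variable {n : ℕ} {K : Type*} [Ring K] [StarRing K] [Algebra ℝ K] [TopologicalSpace K]
  [HornField K] [IsTopologicalRing K] [ContinuousStar K] [ContinuousSMul ℝ K] [T2Space K]

theorem continuous_retr : Continuous (retr : Mat n K → ℝ) := by
  have : (retr : Mat n K → ℝ) = fun A => ∑ i, re (A i i) := funext retr_apply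
  rw [this]
  exact continuous_finsetSum _ fun i _ => continuous_re.comp (continuous_id.matrix_elem i i)

theorem continuous_coords : Continuous (coords : Mat n K → Coord n K → ℝ) :=
  continuous_pi fun i => continuous_retr.comp (continuous_const.mul continuous_id)

theorem continuous_ofCoords : Continuous (ofCoords : (Coord n K → ℝ) → Mat n K) :=
  LinearMap.continuous_of_finiteDimensional
    ((herm n K).subtype ∘ₗ ((coordsEquiv n K).symm : (Coord n K → ℝ) →ₗ[ℝ] herm n K))

variable (n K) in
/-- The diagonal matrix as a linear map. -/
def diagLin : traceless n →ₗ[ℝ] Mat n K where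
  toFun := diag K
  map_add' x y := by
    ext i j
    simp [diag, diagonal_apply, Matrix.add_apply]
    split_ifs <;> simp
  map_smul' c x := by
    ext i j
    simp [diag, diagonal_apply, Matrix.smul_apply, Algebra.smul_def]

theorem diagLin_apply (x : traceless n) : diagLin n K x = diag K x := rfl

theorem continuous_diag : Continuous (diag K : traceless n → Mat n K) :=
  LinearMap.continuous_of_finiteDimensional (diagLin n K)

/-- The traceless diagonal part of a matrix. -/
def diagPart (A : Mat n K) : traceless n :=
  mkTraceless (fun i => re (A i i) - retr A / n) (by
    rw [Finset.sum_sub_distrib, ← retr_apply]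
    rcases Nat.eq_zero_or_pos n with rfl | hn
    · simp [retr_apply]
    · have : (n : ℝ) ≠ 0 := by positivity
      simp [field])

theorem diagPart_apply (A : Mat n K) (i : Fin n) :
    (diagPart A).1 i = re (A i i) - retr A / n := rfl

theorem continuous_diagPart : Continuous (diagPart : Mat n K → traceless n) := by
  refine Continuous.subtype_mk ((PiLp.continuous_toLp 2 _).comp (continuous_pi fun i => ?_)) _
  exact (continuous_re.comp (continuous_id.matrix_elem i i)).sub (continuous_retr.div_const _)

theorem retr_symGen_mul {A : Mat n K} (hA : star A = A) (i j : Fin n) (k : Fin (deg K)) :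
    retr (symGen i j k * A) = 2 * re (star (e k) * A i j) := by
  have h : A j i = star (A i j) := by
    conv_lhs => rw [← hA]
    rfl
  rw [symGen, add_mul, map_add, retr, LinearMap.comp_apply, LinearMap.comp_apply,
    traceLinearMap_apply, traceLinearMap_apply, trace_single_mul, trace_single_mul, h, smul_eq_mul, smul_eq_mul,
    ← re_star (e k * _), star_mul, star_star, re_mul_comm (A i j)]
  ring

/-- Diagonal entries are real, upper entries expand in the units `e k`, and lower entries are
determined by self-adjointness. In particular a matrix orthogonal to all `symGen` is diagonal. -/
theorem eq_diag_add_sum_symGen {A : Mat n K} (hA : A ∈ herm n K) :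
    A = diag K (diagPart A) + ∑ p ∈ posPairs n, ∑ k, re (star (e k) * A p.1 p.2) •
      symGen p.1 p.2 k := by
  have hs : ∀ i j, A j i = star (A i j) := fun i j => by
    conv_lhs => rw [← hA.1]
    rfl
  ext a b
  simp only [Matrix.add_apply, Matrix.sum_apply, Matrix.smul_apply, symGen, single_apply, diag]
  rcases lt_trichotomy a b with h | rfl | h
  · rw [diagonal_apply_ne _ h.ne, zero_add, Finset.sum_eq_single (a, b)]
    · simp only [and_self, if_true, h.ne', false_and, if_false, add_zero]
      exact expand _
    · rintro ⟨c, d⟩ hp hne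
      have hcd := mem_posPairs.1 hp
      refine Finset.sum_eq_zero fun k _ => ?_
      rw [if_neg, if_neg, add_zero, smul_zero]
      · rintro ⟨rfl, rfl⟩
        exact absurd hcd h.not_gt
      · rintro ⟨rfl, rfl⟩
        exact hne rfl
    · intro hp
      exact absurd (mem_posPairs.2 h) hp
  · rw [diagonal_apply_eq, diagPart_apply, hA.2, zero_div, sub_zero, ← eq_of_star_eq _ (hs a a).symm,
      Finset.sum_eq_zero, add_zero]
    rintro ⟨c, d⟩ hp
    have hcd := mem_posPairs.1 hp
    refine Finset.sum_eq_zero fun k _ => ?_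
    rw [if_neg, if_neg, add_zero, smul_zero]
    · rintro ⟨h1, h2⟩
      exact hcd.ne' (h1.trans h2.symm)
    · rintro ⟨h1, h2⟩
      exact hcd.ne (h1.trans h2.symm)
  · rw [diagonal_apply_ne _ h.ne', zero_add, Finset.sum_eq_single (b, a)]
    · simp only [and_self, if_true, h.ne, false_and, if_false, zero_add, hs b a]
      conv_lhs => rw [expand (A b a), star_sum]
      exact Finset.sum_congr rfl fun k _ => star_smul_real _ _
    · rintro ⟨c, d⟩ hp hne
      have hcd := mem_posPairs.1 hp
      refine Finset.sum_eq_zero fun k _ => ?_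
      rw [if_neg, if_neg, add_zero, smul_zero]
      · rintro ⟨rfl, rfl⟩
        exact hne rfl
      · rintro ⟨rfl, rfl⟩
        exact absurd hcd h.not_gt
    · intro hp
      exact absurd (mem_posPairs.2 h) hp

theorem rotGen_mul_symGen {i j : Fin n} (hij : i ≠ j) (k : Fin (deg K)) :
    (rotGen i j k * symGen i j k - symGen i j k * rotGen i j k : Mat n K) =
      (2 : ℝ) • (single i i 1 - single j j 1) := by
  simp [rotGen, symGen, mul_sub, sub_mul, mul_add, add_mul, single_mul_single_of_ne, hij, hij.symm,
    star_e_mul, e_mul_star]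
  module

theorem retr_single_mul (i : Fin n) (A : Mat n K) : retr (single i i 1 * A) = re (A i i) := by
  rw [retr, LinearMap.comp_apply, traceLinearMap_apply, trace_single_mul, smul_eq_mul, one_mul]

theorem retr_diag_mul_self (x : traceless n) : retr (diag K x * diag K x) = ‖x‖ ^ 2 := by
  rw [norm_sq_traceless, diag, diagonal_mul_diagonal, retr_apply]
  refine Finset.sum_congr rfl fun i _ => ?_
  rw [diagonal_apply_eq, re_algebraMap_mul, re_algebraMap, sq]

end Matrices

end

section

/-! ### Groups of unitary matrices containing the plane rotations -/

open HornField

/-- A unitary representation of `G` whose image contains the plane rotations. -/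
structure HornRep (n : ℕ) (K : Type*) [Ring K] [StarRing K] [Algebra ℝ K] [TopologicalSpace K]
    [HornField K] (G : Type*) [Group G] [TopologicalSpace G] where
  /-- the representation -/
  π : G →* Mat n K
  continuous_π : Continuous π
  mem_unitary : ∀ g, π g ∈ unitary (Mat n K)
  exists_rot : ∀ i j : Fin n, i ≠ j → ∀ (k : Fin (deg K)) (t : ℝ), ∃ g, π g = rot i j k t

namespace HornRep

variable {n : ℕ} {K : Type*} [Ring K] [StarRing K] [Algebra ℝ K] [TopologicalSpace K]
  [HornField K] [IsTopologicalRing K] [ContinuousStar K] [ContinuousSMul ℝ K] [T2Space K]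
  {G : Type*} [Group G] [TopologicalSpace G] (R : HornRep n K G)

/-- An element of the group represented by a plane rotation. -/
def rotElt {i j : Fin n} (hij : i ≠ j) (k : Fin (deg K)) (t : ℝ) : G := (R.exists_rot i j hij k t).choose

theorem π_rotElt {i j : Fin n} (hij : i ≠ j) (k : Fin (deg K)) (t : ℝ) :
    R.π (R.rotElt hij k t) = rot i j k t := (R.exists_rot i j hij k t).choose_spec

/-- The action of `G` on matrices by conjugation. -/
def ad (g : G) : Mat n K →ₗ[ℝ] Mat n K :=
  LinearMap.mulRight ℝ (star (R.π g)) ∘ₗ LinearMap.mulLeft ℝ (R.π g)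

theorem ad_apply (g : G) (A : Mat n K) : R.ad g A = R.π g * A * star (R.π g) := rfl

theorem π_mul_star (g : G) : R.π g * star (R.π g) = 1 := (Unitary.mem_iff.1 (R.mem_unitary g)).2

theorem star_mul_π (g : G) : star (R.π g) * R.π g = 1 := (Unitary.mem_iff.1 (R.mem_unitary g)).1

theorem ad_mul (g h : G) (A : Mat n K) : R.ad (g * h) A = R.ad g (R.ad h A) := by
  simp only [ad_apply, map_mul, star_mul, mul_assoc]

theorem ad_one (A : Mat n K) : R.ad 1 A = A := by simp [ad_apply]

theorem ad_inv_ad (g : G) (A : Mat n K) : R.ad g⁻¹ (R.ad g A) = A := by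
  rw [← ad_mul, inv_mul_cancel, ad_one]

theorem ad_ad_inv (g : G) (A : Mat n K) : R.ad g (R.ad g⁻¹ A) = A := by
  rw [← ad_mul, mul_inv_cancel, ad_one]

theorem ad_mul_ad (g : G) (A B : Mat n K) : R.ad g A * R.ad g B = R.ad g (A * B) := by
  simp only [ad_apply]
  calc _ = R.π g * A * (star (R.π g) * R.π g) * B * star (R.π g) := by simp only [mul_assoc]
    _ = _ := by rw [R.star_mul_π, mul_one, mul_assoc (R.π g)]

theorem star_ad (g : G) (A : Mat n K) : star (R.ad g A) = R.ad g (star A) := by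
  simp only [ad_apply, star_mul, star_star, mul_assoc]

theorem retr_ad (g : G) (A : Mat n K) : retr (R.ad g A) = retr A := retr_conj (R.mem_unitary g) A

theorem retr_ad_mul (g : G) (A B : Mat n K) : retr (R.ad g A * B) = retr (A * R.ad g⁻¹ B) := by
  conv_lhs => rw [← R.ad_ad_inv g B, ad_mul_ad, retr_ad]

theorem ad_mem_herm (g : G) {A : Mat n K} (hA : A ∈ herm n K) : R.ad g A ∈ herm n K :=
  conj_mem_herm (R.mem_unitary g) hA

theorem _root_.Continuous.hornRep_ad {X : Type*} [TopologicalSpace X] {f : X → G} {A : X → Mat n K}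
    (hf : Continuous f) (hA : Continuous A) (R : HornRep n K G) :
    Continuous fun x => R.ad (f x) (A x) := by
  have h : Continuous fun x => R.π (f x) := R.continuous_π.comp hf
  exact (h.mul hA).mul h.star

theorem hasDerivAt_ad_mul_rotElt {i j : Fin n} (hij : i ≠ j) (k : Fin (deg K))
    (l : Mat n K →ₗ[ℝ] ℝ) (g : G) (A : Mat n K) (t : ℝ) :
    HasDerivAt (fun t => l (R.ad (g * R.rotElt hij k t) A))
      (l (R.ad (g * R.rotElt hij k t) (rotGen i j k * A - A * rotGen i j k))) t := by
  have h := hasDerivAt_conj_rot hij k (l ∘ₗ R.ad g) A t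
  simp only [LinearMap.comp_apply, ← R.π_rotElt hij k, ← ad_apply, ← ad_mul] at h
  exact h

theorem hasDerivAt_coords_ad_mul_rotElt {i j : Fin n} (hij : i ≠ j) (k : Fin (deg K)) (g : G)
    (A : Mat n K) (t : ℝ) :
    HasDerivAt (fun t => coords (R.ad (g * R.rotElt hij k t) A))
      (coords (R.ad (g * R.rotElt hij k t) (rotGen i j k * A - A * rotGen i j k))) t :=
  hasDerivAt_pi.2 fun a =>
    R.hasDerivAt_ad_mul_rotElt hij k (LinearMap.proj a ∘ₗ coords) g A t

/-- The parametrization of self-adjoint traceless matrices by conjugates of diagonal ones. -/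
def orbit (p : G × traceless n) : Coord n K → ℝ := coords (R.ad p.1 (diag K p.2))

theorem continuous_orbit : Continuous R.orbit := by
  have h : Continuous fun p : G × traceless n => diag K p.2 := continuous_diag.comp continuous_snd
  exact continuous_coords.comp (continuous_fst.hornRep_ad h R)

/-- The parametrization for a fixed group element, as a continuous linear map. -/
def orbitL (g : G) : traceless n →L[ℝ] (Coord n K → ℝ) :=
  LinearMap.toContinuousLinearMap (coords ∘ₗ R.ad g ∘ₗ diagLin n K)

theorem orbitL_apply (g : G) (x : traceless n) : R.orbitL g x = R.orbit (g, x) := rfl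

/-- Conjugation preserves the trace form, so the norm of the diagonal parameter can be read off the
matrix. This makes `orbit` proper. -/
theorem retr_ofCoords_orbit_sq (p : G × traceless n) :
    retr (ofCoords (R.orbit p) * ofCoords (R.orbit p)) = ‖p.2‖ ^ 2 := by
  rw [orbit, ofCoords_coords (R.ad_mem_herm _ (diag_mem_herm _)), ad_mul_ad, retr_ad,
    retr_diag_mul_self]

theorem exists_norm_le_of_orbit_mem {s : Set (Coord n K → ℝ)} (hs : IsCompact s) :
    ∃ C, ∀ p, R.orbit p ∈ s → ‖p.2‖ ≤ C := by
  have hc : Continuous fun c : Coord n K → ℝ => retr (ofCoords c * ofCoords c : Mat n K) :=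
    continuous_retr.comp (continuous_ofCoords.mul continuous_ofCoords)
  obtain ⟨C, hC⟩ := hs.exists_bound_of_continuousOn hc.continuousOn
  refine ⟨C + 1, fun p hp => ?_⟩
  have h := (le_abs_self _).trans (hC _ hp)
  rw [retr_ofCoords_orbit_sq] at h
  nlinarith [norm_nonneg p.2]

theorem isCompact_orbit_preimage [CompactSpace G] {s : Set (Coord n K → ℝ)} (hs : IsCompact s) :
    IsCompact (R.orbit ⁻¹' s) := by
  obtain ⟨C, hC⟩ := R.exists_norm_le_of_orbit_mem hs
  refine (isCompact_univ.prod (isCompact_closedBall (0 : traceless n) C)).of_isClosed_subset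
    (hs.isClosed.preimage R.continuous_orbit) fun p hp => ⟨trivial, ?_⟩
  simpa using hC p hp

variable [IsTopologicalGroup G] [CompactSpace G] [SecondCountableTopology G] [MeasurableSpace G]
  [BorelSpace G]

/-- Integration by parts along a plane rotation. -/
theorem mul_integral_retr_symGen {i j : Fin n} (hij : i ≠ j) (k : Fin (deg K))
    {F : (Coord n K → ℝ) → ℝ} (hF : ContDiff ℝ 1 F) (Y : Mat n K) (x : traceless n) :
    (x.1 i - x.1 j) * ∫ g, retr (R.ad g (symGen i j k) * Y) *
        fderiv ℝ F (R.orbit (g, x)) (coords (R.ad g (symGen i j k))) ∂haarProb G =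
      ∫ g, 2 * (re (R.ad g⁻¹ Y i i) - re (R.ad g⁻¹ Y j j)) * F (R.orbit (g, x)) ∂haarProb G := by
  have hcad : ∀ A : Mat n K, Continuous fun g => R.ad g A := fun A =>
    continuous_id.hornRep_ad continuous_const R
  have hcy : ∀ A : Mat n K, Continuous fun g => retr (R.ad g A * Y) := fun A =>
    continuous_retr.comp ((hcad A).mul continuous_const)
  have hco : Continuous fun g => R.orbit (g, x) :=
    R.continuous_orbit.comp (continuous_id.prodMk continuous_const)
  have hcF : Continuous fun g => F (R.orbit (g, x)) := hF.continuous.comp hco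
  have hcF' : ∀ A : Mat n K, Continuous fun g => fderiv ℝ F (R.orbit (g, x)) (coords (R.ad g A)) :=
    fun A => ((hF.continuous_fderiv one_ne_zero).comp hco).clm_apply
      (continuous_coords.comp (hcad A))
  have hbdd : ∀ f : G → ℝ, Continuous f → ∃ C, ∀ g, |f g| ≤ C := by
    intro f hf
    obtain ⟨C, hC⟩ := isCompact_univ.exists_bound_of_continuousOn hf.continuousOn
    exact ⟨C, fun g => hC g trivial⟩
  set S : Mat n K := symGen i j k with hS
  have hcf := (hcy S).mul hcF
  have hcf' : Continuous fun g => retr (R.ad g ((2 : ℝ) • (single i i 1 - single j j 1)) * Y) *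
      F (R.orbit (g, x)) + retr (R.ad g S * Y) *
        fderiv ℝ F (R.orbit (g, x)) (coords (R.ad g ((x.1 j - x.1 i) • S))) :=
    ((hcy _).mul hcF).add ((hcy _).mul (hcF' _))
  obtain ⟨C, hC⟩ := hbdd _ hcf
  obtain ⟨C', hC'⟩ := hbdd _ hcf'
  -- The derivative of `retr (Ad g S · Y) * F (orbit (g, x))` along the rotation with generator `X`
  -- has two terms: `[X, S] = 2 (Eᵢᵢ - Eⱼⱼ)` gives the right side of the claim and `[X, diag x] =
  -- (xⱼ - xᵢ) S` the left.
  have h0 := integral_flow_deriv_eq_zero (m := haarProb G) (ρ := fun t g => g * R.rotElt hij k t)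
    (fun t => measurePreserving_mul_right_haarProb _) hcf.measurable hcf'.measurable hC hC' ?_
  · have hi : ∀ f : G → ℝ, Continuous f → Integrable f (haarProb G) := fun f hf =>
      hf.integrable_of_hasCompactSupport (HasCompactSupport.of_compactSpace f)
    rw [integral_add (hi _ ((hcy _).fun_mul hcF)) (hi _ ((hcy _).fun_mul (hcF' _)))] at h0
    have h1 : ∀ g, retr (R.ad g S * Y) *
        fderiv ℝ F (R.orbit (g, x)) (coords (R.ad g ((x.1 j - x.1 i) • S))) =
        -((x.1 i - x.1 j) * (retr (R.ad g S * Y) *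
          fderiv ℝ F (R.orbit (g, x)) (coords (R.ad g S)))) := by
      intro g
      rw [map_smul, map_smul, map_smul, smul_eq_mul]
      ring
    have h2 : ∀ g, retr (R.ad g ((2 : ℝ) • (single i i 1 - single j j 1)) * Y) =
        2 * (re (R.ad g⁻¹ Y i i) - re (R.ad g⁻¹ Y j j)) := by
      intro g
      rw [retr_ad_mul, smul_mul_assoc, map_smul, sub_mul, map_sub, retr_single_mul,
        retr_single_mul, smul_eq_mul]
    simp only [h1, h2] at h0
    rw [integral_neg, integral_const_mul] at h0
    linarith
  · intro g t
    have d1 := R.hasDerivAt_ad_mul_rotElt hij k (retr ∘ₗ LinearMap.mulRight ℝ Y) g S t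
    have d2 := R.hasDerivAt_coords_ad_mul_rotElt hij k g (diag K x) t
    rw [rotGen_mul_diag hij] at d2
    rw [hS, rotGen_mul_symGen hij, ← hS] at d1
    have d3 := ((hF.differentiable one_ne_zero).differentiableAt.hasFDerivAt).comp_hasDerivAt t d2
    exact d1.mul d3

end HornRep

end

section

/-! ### The integration formula for conjugates of diagonal matrices -/

open HornField

/-- Lebesgue measure on the chamber, weighted by `∏_{i<j} (xᵢ - xⱼ)^d`. -/
def chamberMeasure (n d : ℕ) : Measure (traceless n) :=
  (volume.restrict (chamber n)).withDensity fun x => ENNReal.ofReal (weight d x)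

instance isFiniteMeasureOnCompacts_chamberMeasure (n d : ℕ) :
    IsFiniteMeasureOnCompacts (chamberMeasure n d) := by
  refine ⟨fun s hs => ?_⟩
  obtain ⟨C, hC⟩ := hs.exists_bound_of_continuousOn (continuous_weight (n := n) d).continuousOn
  rw [chamberMeasure, withDensity_apply _ hs.measurableSet]
  refine (setLIntegral_mono' (g := fun _ => ENNReal.ofReal C) hs.measurableSet fun x hx =>
    ENNReal.ofReal_le_ofReal ((le_abs_self _).trans (hC x hx))).trans_lt ?_
  rw [setLIntegral_const]
  exact ENNReal.mul_lt_top ENNReal.ofReal_lt_top hs.measure_lt_top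

instance sFinite_chamberMeasure (n d : ℕ) : SFinite (chamberMeasure n d) := by
  unfold chamberMeasure
  infer_instance

theorem integral_chamberMeasure {n d : ℕ} (f : traceless n → ℝ) :
    ∫ x, f x ∂chamberMeasure n d = ∫ x in chamber n, weight d x * f x := by
  rw [chamberMeasure, integral_withDensity_eq_integral_toReal_smul
    (continuous_weight d).measurable.ennreal_ofReal (ae_of_all _ fun _ => ENNReal.ofReal_lt_top)]
  refine setIntegral_congr_fun isClosed_chamber.measurableSet fun x hx => ?_
  simp only [smul_eq_mul]
  rw [ENNReal.toReal_ofReal (weight_nonneg d hx)]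

namespace HornRep

variable {n : ℕ} {K : Type*} [Ring K] [StarRing K] [Algebra ℝ K] [TopologicalSpace K]
  [HornField K] [IsTopologicalRing K] [ContinuousStar K] [ContinuousSMul ℝ K] [T2Space K]
  {G : Type*} [Group G] [TopologicalSpace G] (R : HornRep n K G)
  [IsTopologicalGroup G] [CompactSpace G] [SecondCountableTopology G] [MeasurableSpace G]
  [BorelSpace G]

/-- Splits a fixed direction `Y` in the frame of `g`: the diagonal part is a variation of `x`, the
rest consists of multiples of conjugated `symGen`, to be integrated by parts over the group. -/
theorem coords_eq_orbit_add_sum (g : G) {Y : Mat n K} (hY : Y ∈ herm n K) :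
    coords Y = R.orbit (g, diagPart (R.ad g⁻¹ Y)) + ∑ p ∈ posPairs n, ∑ k,
      (retr (R.ad g (symGen p.1 p.2 k) * Y) / 2) • coords (R.ad g (symGen p.1 p.2 k)) := by
  have hA := R.ad_mem_herm g⁻¹ hY
  have h := congrArg (fun A => coords (R.ad g A)) (eq_diag_add_sum_symGen hA)
  simp only [ad_ad_inv, map_add, map_sum, map_smul] at h
  rw [h]
  simp only [retr_ad_mul, retr_symGen_mul hA.1, mul_div_cancel_left₀ _ (two_ne_zero' ℝ)]
  rfl

theorem fderiv_weight_mul (d : ℕ) {F : (Coord n K → ℝ) → ℝ} (hF : ContDiff ℝ 1 F) (g : G)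
    (x u : traceless n) :
    fderiv ℝ (fun x => weight d x * F (R.orbit (g, x))) x u =
      weight d x * fderiv ℝ F (R.orbit (g, x)) (R.orbit (g, u)) +
      ∑ q ∈ posPairs n, (d : ℝ) * ((u.1 q.1 - u.1 q.2) * subweight d q x) *
        F (R.orbit (g, x)) := by
  have h1 : HasFDerivAt (fun x => F (R.orbit (g, x)))
      ((fderiv ℝ F (R.orbit (g, x))).comp (R.orbitL g)) x :=
    ((hF.differentiable one_ne_zero).differentiableAt.hasFDerivAt).comp x (R.orbitL g).hasFDerivAt
  have h2 : HasFDerivAt (weight d) (fderiv ℝ (weight d) x) x :=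
    ((contDiff_weight d).differentiable (by simp)).differentiableAt.hasFDerivAt
  rw [(h2.fun_mul h1).fderiv, ← Finset.sum_mul, ← fderiv_weight]
  simp only [_root_.add_apply, _root_.smul_apply, ContinuousLinearMap.comp_apply, smul_eq_mul,
    orbitL_apply]
  ring

/-- For a pair `i < j` and a unit `e k`, integration by parts over the group gives, with `A = Ad g⁻¹
Y`, the factor `(Aᵢᵢ - Aⱼⱼ) / (xᵢ - xⱼ)`. Summed over the `deg K` units and all pairs, this is the
logarithmic derivative of the weight with exponent `deg K`. Multiplying by the weight beforehand
avoids the division. -/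
theorem integral_weight_mul_fderiv {F : (Coord n K → ℝ) → ℝ} (hF : ContDiff ℝ 1 F) {Y : Mat n K}
    (hY : Y ∈ herm n K) (x : traceless n) :
    weight (deg K) x * ∫ g, fderiv ℝ F (R.orbit (g, x)) (coords Y) ∂haarProb G =
      ∫ g, fderiv ℝ (fun x => weight (deg K) x * F (R.orbit (g, x))) x (diagPart (R.ad g⁻¹ Y))
        ∂haarProb G := by
  have hi : ∀ f : G → ℝ, Continuous f → Integrable f (haarProb G) := fun f hf =>
    hf.integrable_of_hasCompactSupport (HasCompactSupport.of_compactSpace f)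
  have hcad : ∀ A : Mat n K, Continuous fun g => R.ad g A := fun A =>
    continuous_id.hornRep_ad continuous_const R
  have hcu : Continuous fun g => diagPart (R.ad g⁻¹ Y) :=
    continuous_diagPart.comp (continuous_inv.hornRep_ad continuous_const R)
  have hce : ∀ i, Continuous fun g => (diagPart (R.ad g⁻¹ Y)).1 i := fun i =>
    (continuous_entry i).comp hcu
  have hco : Continuous fun g => R.orbit (g, x) :=
    R.continuous_orbit.comp (continuous_id.prodMk continuous_const)
  have hcou : Continuous fun g => R.orbit (g, diagPart (R.ad g⁻¹ Y)) :=
    R.continuous_orbit.comp (continuous_id.prodMk hcu)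
  have hcF : Continuous fun g => F (R.orbit (g, x)) := hF.continuous.comp hco
  have hcF' : ∀ f : G → Coord n K → ℝ, Continuous f →
      Continuous fun g => fderiv ℝ F (R.orbit (g, x)) (f g) :=
    fun f hf => ((hF.continuous_fderiv one_ne_zero).comp hco).clm_apply hf
  have hcy : ∀ A : Mat n K, Continuous fun g => retr (R.ad g A * Y) := fun A =>
    continuous_retr.comp ((hcad A).mul continuous_const)
  have hcc : ∀ A : Mat n K, Continuous fun g => coords (R.ad g A) := fun A =>
    continuous_coords.comp (hcad A)
  have e1 : ∀ g, fderiv ℝ F (R.orbit (g, x)) (coords Y) =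
      fderiv ℝ F (R.orbit (g, x)) (R.orbit (g, diagPart (R.ad g⁻¹ Y))) +
      ∑ p ∈ posPairs n, ∑ k, (retr (R.ad g (symGen p.1 p.2 k) * Y) *
        fderiv ℝ F (R.orbit (g, x)) (coords (R.ad g (symGen p.1 p.2 k)))) / 2 := by
    intro g
    conv_lhs => rw [R.coords_eq_orbit_add_sum g hY]
    simp only [map_add, map_sum, map_smul, smul_eq_mul]
    congr 1
    exact Finset.sum_congr rfl fun p _ => Finset.sum_congr rfl fun k _ => by ring
  have hcS : ∀ (p : Fin n × Fin n) (k : Fin (deg K)),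
      Continuous fun g => retr (R.ad g (symGen p.1 p.2 k) * Y) *
        fderiv ℝ F (R.orbit (g, x)) (coords (R.ad g (symGen p.1 p.2 k))) := fun p k =>
    (hcy _).fun_mul (hcF' _ (hcc _))
  simp only [e1, R.fderiv_weight_mul _ hF]
  rw [integral_add (hi _ (hcF' _ hcou)) (integrable_finsetSum _ fun p _ =>
      integrable_finsetSum _ fun k _ => (hi _ (hcS p k)).div_const 2),
    integral_add ((hi _ (hcF' _ hcou)).const_mul _) (integrable_finsetSum _ fun q _ =>
      hi _ (((((hce q.1).sub (hce q.2)).fun_mul continuous_const).const_mul _).fun_mul hcF)),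
    integral_const_mul, mul_add]
  congr 1
  rw [integral_finsetSum _ (fun p _ => integrable_finsetSum _ fun k _ => (hi _ (hcS p k)).div_const 2),
    integral_finsetSum _ (fun q _ =>
      hi _ (((((hce q.1).sub (hce q.2)).fun_mul continuous_const).const_mul _).fun_mul hcF)),
    Finset.mul_sum]
  refine Finset.sum_congr rfl fun p hp => ?_
  rw [integral_finsetSum _ (fun k _ => (hi _ (hcS p k)).div_const 2)]
  have hpne : p.1 ≠ p.2 := (mem_posPairs.1 hp).ne
  have e2 : ∀ k : Fin (deg K), weight (deg K) x * ∫ g, (retr (R.ad g (symGen p.1 p.2 k) * Y) *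
      fderiv ℝ F (R.orbit (g, x)) (coords (R.ad g (symGen p.1 p.2 k)))) / 2 ∂haarProb G =
      subweight (deg K) p x * ∫ g, (re (R.ad g⁻¹ Y p.1 p.1) - re (R.ad g⁻¹ Y p.2 p.2)) *
        F (R.orbit (g, x)) ∂haarProb G := by
    intro k
    have h := R.mul_integral_retr_symGen hpne k hF Y x
    simp only [mul_assoc (2 : ℝ)] at h
    rw [integral_const_mul] at h
    rw [integral_div, weight_eq_mul deg_pos hp]
    linear_combination (subweight (deg K) p x / 2) * h
  rw [Finset.mul_sum, Finset.sum_congr rfl fun k _ => e2 k, Finset.sum_const, Finset.card_univ,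
    Fintype.card_fin, nsmul_eq_mul, ← integral_const_mul, ← integral_const_mul]
  refine integral_congr_ae (ae_of_all _ fun g => ?_)
  simp only [diagPart_apply]
  ring

/-- The image of the product of Haar measure and the weighted chamber. -/
def weylMeasure : Measure (Coord n K → ℝ) :=
  ((haarProb G).prod (chamberMeasure n (deg K))).map R.orbit

instance isFiniteMeasureOnCompacts_weylMeasure : IsFiniteMeasureOnCompacts R.weylMeasure := by
  refine ⟨fun s hs => ?_⟩
  rw [weylMeasure, Measure.map_apply R.continuous_orbit.measurable hs.measurableSet]
  exact (R.isCompact_orbit_preimage hs).measure_lt_top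

/-- By `integral_weight_mul_fderiv` the integrand is, for each `g`, a derivative in `x` of weight
times `F`. The direction depends on `g` only, so Fubini leaves an integral over the convex chamber
of a derivative of a function vanishing on the walls. -/
theorem integral_fderiv_weylMeasure {F : (Coord n K → ℝ) → ℝ} (hF : ContDiff ℝ ∞ F)
    (hc : HasCompactSupport F) (v : Coord n K → ℝ) :
    ∫ y, fderiv ℝ F y v ∂(R.weylMeasure) = 0 := by
  have hF1 : ContDiff ℝ 1 F := hF.of_le (by exact_mod_cast le_top)
  have hcF' : Continuous (fderiv ℝ F) := hF1.continuous_fderiv one_ne_zero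
  have hz : ∀ p, p ∉ R.orbit ⁻¹' tsupport F →
      F (R.orbit p) = 0 ∧ fderiv ℝ F (R.orbit p) = 0 := fun p hp =>
    ⟨image_eq_zero_of_notMem_tsupport hp,
      image_eq_zero_of_notMem_tsupport fun h => hp (tsupport_fderiv_subset ℝ h)⟩
  set Y : Mat n K := ofCoords v with hYdef
  have hY : Y ∈ herm n K := ofCoords_mem v
  have hv : v = coords Y := (coords_ofCoords v).symm
  have hT : Continuous fun p => fderiv ℝ F (R.orbit p) v :=
    (hcF'.comp R.continuous_orbit).clm_apply continuous_const
  rw [weylMeasure, integral_map R.continuous_orbit.aemeasurable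
    (hcF'.clm_apply continuous_const).aestronglyMeasurable,
    integral_prod_symm _ (hT.integrable_of_hasCompactSupport
      (HasCompactSupport.intro (R.isCompact_orbit_preimage hc) fun p hp => by simp [(hz p hp).2])),
    integral_chamberMeasure]
  simp only [hv, R.integral_weight_mul_fderiv hF1 hY]
  let D : traceless n → G → ℝ := fun x g =>
    fderiv ℝ (fun x => weight (deg K) x * F (R.orbit (g, x))) x (diagPart (R.ad g⁻¹ Y))
  have hDc : Continuous (Function.uncurry D) := by
    have ho : Continuous fun p : traceless n × G => R.orbit (p.2, p.1) :=
      R.continuous_orbit.comp (continuous_snd.prodMk continuous_fst)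
    have hu : Continuous fun p : traceless n × G => diagPart (R.ad p.2⁻¹ Y) :=
      continuous_diagPart.comp (continuous_snd.inv.hornRep_ad continuous_const R)
    have he : ∀ i, Continuous fun p : traceless n × G => (diagPart (R.ad p.2⁻¹ Y)).1 i := fun i =>
      (continuous_entry i).comp hu
    have hou : Continuous fun p : traceless n × G => R.orbit (p.2, diagPart (R.ad p.2⁻¹ Y)) :=
      R.continuous_orbit.comp (continuous_snd.prodMk hu)
    have : Function.uncurry D = fun p : traceless n × G =>
        weight (deg K) p.1 * fderiv ℝ F (R.orbit (p.2, p.1))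
          (R.orbit (p.2, diagPart (R.ad p.2⁻¹ Y))) +
        ∑ q ∈ posPairs n, (deg K : ℝ) * (((diagPart (R.ad p.2⁻¹ Y)).1 q.1 -
          (diagPart (R.ad p.2⁻¹ Y)).1 q.2) * subweight (deg K) q p.1) *
          F (R.orbit (p.2, p.1)) := by
      funext p
      exact R.fderiv_weight_mul _ hF1 _ _ _
    rw [this]
    refine Continuous.add (((continuous_weight _).comp continuous_fst).mul
      ((hcF'.comp ho).clm_apply hou)) (continuous_finsetSum _ fun q _ => ?_)
    exact (continuous_const.mul (((he q.1).sub (he q.2)).mul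
      ((continuous_subweight _ q).comp continuous_fst))).mul (hF1.continuous.comp ho)
  have hDs : HasCompactSupport (Function.uncurry D) := by
    refine HasCompactSupport.intro ((R.isCompact_orbit_preimage hc).image continuous_swap)
      fun p hp => ?_
    have hp' : p.swap ∉ R.orbit ⁻¹' tsupport F := fun h => hp ⟨p.swap, h, by simp⟩
    have := hz _ hp'
    simp only [Function.uncurry, D]
    rw [R.fderiv_weight_mul _ hF1]
    simp only [Prod.swap] at this
    simp [this.1, this.2]
  have hswap := integral_integral_swap (μ := volume.restrict (chamber n)) (ν := haarProb G)
    (f := D) (hDc.integrable_of_hasCompactSupport hDs)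
  rw [hswap]
  refine integral_eq_zero_of_ae (ae_of_all _ fun g => ?_)
  refine setIntegral_fderiv_eq_zero_of_convex convex_chamber isClosed_chamber.measurableSet ?_ ?_ ?_ _
  · exact ((contDiff_weight _).of_le (by exact_mod_cast le_top)).mul
      (hF1.comp (R.orbitL g).contDiff)
  · obtain ⟨C, hC⟩ := R.exists_norm_le_of_orbit_mem hc.isCompact
    refine HasCompactSupport.intro (isCompact_closedBall (0 : traceless n) C) fun x hx => ?_
    rw [(hz (g, x) fun h => hx (by simpa using hC _ h)).1, mul_zero]
  · intro x hx
    rw [weight_eq_zero_of_mem_frontier deg_pos hx, zero_mul]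

/-- The vector `a` serves, here and in the results below that take it, to witness that the open set
of regular vectors is nonempty. -/
theorem chamberMeasure_univ_ne_zero (d : ℕ) {a : traceless n} (ha : StrictAnti fun i => a.1 i) :
    chamberMeasure n d Set.univ ≠ 0 := by
  intro h
  rw [chamberMeasure, withDensity_apply _ MeasurableSet.univ, setLIntegral_univ,
    lintegral_eq_zero_iff (continuous_weight d).measurable.ennreal_ofReal] at h
  have h1 : ∀ᵐ x : traceless n, ¬ StrictAnti fun i => x.1 i := by
    filter_upwards [(ae_restrict_iff' isClosed_chamber.measurableSet).1 h] with x hx hs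
    have := hx hs.antitone
    simp only [Pi.zero_apply, ENNReal.ofReal_eq_zero] at this
    exact absurd (weight_pos d hs) this.not_gt
  have h2 : volume {x : traceless n | StrictAnti fun i => x.1 i} = 0 := by
    rw [measure_eq_zero_iff_ae_notMem]
    exact h1
  exact (isOpen_strictAnti.measure_pos volume ⟨a, ha⟩).ne' h2

/-- The integration formula: the image measure is a multiple of Lebesgue measure. -/
theorem exists_weylMeasure_eq_smul {a : traceless n} (ha : StrictAnti fun i => a.1 i) :
    ∃ c : NNReal, c ≠ 0 ∧ R.weylMeasure = c • (volume : Measure (Coord n K → ℝ)) := by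
  have : R.weylMeasure.IsAddLeftInvariant :=
    isAddLeftInvariant_of_integral_fderiv_eq_zero fun F hF hc v =>
      R.integral_fderiv_weylMeasure hF hc v
  have h := Measure.isAddLeftInvariant_eq_smul R.weylMeasure (volume : Measure (Coord n K → ℝ))
  refine ⟨_, fun h0 => ?_, h⟩
  rw [h0, zero_smul] at h
  have h1 := congrArg (fun μ => μ Set.univ) h
  simp only [weylMeasure] at h1
  rw [Measure.map_apply R.continuous_orbit.measurable MeasurableSet.univ, Set.preimage_univ,
    ← Set.univ_prod_univ, Measure.prod_prod, measure_univ, one_mul] at h1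
  exact chamberMeasure_univ_ne_zero _ ha h1

end HornRep

end

section

/-! ### Spectral theory -/

open HornField

section Matrices

variable {n : ℕ} {K : Type*} [Ring K] [StarRing K] [Algebra ℝ K] [TopologicalSpace K]
  [HornField K]

/-- The diagonal matrix with given real entries. -/
def rdiag (K : Type*) [Ring K] [Algebra ℝ K] (v : Fin n → ℝ) : Mat n K :=
  diagonal fun i => algebraMap ℝ K (v i)

theorem diag_eq_rdiag (x : traceless n) : diag K x = rdiag K (fun i => x.1 i) := rfl

theorem rdiag_mul (v w : Fin n → ℝ) : rdiag K v * rdiag K w = rdiag K (fun i => v i * w i) := by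
  simp [rdiag, diagonal_mul_diagonal]

theorem rdiag_add (v w : Fin n → ℝ) : rdiag K v + rdiag K w = rdiag K (fun i => v i + w i) := by
  simp [rdiag, diagonal_add]

theorem rdiag_const (r : ℝ) : rdiag K (fun _ : Fin n => r) = r • (1 : Mat n K) := by
  ext i j
  by_cases h : i = j
  · subst h
    simp [rdiag, Algebra.algebraMap_eq_smul_one]
  · simp [rdiag, h]

theorem star_rdiag (v : Fin n → ℝ) : star (rdiag K v) = rdiag K v := by
  rw [rdiag, star_eq_conjTranspose, diagonal_conjTranspose]
  congr 1
  funext i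
  exact star_algebraMap_real _

theorem retr_rdiag (v : Fin n → ℝ) : retr (rdiag K v) = ∑ i, v i := by
  simp [retr_apply, rdiag, re_algebraMap]

theorem retr_mul_rdiag (A : Mat n K) (v : Fin n → ℝ) :
    retr (A * rdiag K v) = ∑ i, re (A i i) * v i := by
  rw [retr_apply]
  refine Finset.sum_congr rfl fun i _ => ?_
  rw [rdiag, mul_diagonal, re_mul_comm, re_algebraMap_mul, mul_comm]

theorem rdiag_injective (K : Type*) [Ring K] [StarRing K] [Algebra ℝ K] [TopologicalSpace K]
    [HornField K] : Function.Injective (rdiag K : (Fin n → ℝ) → Mat n K) := by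
  intro v w h
  funext i
  have := congrArg (fun A : Mat n K => re (A i i)) h
  simpa [rdiag, re_algebraMap] using this

/-- The relation forces `k i j = 0` unless `a j = b i`, so it survives applying any function to both
diagonals. -/
theorem mul_rdiag_comp {k : Mat n K} {a b : Fin n → ℝ} (h : k * rdiag K a = rdiag K b * k)
    (φ : ℝ → ℝ) : k * rdiag K (fun i => φ (a i)) = rdiag K (fun i => φ (b i)) * k := by
  ext i j
  have hij := congrFun (congrFun h i) j
  rw [rdiag, rdiag, mul_diagonal, diagonal_mul, ← Algebra.commutes, ← Algebra.smul_def,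
    ← Algebra.smul_def] at hij ⊢
  by_cases hab : a j = b i
  · rw [hab]
  · have : (a j - b i) • k i j = 0 := by rw [sub_smul, hij, sub_self]
    have hk : k i j = 0 := by
      have h2 := congrArg (fun z => (a j - b i)⁻¹ • z) this
      simpa [smul_smul, inv_mul_cancel₀ (sub_ne_zero.2 hab)] using h2
    simp [hk]

/-- `star V * U` intertwines the two diagonal matrices. Hence functional calculus does not depend on
the chosen diagonalization. -/
theorem conj_rdiag_comp {U V : Mat n K} (hU : U ∈ unitary (Mat n K)) (hV : V ∈ unitary (Mat n K))
    {a b : Fin n → ℝ} (h : U * rdiag K a * star U = V * rdiag K b * star V) (φ : ℝ → ℝ) :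
    U * rdiag K (fun i => φ (a i)) * star U = V * rdiag K (fun i => φ (b i)) * star V := by
  obtain ⟨hU1, hU2⟩ := Unitary.mem_iff.1 hU
  obtain ⟨hV1, hV2⟩ := Unitary.mem_iff.1 hV
  have h1 : (star V * U) * rdiag K a = rdiag K b * (star V * U) := by
    calc (star V * U) * rdiag K a = star V * (U * rdiag K a * star U) * U := by
          simp only [mul_assoc, hU1, mul_one]
      _ = (star V * V) * rdiag K b * (star V * U) := by rw [h]; simp only [mul_assoc]
      _ = _ := by rw [hV1, one_mul]
  have h2 := mul_rdiag_comp h1 φ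
  calc U * rdiag K (fun i => φ (a i)) * star U
      = (V * star V) * U * rdiag K (fun i => φ (a i)) * star U := by rw [hV2, one_mul]
    _ = V * ((star V * U) * rdiag K (fun i => φ (a i))) * star U := by simp only [mul_assoc]
    _ = V * rdiag K (fun i => φ (b i)) * star V * (U * star U) := by rw [h2]; simp only [mul_assoc]
    _ = _ := by rw [hU2, mul_one]

/-- If `y i < x i`, then at the threshold `x i` at least the indices up to `i` count for `x`, but
only indices below `i` can count for `y`. -/
theorem le_of_card_le {x y : Fin n → ℝ} (hx : Antitone x) (hy : Antitone y)
    (h : ∀ t, (Finset.univ.filter fun i => t ≤ x i).card ≤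
      (Finset.univ.filter fun i => t ≤ y i).card) (i : Fin n) : x i ≤ y i := by
  by_contra! hlt
  have h1 : (Finset.Iic i).card ≤ (Finset.univ.filter fun j => x i ≤ x j).card :=
    Finset.card_le_card fun j hj => by
      simpa using hx (Finset.mem_Iic.1 hj)
  have h2 : (Finset.univ.filter fun j => x i ≤ y j).card ≤ (Finset.Iio i).card :=
    Finset.card_le_card fun j hj => by
      simp only [Finset.mem_filter, Finset.mem_univ, true_and] at hj
      rw [Finset.mem_Iio]
      by_contra! hij
      exact absurd (hj.trans (hy hij)) hlt.not_ge
  have h3 := h (x i)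
  rw [Fin.card_Iic] at h1
  rw [Fin.card_Iio] at h2
  omega

/-- The trace of the indicator of `[t, ∞)` applied to `C` counts the eigenvalues at least `t`. The
argument needs no characteristic polynomial and so covers the quaternions. -/
theorem isSortedSpectrum_unique {C : Mat n K} {x y : traceless n} (hx : IsSortedSpectrum C x)
    (hy : IsSortedSpectrum C y) : x = y := by
  obtain ⟨hxc, U, hU, rfl⟩ := hx
  obtain ⟨hyc, V, hV, h⟩ := hy
  have hcard : ∀ t, (Finset.univ.filter fun i => t ≤ x.1 i).card =
      (Finset.univ.filter fun i => t ≤ y.1 i).card := by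
    intro t
    have h1 := congrArg retr (conj_rdiag_comp hU hV h fun s => if t ≤ s then 1 else 0)
    rw [retr_conj hU, retr_conj hV, retr_rdiag, retr_rdiag, Finset.sum_boole, Finset.sum_boole] at h1
    exact_mod_cast h1
  exact traceless_ext fun i => le_antisymm (le_of_card_le hxc hyc (fun t => (hcard t).le) i)
    (le_of_card_le hyc hxc (fun t => (hcard t).ge) i)

theorem sortedSpectrum_conj_diag {U : Mat n K} (hU : U ∈ unitary (Mat n K)) {x : traceless n}
    (hx : x ∈ chamber n) : sortedSpectrum (U * diag K x * star U) = x := by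
  have h : IsSortedSpectrum (U * diag K x * star U) x := ⟨hx, U, hU, rfl⟩
  exact isSortedSpectrum_unique (Classical.epsilon_spec (p := IsSortedSpectrum _) ⟨x, h⟩) h

end Matrices

/-- Meant for `q` the diagonal of a projection commuting with the diagonal matrix of `x`: on each
level set of `x` the sum of `q` is an integer not exceeding the multiplicity, and that many indices
can be picked there. -/
theorem exists_subset_of_nat_sums {n : ℕ} (q x : Fin n → ℝ)
    (h : ∀ v, ∃ N : ℕ, N ≤ (Finset.univ.filter fun i => x i = v).card ∧
      ∑ i ∈ Finset.univ.filter (fun i => x i = v), q i = N) :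
    ∃ s : Finset (Fin n), (s.card : ℝ) = ∑ i, q i ∧ ∑ i ∈ s, x i = ∑ i, q i * x i := by
  classical
  choose N hN hq using h
  choose T hT hTc using fun v => Finset.exists_subset_card_eq (hN v)
  have hTx : ∀ v, ∀ i ∈ T v, x i = v := fun v i hi => (Finset.mem_filter.1 (hT v hi)).2
  have hdis : ∀ v ∈ Finset.univ.image x, ∀ w ∈ Finset.univ.image x, v ≠ w →
      Disjoint (T v) (T w) := by
    intro v _ w _ hvw
    rw [Finset.disjoint_left]
    intro i hi hi'
    exact hvw ((hTx v i hi).symm.trans (hTx w i hi'))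
  have hfib : ∀ f : Fin n → ℝ, ∑ i, f i =
      ∑ v ∈ Finset.univ.image x, ∑ i ∈ Finset.univ.filter (fun i => x i = v), f i := fun f =>
    (Finset.sum_fiberwise_of_maps_to (fun i _ => Finset.mem_image_of_mem x (Finset.mem_univ i)) f).symm
  refine ⟨(Finset.univ.image x).biUnion T, ?_, ?_⟩
  · rw [Finset.card_biUnion hdis, hfib, Nat.cast_sum]
    exact Finset.sum_congr rfl fun v _ => by rw [hTc, hq]
  · rw [Finset.sum_biUnion hdis, hfib]
    refine Finset.sum_congr rfl fun v _ => ?_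
    rw [Finset.sum_congr rfl (hTx v), Finset.sum_const, hTc, nsmul_eq_mul, ← hq, Finset.sum_mul]
    refine Finset.sum_congr rfl fun i hi => ?_
    rw [(Finset.mem_filter.1 hi).2]

/-! ### The spectral theorem, and hyperplane equations from commuting matrices. -/

namespace HornRep

variable {n : ℕ} {K : Type*} [Ring K] [StarRing K] [Algebra ℝ K] [TopologicalSpace K]
  [HornField K] [IsTopologicalRing K] [ContinuousStar K] [ContinuousSMul ℝ K] [T2Space K]
  {G : Type*} [Group G] [TopologicalSpace G] (R : HornRep n K G)
  [IsTopologicalGroup G] [CompactSpace G] [SecondCountableTopology G] [MeasurableSpace G]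
  [BorelSpace G]

theorem isClosed_orbit_image {s : Set (traceless n)} (hs : IsClosed s) :
    IsClosed (R.orbit '' (Set.univ ×ˢ s)) := by
  have h : IsProperMap R.orbit := isProperMap_iff_isCompact_preimage.2
    ⟨R.continuous_orbit, fun _ hK => R.isCompact_orbit_preimage hK⟩
  exact h.isClosedMap _ (isClosed_univ.prod hs)

/-- The image of `G` times the chamber is closed because `orbit` is proper, and its complement is
null for the Weyl measure, hence for Lebesgue measure. A null open set is empty. -/
theorem exists_orbit_eq {a : traceless n} (ha : StrictAnti fun i => a.1 i) (c : Coord n K → ℝ) :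
    ∃ g, ∃ x ∈ chamber n, R.orbit (g, x) = c := by
  by_contra! hne
  obtain ⟨κ, hκ, hw⟩ := R.exists_weylMeasure_eq_smul ha
  have hcl := R.isClosed_orbit_image (isClosed_chamber (n := n))
  have h0 : R.weylMeasure (R.orbit '' (Set.univ ×ˢ chamber n))ᶜ = 0 := by
    rw [weylMeasure, Measure.map_apply R.continuous_orbit.measurable hcl.measurableSet.compl]
    refine measure_mono_null (t := Set.univ ×ˢ (chamber n)ᶜ) ?_ ?_
    · rintro ⟨g, x⟩ hx
      exact ⟨trivial, fun hxc => hx ⟨(g, x), ⟨trivial, hxc⟩, rfl⟩⟩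
    · rw [Measure.prod_prod, chamberMeasure,
        withDensity_apply _ isClosed_chamber.measurableSet.compl,
        Measure.restrict_restrict isClosed_chamber.measurableSet.compl]
      simp
  rw [hw] at h0
  simp only [Measure.smul_apply, smul_eq_zero, hκ, false_or] at h0
  refine (hcl.isOpen_compl.measure_pos volume ⟨c, ?_⟩).ne' h0
  rintro ⟨⟨g, x⟩, ⟨-, hx⟩, h⟩
  exact hne g x hx h

/-- The spectral theorem. -/
theorem exists_ad_diag_eq {a : traceless n} (ha : StrictAnti fun i => a.1 i) {A : Mat n K}
    (hA : A ∈ herm n K) : ∃ g, ∃ x ∈ chamber n, R.ad g (diag K x) = A := by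
  obtain ⟨g, x, hx, h⟩ := R.exists_orbit_eq ha (coords A)
  refine ⟨g, x, hx, ?_⟩
  rw [← ofCoords_coords hA, ← h, orbit, ofCoords_coords (R.ad_mem_herm _ (diag_mem_herm x))]

/-- Subtract a multiple of the identity to make the projection traceless, and diagonalize.
Idempotence forces the shifted eigenvalues to be `0` or `1`, and the trace counts the ones. -/
theorem exists_nat_retr_eq (R : HornRep n K G) {a : traceless n} (ha : StrictAnti fun i => a.1 i) {P : Mat n K}
    (hs : star P = P) (hP : P * P = P) : ∃ N : ℕ, retr P = N := by
  set τ := retr P / n with hτ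
  have hone : retr (1 : Mat n K) = n := by
    rw [retr_apply]
    simp [re_one]
  have hA : P - τ • (1 : Mat n K) ∈ herm n K := by
    refine ⟨by rw [star_sub, star_smul_mat, star_one, hs], ?_⟩
    rw [map_sub, map_smul, hone, smul_eq_mul, hτ]
    rcases Nat.eq_zero_or_pos n with rfl | hn
    · simp [retr_apply]
    · have : (n : ℝ) ≠ 0 := by positivity
      field_simp
      simp
  obtain ⟨g, x, -, h⟩ := R.exists_ad_diag_eq ha hA
  have h1 : R.ad g (rdiag K fun i => x.1 i + τ) = P := by
    rw [← rdiag_add, map_add, ← diag_eq_rdiag, h, rdiag_const, map_smul, ad_apply R g 1, mul_one,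
      R.π_mul_star, sub_add_cancel]
  have h2 : (fun i => (x.1 i + τ) * (x.1 i + τ)) = fun i => x.1 i + τ := by
    refine rdiag_injective K ?_
    rw [← rdiag_mul, ← R.ad_inv_ad g (rdiag K _ * rdiag K _), ← ad_mul_ad, h1, hP, ← h1,
      R.ad_inv_ad]
  have h3 : ∀ i, x.1 i + τ = if x.1 i + τ = 1 then 1 else 0 := by
    intro i
    have := congrFun h2 i
    simp only at this
    rcases eq_or_ne (x.1 i + τ) 0 with h0 | h0
    · simp [h0]
    · rw [if_pos (mul_right_cancel₀ h0 (by linarith))]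
      exact mul_right_cancel₀ h0 (by linarith)
  refine ⟨(Finset.univ.filter fun i => x.1 i + τ = 1).card, ?_⟩
  rw [← h1, retr_ad, retr_rdiag, Finset.sum_congr rfl fun i _ => h3 i, Finset.sum_boole]

variable (n K) in
/-- The sorted spectrum as a function of coordinates. -/
def _root_.Horn.spec (c : Coord n K → ℝ) : traceless n := sortedSpectrum (ofCoords c : Mat n K)

theorem spec_orbit (g : G) {x : traceless n} (hx : x ∈ chamber n) :
    spec n K (R.orbit (g, x)) = x := by
  rw [spec, orbit, ofCoords_coords (R.ad_mem_herm _ (diag_mem_herm x))]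
  exact sortedSpectrum_conj_diag (R.mem_unitary g) hx

theorem spec_mem_chamber (R : HornRep n K G) {a : traceless n} (ha : StrictAnti fun i => a.1 i)
    (c : Coord n K → ℝ) : spec n K c ∈ chamber n := by
  obtain ⟨g, x, hx, rfl⟩ := R.exists_orbit_eq ha c
  rwa [R.spec_orbit g hx]

theorem exists_orbit_spec (R : HornRep n K G) {a : traceless n} (ha : StrictAnti fun i => a.1 i)
    (c : Coord n K → ℝ) : ∃ g, R.orbit (g, spec n K c) = c := by
  obtain ⟨g, x, hx, rfl⟩ := R.exists_orbit_eq ha c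
  exact ⟨g, by rw [R.spec_orbit g hx]⟩

/-- The preimage of a closed set is the image under the proper map `orbit` of a closed set. -/
theorem continuous_spec (R : HornRep n K G) {a : traceless n} (ha : StrictAnti fun i => a.1 i) :
    Continuous (spec n K) := by
  refine continuous_iff_isClosed.2 fun s hs => ?_
  have : spec n K ⁻¹' s = R.orbit '' (Set.univ ×ˢ (chamber n ∩ s)) := by
    ext c
    constructor
    · intro hc
      obtain ⟨g, hg⟩ := R.exists_orbit_spec ha c
      exact ⟨(g, spec n K c), ⟨trivial, R.spec_mem_chamber ha c, hc⟩, hg⟩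
    · rintro ⟨⟨g, x⟩, ⟨-, hxc, hxs⟩, rfl⟩
      rw [Set.mem_preimage, R.spec_orbit g hxc]
      exact hxs
  rw [this]
  exact R.isClosed_orbit_image (isClosed_chamber.inter hs)

/-- If a nonzero traceless self-adjoint matrix commutes with both summands, the spectrum of the sum
lies on the singular locus. -/
theorem mem_singularLocus {a : traceless n} (ha : StrictAnti fun i => a.1 i) {α β γ y y' : traceless n}
    {g₁ g₂ g : G} (hy : y ≠ 0) (hY : R.ad g₁ (diag K y) = R.ad g₂ (diag K y'))
    (hC : R.ad g (diag K γ) = R.ad g₁ (diag K α) + R.ad g₂ (diag K β)) :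
    γ ∈ singularLocus α β := by
  classical
  obtain ⟨i₀, hi₀⟩ : ∃ i, y.1 i ≠ 0 := by
    by_contra! h
    exact hy (traceless_ext fun i => h i)
  -- A nonzero traceless vector is not constant. This will make the spectral projection a proper
  -- one, that is, of rank less than `n`.
  have hj₀ : ∃ j, y.1 j ≠ y.1 i₀ := by
    by_contra! h
    have h1 : ∑ i, y.1 i = 0 := y.2
    rw [Finset.sum_congr rfl fun i _ => h i, Finset.sum_const, nsmul_eq_mul, mul_eq_zero] at h1
    rcases h1 with h1 | h1
    · simp only [Finset.card_univ, Fintype.card_fin, Nat.cast_eq_zero] at h1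
      subst h1
      exact i₀.elim0
    · exact hi₀ h1
  set v := y.1 i₀
  set φ : ℝ → ℝ := fun s => if s = v then 1 else 0 with hφ
  set I := Finset.univ.filter fun i => y.1 i = v with hI
  set J := Finset.univ.filter fun i => y'.1 i = v with hJ
  -- The spectral projection of `Y` at the eigenvalue `v`. Both diagonalizations of `Y` compute the
  -- same `P`, so it commutes with both summands and has rank `|I| = |J|`.
  set P : Mat n K := R.ad g₁ (rdiag K fun i => φ (y.1 i)) with hP
  have hP2 : P = R.ad g₂ (rdiag K fun i => φ (y'.1 i)) :=
    conj_rdiag_comp (R.mem_unitary g₁) (R.mem_unitary g₂) hY φ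
  have hφφ : ∀ s, φ s * φ s = φ s := fun s => by simp only [hφ]; split_ifs <;> simp
  have hPs : star P = P := by rw [hP, star_ad, star_rdiag]
  have hPP : P * P = P := by
    rw [hP, ad_mul_ad, rdiag_mul]
    simp only [hφφ]
  have hPI : retr P = I.card := by
    rw [hP, retr_ad, retr_rdiag, hI, ← Finset.sum_boole]
  have hPJ : retr P = J.card := by
    rw [hP2, retr_ad, retr_rdiag, hJ, ← Finset.sum_boole]
  have hsum : ∀ (f z : Fin n → ℝ), ∑ i, φ (z i) * f i =
      ∑ i ∈ Finset.univ.filter (fun i => z i = v), f i := by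
    intro f z
    rw [Finset.sum_filter]
    exact Finset.sum_congr rfl fun i _ => by simp [hφ]
  have hPC : retr (P * R.ad g (diag K γ)) = ∑ i ∈ I, α.1 i + ∑ i ∈ J, β.1 i := by
    rw [hC, mul_add, map_add]
    congr 1
    · rw [hP, ad_mul_ad, retr_ad, diag_eq_rdiag, rdiag_mul, retr_rdiag, hsum]
    · rw [hP2, ad_mul_ad, retr_ad, diag_eq_rdiag, rdiag_mul, retr_rdiag, hsum]
  have hcomm : P * R.ad g (diag K γ) = R.ad g (diag K γ) * P := by
    rw [hC, mul_add, add_mul]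
    congr 1
    · rw [hP, ad_mul_ad, ad_mul_ad, diag_eq_rdiag, rdiag_mul, rdiag_mul]
      simp only [mul_comm]
    · rw [hP2, ad_mul_ad, ad_mul_ad, diag_eq_rdiag, rdiag_mul, rdiag_mul]
      simp only [mul_comm]
  -- `P` in the eigenframe of the sum. It commutes with `diag γ` but need not be diagonal when `γ`
  -- has repeated entries.
  set Q : Mat n K := R.ad g⁻¹ P with hQ
  have hQP : R.ad g Q = P := R.ad_ad_inv g P
  have hQs : star Q = Q := by rw [hQ, star_ad, hPs]
  have hQQ : Q * Q = Q := by rw [hQ, ad_mul_ad, hPP]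
  have hQγ : Q * rdiag K (fun i => γ.1 i) = rdiag K (fun i => γ.1 i) * Q := by
    have h := congrArg (R.ad g⁻¹) hcomm
    rwa [← ad_mul_ad, ← ad_mul_ad, R.ad_inv_ad, ← hQ] at h
  -- On the eigenspace of `w`, with projection `E`, the product `Q E` is again a projection, so its
  -- trace is a natural number.
  have hnat : ∀ w, ∃ N : ℕ, N ≤ (Finset.univ.filter fun i => γ.1 i = w).card ∧
      ∑ i ∈ Finset.univ.filter (fun i => γ.1 i = w), re (Q i i) = N := by
    intro w
    set E : Mat n K := rdiag K fun i => if γ.1 i = w then 1 else 0 with hE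
    have hQE : Q * E = E * Q := mul_rdiag_comp hQγ fun s => if s = w then 1 else 0
    have hEE : E * E = E := by
      rw [hE, rdiag_mul]
      congr 1
      funext i
      split_ifs <;> simp
    have hEs : star E = E := star_rdiag _
    have hEQ : retr (Q * E) = ∑ i ∈ Finset.univ.filter (fun i => γ.1 i = w), re (Q i i) := by
      rw [hE, retr_mul_rdiag, Finset.sum_filter]
      exact Finset.sum_congr rfl fun i _ => by simp
    have h1 : (Q * E) * (Q * E) = Q * E := by
      calc (Q * E) * (Q * E) = (Q * E) * (E * Q) := by rw [← hQE]
        _ = Q * (E * E) * Q := by simp only [mul_assoc]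
        _ = Q * (Q * E) := by rw [hEE, mul_assoc, hQE]
        _ = Q * E := by rw [← mul_assoc, hQQ]
    obtain ⟨N, hN⟩ := R.exists_nat_retr_eq ha (P := Q * E) (by rw [star_mul, hEs, hQs, hQE]) h1
    have h2 : (E - Q * E) * (E - Q * E) = E - Q * E := by
      rw [mul_sub, sub_mul, sub_mul, hEE, h1]
      have h3 : Q * E * E = Q * E := by rw [mul_assoc, hEE]
      have h4 : E * (Q * E) = Q * E := by rw [← mul_assoc, ← hQE, h3]
      rw [h3, h4, sub_self, sub_zero]
    -- The complementary projection also has natural trace, which bounds `N` by the multiplicity of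
    -- `w`.
    obtain ⟨M, hM⟩ := R.exists_nat_retr_eq ha (P := E - Q * E)
      (by rw [star_sub, star_mul, hEs, hQs, hQE]) h2
    refine ⟨N, ?_, by rw [← hEQ, hN]⟩
    rw [map_sub, hN, hE, retr_rdiag, Finset.sum_boole] at hM
    have : (N : ℝ) + M = (Finset.univ.filter fun i => γ.1 i = w).card := by linarith
    have : N + M = (Finset.univ.filter fun i => γ.1 i = w).card := by exact_mod_cast this
    omega
  obtain ⟨S, hS, hSγ⟩ := exists_subset_of_nat_sums (fun i => re (Q i i)) (fun i => γ.1 i) hnat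
  have hSI : (S.card : ℝ) = I.card := by rw [hS, ← retr_apply, ← hPI, hQ, retr_ad]
  have hSJ : (S.card : ℝ) = J.card := by rw [hSI, ← hPI, hPJ]
  have hSI' : S.card = I.card := by exact_mod_cast hSI
  have hSJ' : S.card = J.card := by exact_mod_cast hSJ
  refine ⟨I, J, S, hSI'.symm, hSJ'.symm, ?_, ?_, ?_⟩
  · rw [hSI']
    exact Finset.card_pos.2 ⟨i₀, by simp [hI, v]⟩
  · rw [hSI']
    obtain ⟨j₀, hj₀⟩ := hj₀
    have : I ⊂ Finset.univ := by
      refine Finset.ssubset_univ_iff.2 fun h => ?_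
      have : j₀ ∈ I := h ▸ Finset.mem_univ j₀
      exact hj₀ (Finset.mem_filter.1 this).2
    simpa using Finset.card_lt_card this
  · change ∑ j ∈ S, γ.1 j = _
    rw [hSγ, ← hPC, ← hQP, ad_mul_ad, retr_ad, diag_eq_rdiag, retr_mul_rdiag]

end HornRep

end

section

/-! ### Vanishing entries of a random conjugate -/

open HornField

/-- Zeros with nonzero derivative are isolated, and a discrete subset of the line is countable. -/
theorem countable_zeros_of_deriv_ne_zero {f f' : ℝ → ℝ} (hf : ∀ t, HasDerivAt f (f' t) t) :
    {t | f t = 0 ∧ f' t ≠ 0}.Countable := by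
  have h : DiscreteTopology {t | f t = 0 ∧ f' t ≠ 0} := by
    rw [discreteTopology_subtype_iff]
    rintro t ⟨h0, h1⟩
    have h2 := (hf t).eventually_ne (c := 0) h1
    rw [← Filter.empty_mem_iff_bot]
    filter_upwards [Filter.mem_inf_of_left h2, Filter.mem_inf_of_right (Filter.mem_principal_self _)]
      with s hs hs'
    exact hs hs'.1
  exact Set.countable_coe_iff.1 (TopologicalSpace.separableSpace_iff_countable.1 inferInstance)

/-- Along measure preserving flows the zeros with nonzero derivative are negligible. -/
theorem ae_deriv_eq_zero_of_eq_zero {X : Type*} [MeasurableSpace X] {m : Measure X}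
    [IsProbabilityMeasure m] {ρ : ℝ → X → X} (hρ : ∀ t, MeasurePreserving (ρ t) m m)
    {F F' : X → ℝ} (hF : Measurable F) (hF' : Measurable F')
    (hFρ : Measurable fun p : ℝ × X => F (ρ p.1 p.2))
    (hFρ' : Measurable fun p : ℝ × X => F' (ρ p.1 p.2))
    (hd : ∀ x t, HasDerivAt (fun t => F (ρ t x)) (F' (ρ t x)) t) :
    ∀ᵐ x ∂m, F x = 0 → F' x = 0 := by
  have hm : MeasurableSet {x | F x = 0 ∧ F' x ≠ 0} :=
    (hF (measurableSet_singleton 0)).inter (hF' (measurableSet_singleton 0)).compl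
  have hmρ : MeasurableSet {p : ℝ × X | F (ρ p.1 p.2) = 0 ∧ F' (ρ p.1 p.2) ≠ 0} :=
    (hFρ (measurableSet_singleton 0)).inter (hFρ' (measurableSet_singleton 0)).compl
  -- For each `x` the exceptional times are countable, hence null. By Fubini some `t` has a null
  -- exceptional set in `X`, and invariance transports it to time zero.
  have h0 : (volume.prod m) {p : ℝ × X | F (ρ p.1 p.2) = 0 ∧ F' (ρ p.1 p.2) ≠ 0} = 0 := by
    rw [Measure.prod_apply_symm hmρ]
    refine (lintegral_congr fun x => ?_).trans lintegral_zero
    exact (countable_zeros_of_deriv_ne_zero (hd x)).measure_zero volume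
  have h1 := Measure.ae_ae_of_ae_prod (measure_eq_zero_iff_ae_notMem.1 h0)
  obtain ⟨t, ht⟩ := h1.exists
  have h2 : m {x | F x = 0 ∧ F' x ≠ 0} = 0 := by
    rw [← (hρ t).measure_preimage hm.nullMeasurableSet, measure_eq_zero_iff_ae_notMem]
    exact ht
  filter_upwards [measure_eq_zero_iff_ae_notMem.1 h2] with x hx h
  by_contra hne
  exact hx ⟨h, hne⟩

namespace HornRep

variable {n : ℕ} {K : Type*} [Ring K] [StarRing K] [Algebra ℝ K] [TopologicalSpace K]
  [HornField K] [IsTopologicalRing K] [ContinuousStar K] [ContinuousSMul ℝ K] [T2Space K]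
  {G : Type*} [Group G] [TopologicalSpace G] (R : HornRep n K G)
  [IsTopologicalGroup G] [CompactSpace G] [SecondCountableTopology G] [MeasurableSpace G]
  [BorelSpace G]

/-- Left multiplication of `g` by rotations moves the conjugate `B = Ad g A` with velocity `[X, B]`.
So, almost surely, a linear relation satisfied by `B` is also satisfied by `[X, B]`. -/
theorem ae_apply_commutator_eq_zero {i j : Fin n} (hij : i ≠ j) (k : Fin (deg K))
    (l : Mat n K →ₗ[ℝ] ℝ) (A : Mat n K) :
    ∀ᵐ g ∂haarProb G, l (R.ad g A) = 0 →
      l (rotGen i j k * R.ad g A - R.ad g A * rotGen i j k) = 0 := by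
  have hl : Continuous l := LinearMap.continuous_of_finiteDimensional l
  have hcad : Continuous fun g => R.ad g A := continuous_id.hornRep_ad continuous_const R
  have hr : Continuous fun t => (rot i j k t : Mat n K) := by
    unfold rot
    exact (continuous_const.add (Real.continuous_cos.smul continuous_const)).add
      (Real.continuous_sin.smul continuous_const)
  have hc : ∀ f : G → Mat n K, Continuous f →
      Continuous fun p : ℝ × G => rot i j k p.1 * f p.2 * star (rot i j k p.1 : Mat n K) := by
    intro f hf
    have h : Continuous fun p : ℝ × G => (rot i j k p.1 : Mat n K) := hr.comp continuous_fst
    exact (h.mul (hf.comp continuous_snd)).mul h.star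
  -- A rotation commutes with its own generator, so the velocity at time `t` is the commutator taken
  -- at the moved point.
  have hcomm : ∀ t, rot i j k t * rotGen i j k = (rotGen i j k * rot i j k t : Mat n K) :=
    fun t => by rw [rot_mul_rotGen hij, rotGen_mul_rot hij]
  have hcomm' : ∀ t, star (rot i j k t) * rotGen i j k =
      (rotGen i j k * star (rot i j k t) : Mat n K) :=
    fun t => by rw [rotGen_mul_star_rot hij, star_rot_mul_rotGen hij]
  have had : ∀ t g, R.ad (R.rotElt hij k t * g) A =
      rot i j k t * R.ad g A * star (rot i j k t) := fun t g => by
    rw [ad_mul, ad_apply, π_rotElt]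
  have had' : ∀ t g, rotGen i j k * R.ad (R.rotElt hij k t * g) A -
      R.ad (R.rotElt hij k t * g) A * rotGen i j k =
      rot i j k t * (rotGen i j k * R.ad g A - R.ad g A * rotGen i j k) * star (rot i j k t) := by
    intro t g
    rw [had, mul_sub, sub_mul]
    congr 1
    · simp only [← mul_assoc, hcomm]
    · simp only [mul_assoc, hcomm']
  have hcX : Continuous fun g => rotGen i j k * R.ad g A - R.ad g A * rotGen i j k :=
    (continuous_const.mul hcad).sub (hcad.mul continuous_const)
  refine ae_deriv_eq_zero_of_eq_zero (ρ := fun t g => R.rotElt hij k t * g)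
    (fun t => measurePreserving_mul_left_haarProb _) (hl.comp hcad).measurable
    (hl.comp hcX).measurable ?_ ?_ fun g t => ?_
  · simp only [had]
    exact (hl.comp (hc _ hcad)).measurable
  · simp only [had']
    exact (hl.comp (hc _ hcX)).measurable
  · simp only [had']
    simp only [had]
    exact hasDerivAt_conj_rot hij k l (R.ad g A) t

/-- The functional `A ↦ re (ē A i j)`. -/
def _root_.Horn.entryFun (i j : Fin n) (k : Fin (deg K)) : Mat n K →ₗ[ℝ] ℝ :=
  re ∘ₗ LinearMap.mulLeft ℝ (star (e k)) ∘ₗ entryLinearMap ℝ K i j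

theorem _root_.Horn.entryFun_apply (i j : Fin n) (k : Fin (deg K)) (A : Mat n K) :
    entryFun i j k A = re (star (e k) * A i j) := rfl

theorem _root_.Horn.eq_zero_of_forall_re {x : K} (h : ∀ k, re (star (e k) * x) = 0) : x = 0 := by
  rw [expand x]
  simp [h]

theorem _root_.Horn.commutator_apply_third {i j p : Fin n} (hjp : j ≠ p) (hij : i ≠ j) (hip : i ≠ p)
    (k : Fin (deg K)) (B : Mat n K) :
    (rotGen j p k * B - B * rotGen j p k) i j = B i p * star (e k) := by
  simp [rotGen, sub_mul, mul_sub, Matrix.sub_apply, single_mul_apply_of_ne, hij, hip, hjp,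
    mul_single_apply_of_ne]

theorem _root_.Horn.re_commutator_apply {i j : Fin n} (hij : i ≠ j) (k : Fin (deg K)) (B : Mat n K) :
    re (star (e k) * (rotGen i j k * B - B * rotGen i j k) i j) = re (B j j) - re (B i i) := by
  have h : (rotGen i j k * B - B * rotGen i j k) i j = e k * B j j - B i i * e k := by
    simp [rotGen, sub_mul, mul_sub, Matrix.sub_apply, single_mul_apply_of_ne, hij, hij.symm,
      mul_single_apply_of_ne]
  rw [h, mul_sub, map_sub, ← mul_assoc, star_e_mul, one_mul, re_mul_comm _ (B i i * e k), mul_assoc,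
    e_mul_star, mul_one]

/-- For a fixed pair `i ≠ j`, the `i j` entry of a random conjugate is almost surely nonzero. -/
theorem ae_ad_diag_apply_ne_zero {b : traceless n} (hb : StrictAnti fun i => b.1 i) {i j : Fin n}
    (hij : i ≠ j) : ∀ᵐ g ∂haarProb G, R.ad g (diag K b) i j ≠ 0 := by
  set B : G → Mat n K := fun g => R.ad g (diag K b) with hB
  have hBh : ∀ g, B g ∈ herm n K := fun g => R.ad_mem_herm g (diag_mem_herm b)
  have hBs : ∀ g p q, B g q p = star (B g p q) := fun g p q => by
    conv_lhs => rw [← (hBh g).1]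
    rfl
  -- `S p q` records that, almost surely, vanishing of the `i j` entry forces vanishing of the `p q`
  -- entry. Commutators with rotation generators spread this to the whole matrix.
  let S : Fin n → Fin n → Prop := fun p q => ∀ᵐ g ∂haarProb G, B g i j = 0 → B g p q = 0
  have hsymm : ∀ p q, S p q → S q p := fun p q h => by
    filter_upwards [h] with g hg hZ
    rw [hBs g p q, hg hZ, star_zero]
  have hcom : ∀ p q, S p q → ∀ {s t : Fin n} (hst : s ≠ t) (k : Fin (deg K)),
      ∀ᵐ g ∂haarProb G, B g i j = 0 → ∀ k', re (star (e k') *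
        (rotGen s t k * B g - B g * rotGen s t k) p q) = 0 := by
    intro p q h s t hst k
    have h1 : ∀ᵐ g ∂haarProb G, ∀ k', entryFun p q k' (B g) = 0 →
        entryFun p q k' (rotGen s t k * B g - B g * rotGen s t k) = 0 :=
      ae_all_iff.2 fun k' => R.ae_apply_commutator_eq_zero hst k (entryFun p q k') (diag K b)
    filter_upwards [h, h1] with g hg hg1 hZ k'
    refine hg1 k' ?_
    rw [entryFun_apply, hg hZ, mul_zero, map_zero]
  -- The `p q` entry of the commutator with the generator in the plane `q r` is the `p r` entry
  -- times a unit, so the second index can be exchanged.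
  have hthird : ∀ p q, p ≠ q → S p q → ∀ r, r ≠ p → S p r := by
    intro p q hpq h r hrp
    rcases eq_or_ne q r with rfl | hqr
    · exact h
    · let k : Fin (deg K) := ⟨0, deg_pos⟩
      filter_upwards [hcom p q h hqr k] with g hg hZ
      have h1 := eq_zero_of_forall_re (hg hZ)
      rw [commutator_apply_third hqr hpq hrp.symm] at h1
      have h2 := congrArg (fun z => z * e k) h1
      simpa [mul_assoc, star_e_mul] using h2
  have hall : ∀ p q, p ≠ q → S p q := by
    have h0 : ∀ q, q ≠ i → S i q := hthird i j hij (ae_of_all _ fun g h => h)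
    intro p q hpq
    rcases eq_or_ne p i with rfl | hpi
    · exact h0 q hpq.symm
    · exact hthird p i hpi (hsymm _ _ (h0 p hpi)) q hpq.symm
  -- Rotating in the plane `p q` itself turns the vanishing `p q` entry into equality of the two
  -- diagonal entries.
  have hdiag : ∀ p q, p ≠ q → ∀ᵐ g ∂haarProb G, B g i j = 0 → re (B g q q) = re (B g p p) := by
    intro p q hpq
    let k : Fin (deg K) := ⟨0, deg_pos⟩
    filter_upwards [hcom p q (hall p q hpq) hpq k] with g hg hZ
    have h1 := hg hZ k
    rw [re_commutator_apply hpq] at h1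
    linarith
  have h1 : ∀ᵐ g ∂haarProb G, ∀ p q, p ≠ q → B g i j = 0 → B g p q = 0 := by
    simp only [ae_all_iff]
    exact hall
  have h2 : ∀ᵐ g ∂haarProb G, ∀ p q, p ≠ q → B g i j = 0 → re (B g q q) = re (B g p p) := by
    simp only [ae_all_iff]
    exact hdiag
  filter_upwards [h1, h2] with g hg1 hg2 hZ
  have h3 : ∀ p, re (B g p p) = re (B g i i) := fun p => by
    rcases eq_or_ne i p with rfl | hp
    · rfl
    · exact hg2 i p hp hZ
  have hn : (n : ℝ) ≠ 0 := by
    have := i.pos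
    positivity
  -- All diagonal entries agree and their sum is zero; thus the conjugate, and with it `b`, would
  -- vanish, contrary to `b i ≠ b j`.
  have h4 : re (B g i i) = 0 := by
    have := (hBh g).2
    rw [retr_apply, Finset.sum_congr rfl fun p _ => h3 p, Finset.sum_const, nsmul_eq_mul,
      Finset.card_univ, Fintype.card_fin, mul_eq_zero] at this
    exact this.resolve_left hn
  have h5 : B g = 0 := by
    ext p q
    rcases eq_or_ne p q with rfl | hpq
    · rw [eq_of_star_eq _ (hBs g p p).symm, h3, h4, map_zero, Matrix.zero_apply]
    · exact hg1 p q hpq hZ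
  have h6 : diag K b = 0 := by
    rw [← R.ad_inv_ad g (diag K b), show R.ad g (diag K b) = 0 from h5, map_zero]
  have h7 : b = 0 := by
    have h8 := retr_diag_mul_self (K := K) b
    rw [h6, mul_zero, map_zero] at h8
    exact norm_eq_zero.1 (pow_eq_zero_iff two_ne_zero |>.1 h8.symm)
  refine hij (hb.injective ?_)
  simp [h7]

/-- Almost surely no nonzero self-adjoint traceless matrix is diagonalized by both `g₁`, `g₂`. -/
theorem ae_forall_ad_diag_ne {b : traceless n} (hb : StrictAnti fun i => b.1 i) :
    ∀ᵐ p : G × G ∂(haarProb G).prod (haarProb G), ∀ y y' : traceless n,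
      R.ad p.1 (diag K y) = R.ad p.2 (diag K y') → y = 0 := by
  have hcont : ∀ i j, Continuous fun p : G × G => R.ad (p.1⁻¹ * p.2) (diag K b) i j := fun i j =>
    ((continuous_fst.inv.mul continuous_snd).hornRep_ad continuous_const R).matrix_elem i j
  have h1 : ∀ᵐ p : G × G ∂(haarProb G).prod (haarProb G), ∀ i j, i ≠ j →
      R.ad (p.1⁻¹ * p.2) (diag K b) i j ≠ 0 := by
    simp only [ae_all_iff]
    intro i j hij
    have hms : MeasurableSet {p : G × G | R.ad (p.1⁻¹ * p.2) (diag K b) i j = 0} :=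
      (isClosed_eq (hcont i j) continuous_const).measurableSet
    have hms' : MeasurableSet {g : G | R.ad g (diag K b) i j = 0} :=
      (isClosed_eq ((continuous_id.hornRep_ad continuous_const R).matrix_elem i j)
        continuous_const).measurableSet
    suffices h0 : (haarProb G).prod (haarProb G)
        {p : G × G | R.ad (p.1⁻¹ * p.2) (diag K b) i j = 0} = 0 from
      measure_eq_zero_iff_ae_notMem.1 h0
    rw [Measure.prod_apply hms]
    refine (lintegral_congr fun g => ?_).trans lintegral_zero
    have h2 : haarProb G {g : G | R.ad g (diag K b) i j = 0} = 0 :=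
      measure_eq_zero_iff_ae_notMem.2 (R.ae_ad_diag_apply_ne_zero hb hij)
    -- For fixed `g₁` the element `g₁⁻¹ g₂` is again Haar distributed.
    rw [← (measurePreserving_mul_left_haarProb g⁻¹).measure_preimage hms'.nullMeasurableSet] at h2
    exact h2
  filter_upwards [h1] with p hp y y' hy
  set k := p.1⁻¹ * p.2 with hk
  have hyk : diag K y = R.ad k (diag K y') := by
    rw [hk, ad_mul, ← hy, R.ad_inv_ad]
  -- In the frame of `g₁`, the common matrix is both `diag y` and a conjugate by `k` of a diagonal
  -- matrix, so it commutes with `Ad k (diag b)`. Nonzero off-diagonal entries of the latter force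
  -- the entries of `y` to coincide.
  have hcomm : diag K y * R.ad k (diag K b) = R.ad k (diag K b) * diag K y := by
    rw [hyk, ad_mul_ad, ad_mul_ad, diag_eq_rdiag, diag_eq_rdiag, rdiag_mul, rdiag_mul]
    simp only [mul_comm]
  have hconst : ∀ i j, y.1 i = y.1 j := by
    intro i j
    by_contra hne
    have hij : i ≠ j := fun h => hne (by rw [h])
    have h2 := congrFun (congrFun hcomm i) j
    rw [diag, diagonal_mul, mul_diagonal, ← Algebra.commutes, ← Algebra.smul_def,
      ← Algebra.smul_def] at h2
    have h3 : (y.1 i - y.1 j) • R.ad k (diag K b) i j = 0 := by rw [sub_smul, h2, sub_self]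
    have h4 := congrArg (fun z => (y.1 i - y.1 j)⁻¹ • z) h3
    simp only [smul_smul, inv_mul_cancel₀ (sub_ne_zero.2 hne), one_smul, smul_zero] at h4
    exact hp i j hij h4
  refine traceless_ext fun i => ?_
  have h5 : ∑ j, y.1 j = 0 := y.2
  rw [Finset.sum_congr rfl fun j _ => hconst j i, Finset.sum_const, nsmul_eq_mul,
    Finset.card_univ, Fintype.card_fin, mul_eq_zero] at h5
  have hn : (n : ℝ) ≠ 0 := by
    have := i.pos
    positivity
  exact h5.resolve_left hn

end HornRep

end

section

/-! ### The sum of two random conjugates as a polynomial map -/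

open HornField

variable {n : ℕ} {K : Type*} [Ring K] [StarRing K] [Algebra ℝ K] [TopologicalSpace K]
  [HornField K]

variable (n K) in
/-- A basis of the space of matrices. -/
def matBasis : Module.Basis (Fin (Module.finrank ℝ (Mat n K))) ℝ (Mat n K) :=
  Module.finBasis ℝ (Mat n K)

variable (n K) in
/-- The index type of the plane rotations. -/
abbrev RotIdx := {p : Fin n × Fin n // p.1 ≠ p.2} × Fin (deg K)

namespace HornRep

variable [IsTopologicalRing K] [ContinuousStar K] [ContinuousSMul ℝ K] [T2Space K]
  {G : Type*} [Group G] [TopologicalSpace G] (R : HornRep n K G)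
  [IsTopologicalGroup G] [CompactSpace G] [SecondCountableTopology G] [MeasurableSpace G]
  [BorelSpace G]

/-- The matrix entries of the adjoint action. -/
def adEntry (k l : Fin (Module.finrank ℝ (Mat n K))) (g : G) : ℝ :=
  (matBasis n K).coord l (R.ad g (matBasis n K k))

theorem continuous_adEntry (k l : Fin (Module.finrank ℝ (Mat n K))) :
    Continuous (R.adEntry k l) :=
  (LinearMap.continuous_of_finiteDimensional ((matBasis n K).coord l)).comp
    (continuous_id.hornRep_ad continuous_const R)

theorem sum_repr_mul_adEntry (A : Mat n K) (l : Fin (Module.finrank ℝ (Mat n K))) (g : G) :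
    ∑ k, (matBasis n K).repr A k * R.adEntry k l g = (matBasis n K).coord l (R.ad g A) := by
  conv_rhs => rw [← (matBasis n K).sum_repr A]
  simp only [map_sum, map_smul, smul_eq_mul, adEntry]

theorem sum_sum_repr_mul_adEntry (f : Mat n K →ₗ[ℝ] ℝ) (A : Mat n K) (g : G) :
    ∑ k, ∑ l, (matBasis n K).repr A k * f (matBasis n K l) * R.adEntry k l g = f (R.ad g A) := by
  rw [Finset.sum_comm]
  conv_rhs => rw [← (matBasis n K).sum_repr (R.ad g A)]
  simp only [map_sum, map_smul, smul_eq_mul]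
  refine Finset.sum_congr rfl fun l _ => ?_
  have h := R.sum_repr_mul_adEntry A l g
  rw [Module.Basis.coord_apply] at h
  rw [← h, Finset.sum_mul]
  exact Finset.sum_congr rfl fun k _ => by ring

/-- The commutator with the generator of a rotation. -/
def _root_.Horn.rotComm (a : RotIdx n K) (A : Mat n K) : Mat n K :=
  rotGen a.1.1.1 a.1.1.2 a.2 * A - A * rotGen a.1.1.1 a.1.1.2 a.2

/-- The group element of a rotation. -/
def rotAt (a : RotIdx n K) (t : ℝ) : G := R.rotElt a.1.2 a.2 t

/-- Along right rotations the entries of the adjoint action satisfy a closed linear system of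
differential equations. This is what makes them generators of a `PolyFlow`. -/
theorem hasDerivAt_adEntry (a : RotIdx n K) (k l : Fin (Module.finrank ℝ (Mat n K))) (g : G)
    (t : ℝ) : HasDerivAt (fun t => R.adEntry k l (g * R.rotAt a t))
      (∑ k', (matBasis n K).repr (rotComm a (matBasis n K k)) k' *
        R.adEntry k' l (g * R.rotAt a t)) t := by
  rw [sum_repr_mul_adEntry]
  exact R.hasDerivAt_ad_mul_rotElt a.1.2 a.2 ((matBasis n K).coord l) g _ t

/-- The coordinates of `A + B`, with the flows given by the rotations of either factor. -/
def hornFlow (α β : traceless n) : PolyFlow ((haarProb G).prod (haarProb G))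
    (RotIdx n K ⊕ RotIdx n K)
    ((Fin (Module.finrank ℝ (Mat n K)) × Fin (Module.finrank ℝ (Mat n K))) ⊕
      (Fin (Module.finrank ℝ (Mat n K)) × Fin (Module.finrank ℝ (Mat n K))))
    (Coord n K) where
  ρ a t x := Sum.elim (fun a => (x.1 * R.rotAt a t, x.2)) (fun a => (x.1, x.2 * R.rotAt a t)) a
  measurePreserving a t := by
    rcases a with a | a
    · exact (measurePreserving_mul_right_haarProb _).prod (MeasurePreserving.id _)
    · exact (MeasurePreserving.id _).prod (measurePreserving_mul_right_haarProb _)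
  u k x := Sum.elim (fun k => R.adEntry k.1 k.2 x.1) (fun k => R.adEntry k.1 k.2 x.2) k
  measurable_u k := by
    rcases k with k | k
    · exact ((R.continuous_adEntry k.1 k.2).comp continuous_fst).measurable
    · exact ((R.continuous_adEntry k.1 k.2).comp continuous_snd).measurable
  bounded_u k := by
    rcases k with k | k <;>
    · obtain ⟨C, hC⟩ := isCompact_univ.exists_bound_of_continuousOn
        (R.continuous_adEntry k.1 k.2).continuousOn
      exact ⟨C, fun x => hC _ trivial⟩
  du a k := Sum.elim
    (fun a => Sum.elim (fun k => ∑ k', MvPolynomial.C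
      ((matBasis n K).repr (rotComm a (matBasis n K k.1)) k') *
        MvPolynomial.X (Sum.inl (k', k.2))) (fun _ => 0) k)
    (fun a => Sum.elim (fun _ => 0) (fun k => ∑ k', MvPolynomial.C
      ((matBasis n K).repr (rotComm a (matBasis n K k.1)) k') *
        MvPolynomial.X (Sum.inr (k', k.2))) k) a
  hasDerivAt_u a k x t := by
    rcases a with a | a <;> rcases k with k | k
    · simpa using R.hasDerivAt_adEntry a k.1 k.2 x.1 t
    · simpa using hasDerivAt_const t (R.adEntry k.1 k.2 x.2)
    · simpa using hasDerivAt_const t (R.adEntry k.1 k.2 x.1)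
    · simpa using R.hasDerivAt_adEntry a k.1 k.2 x.2 t
  Φ i := (∑ k, ∑ l, MvPolynomial.C ((matBasis n K).repr (diag K α) k * coords (matBasis n K l) i) *
      MvPolynomial.X (Sum.inl (k, l))) +
    ∑ k, ∑ l, MvPolynomial.C ((matBasis n K).repr (diag K β) k * coords (matBasis n K l) i) *
      MvPolynomial.X (Sum.inr (k, l))

theorem φ_hornFlow (α β : traceless n) (x : G × G) :
    (R.hornFlow α β).φ x = coords (hornSum α β (R.π x.1) (R.π x.2)) := by
  funext i
  have h := fun (A : Mat n K) (g : G) =>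
    R.sum_sum_repr_mul_adEntry (LinearMap.proj i ∘ₗ coords) A g
  simp only [LinearMap.comp_apply, LinearMap.proj_apply] at h
  simp only [PolyFlow.φ, PolyFlow.val, hornFlow, map_add, map_sum, map_mul, MvPolynomial.aeval_X,
    MvPolynomial.algHom_C, Sum.elim_inl, Sum.elim_inr, Algebra.algebraMap_self, RingHom.id_apply, h,
    hornSum, ← ad_apply, Pi.add_apply]

theorem continuous_val_hornFlow (α β : traceless n) (p) :
    Continuous fun x => (R.hornFlow α β).val x p := by
  have hu : ∀ k, Continuous ((R.hornFlow α β).u k) := by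
    rintro (k | k)
    · exact (R.continuous_adEntry k.1 k.2).comp continuous_fst
    · exact (R.continuous_adEntry k.1 k.2).comp continuous_snd
  induction p using MvPolynomial.induction_on with
  | C a => simpa [PolyFlow.val] using continuous_const
  | add p q hp hq => simpa using hp.fun_add hq
  | mul_X p k hp => simpa [PolyFlow.val] using hp.fun_mul (hu k)

theorem u_ρ_zero (α β : traceless n) (a) (x : G × G) (k) :
    (R.hornFlow α β).u k ((R.hornFlow α β).ρ a 0 x) = (R.hornFlow α β).u k x := by
  have h : ∀ (b : RotIdx n K) (g : G) (A : Mat n K), R.ad (g * R.rotAt b 0) A = R.ad g A := by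
    intro b g A
    rw [ad_mul, ad_apply R (R.rotAt b 0), rotAt, π_rotElt, rot_zero, star_one, one_mul, mul_one]
  rcases a with a | a <;> rcases k with k | k <;> simp [hornFlow, adEntry, h]

/-- The velocities of the map along the flows. -/
def velocity (α β : traceless n) (x : G × G) (a : RotIdx n K ⊕ RotIdx n K) : Mat n K :=
  Sum.elim (fun a => R.ad x.1 (rotComm a (diag K α))) (fun a => R.ad x.2 (rotComm a (diag K β))) a

/-- Both sides are the derivative at time zero of the coordinates of the sum along a flow, so the
polynomials need not be expanded. -/
theorem val_L_Φ (α β : traceless n) (x : G × G) (a : RotIdx n K ⊕ RotIdx n K) (i : Coord n K) :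
    (R.hornFlow α β).val x ((R.hornFlow α β).L a ((R.hornFlow α β).Φ i)) =
      coords (R.velocity α β x a) i := by
  have h0 : ∀ p, (R.hornFlow α β).val ((R.hornFlow α β).ρ a 0 x) p = (R.hornFlow α β).val x p := by
    intro p
    simp only [PolyFlow.val, u_ρ_zero]
  have h1 := congrFun ((R.hornFlow α β).hasDerivAt_φ a x 0).deriv i
  have hrot : ∀ (b : RotIdx n K) (g : G) (A : Mat n K), R.ad (g * R.rotAt b 0) A = R.ad g A := by
    intro b g A
    rw [ad_mul, ad_apply R (R.rotAt b 0), rotAt, π_rotElt, rot_zero, star_one, one_mul, mul_one]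
  rw [← h0, ← h1]
  simp only [φ_hornFlow, hornSum, ← ad_apply, map_add]
  rcases a with a | a
  · have h := (R.hasDerivAt_coords_ad_mul_rotElt a.1.2 a.2 x.1 (diag K α) 0).add_const
      (coords (R.ad x.2 (diag K β)))
    refine (congrFun h.deriv i).trans ?_
    rw [show R.rotElt a.1.2 a.2 0 = R.rotAt a 0 from rfl, hrot]
    rfl
  · have h := (R.hasDerivAt_coords_ad_mul_rotElt a.1.2 a.2 x.2 (diag K β) 0).const_add
      (coords (R.ad x.1 (diag K α)))
    refine (congrFun h.deriv i).trans ?_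
    rw [show R.rotElt a.1.2 a.2 0 = R.rotAt a 0 from rfl, hrot]
    rfl

theorem val_disc (α β : traceless n) (x : G × G) :
    (R.hornFlow α β).val x (R.hornFlow α β).disc =
      ((of fun i a => coords (R.velocity α β x a) i) *
        (of fun i a => coords (R.velocity α β x a) i)ᴴ :
          Matrix (Coord n K) (Coord n K) ℝ).det := by
  rw [PolyFlow.disc, AlgHom.map_det]
  congr 1
  ext i j
  simp [PolyFlow.gram, mul_apply, val_L_Φ]

theorem val_disc_nonneg (α β : traceless n) (x : G × G) :
    0 ≤ (R.hornFlow α β).val x (R.hornFlow α β).disc := by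
  rw [val_disc]
  exact (posSemidef_self_mul_conjTranspose _).det_nonneg

/-- In the frame of `g` the velocities are multiples `αⱼ - αᵢ ≠ 0` of the matrices `symGen`, so
orthogonality to them removes every off-diagonal entry. -/
theorem eq_ad_diag_of_retr_eq_zero {α : traceless n} (hα : StrictAnti fun i => α.1 i) (g : G)
    {Y : Mat n K} (hY : Y ∈ herm n K)
    (h : ∀ a : RotIdx n K, retr (Y * R.ad g (rotComm a (diag K α))) = 0) :
    Y = R.ad g (diag K (diagPart (R.ad g⁻¹ Y))) := by
  have hA := R.ad_mem_herm g⁻¹ hY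
  have h1 := eq_diag_add_sum_symGen hA
  rw [Finset.sum_eq_zero, add_zero] at h1
  · rw [← h1, ad_ad_inv]
  · intro p hp
    refine Finset.sum_eq_zero fun k _ => ?_
    have hne : p.1 ≠ p.2 := (mem_posPairs.1 hp).ne
    have h2 := h (⟨p, hne⟩, k)
    rw [rotComm, rotGen_mul_diag hne, map_smul, mul_smul_comm, map_smul, retr_mul_comm, retr_ad_mul,
      retr_symGen_mul hA.1, smul_eq_mul, mul_eq_zero] at h2
    rcases h2 with h2 | h2
    · exact absurd (hα.injective (sub_eq_zero.1 h2)) hne.symm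
    · rw [(mul_eq_zero.1 h2).resolve_left two_ne_zero, zero_smul]

/-- A kernel vector of the Gram matrix is the coefficient vector of a matrix orthogonal to the
velocities of both flows, hence diagonal in both frames. -/
theorem exists_ad_diag_eq_of_val_disc_eq_zero {α β : traceless n} (hα : StrictAnti fun i => α.1 i)
    (hβ : StrictAnti fun i => β.1 i) {x : G × G}
    (h : (R.hornFlow α β).val x (R.hornFlow α β).disc = 0) :
    ∃ y y' : traceless n, y ≠ 0 ∧ R.ad x.1 (diag K y) = R.ad x.2 (diag K y') := by
  rw [val_disc] at h
  obtain ⟨v, hv, hv0⟩ := exists_mulVec_eq_zero_iff.2 h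
  rw [self_mul_conjTranspose_mulVec_eq_zero] at hv0
  set Y : Mat n K := ∑ i, v i • (hermBasis n K i : Mat n K) with hYdef
  have hY : Y ∈ herm n K := Submodule.sum_mem _ fun i _ => Submodule.smul_mem _ _ (hermBasis n K i).2
  have hY0 : Y ≠ 0 := by
    intro h0
    apply hv
    have h1 : ∑ i, v i • hermBasis n K i = 0 := by
      apply Subtype.ext
      simpa [hYdef] using h0
    funext i
    exact Fintype.linearIndependent_iff.1 (hermBasis n K).linearIndependent v h1 i
  have hr : ∀ a, retr (Y * R.velocity α β x a) = 0 := by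
    intro a
    have h1 := congrFun hv0 a
    rw [hYdef, ← sum_mul_coords]
    simp only [mulVec, dotProduct, conjTranspose_apply, of_apply, star_trivial, Pi.zero_apply] at h1
    rw [← h1]
    exact Finset.sum_congr rfl fun i _ => mul_comm _ _
  have h1 := R.eq_ad_diag_of_retr_eq_zero hα x.1 hY fun a => hr (Sum.inl a)
  have h2 := R.eq_ad_diag_of_retr_eq_zero hβ x.2 hY fun a => hr (Sum.inr a)
  refine ⟨_, _, ?_, h1.symm.trans h2⟩
  intro h0
  apply hY0
  rw [h1, h0, ← diagLin_apply, map_zero, map_zero]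

/-- The law of the coordinates of the sum. -/
def sumLaw (R : HornRep n K G) (α β : traceless n) : Measure (Coord n K → ℝ) :=
  ((haarProb G).prod (haarProb G)).map fun x => coords (hornSum α β (R.π x.1) (R.π x.2))

theorem map_φ_hornFlow (α β : traceless n) :
    ((haarProb G).prod (haarProb G)).map (R.hornFlow α β).φ = R.sumLaw α β := by
  rw [sumLaw]
  congr 1
  funext x
  exact R.φ_hornFlow α β x

theorem sumLaw_absolutelyContinuous {α β : traceless n} (hα : StrictAnti fun i => α.1 i)
    (hβ : StrictAnti fun i => β.1 i) : R.sumLaw α β ≪ volume := by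
  rw [← map_φ_hornFlow]
  refine (R.hornFlow α β).map_φ_absolutelyContinuous ?_
  filter_upwards [R.ae_forall_ad_diag_ne hβ] with x hx h0
  obtain ⟨y, y', hy, h⟩ := R.exists_ad_diag_eq_of_val_disc_eq_zero hα hβ h0
  exact hy (hx y y' h)

theorem hornSum_mem_herm (α β : traceless n) (x : G × G) :
    hornSum α β (R.π x.1) (R.π x.2) ∈ herm n K :=
  Submodule.add_mem _ (R.ad_mem_herm x.1 (diag_mem_herm α)) (R.ad_mem_herm x.2 (diag_mem_herm β))

/-- Off the singular locus `disc` and the distance of `A + B` to `c` cannot vanish together, so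
their sum has a positive minimum `η` on the compact `G × G`. -/
theorem exists_analyticAt_density {α β : traceless n} (hα : StrictAnti fun i => α.1 i)
    (hβ : StrictAnti fun i => β.1 i) {c : Coord n K → ℝ} (hc : spec n K c ∉ singularLocus α β) :
    ∃ a : (Coord n K → ℝ) → ℝ, AnalyticAt ℝ a c ∧ ∃ ε > 0, ∀ᵐ y, y ∈ Metric.ball c ε →
      ((R.sumLaw α β).rnDeriv volume y).toReal = a y := by
  rw [← map_φ_hornFlow]
  set S := R.hornFlow α β with hS
  have hcont : Continuous fun x => S.val x S.disc + dist (S.φ x) c := by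
    refine (R.continuous_val_hornFlow α β _).add (Continuous.dist ?_ continuous_const)
    exact continuous_pi fun i => R.continuous_val_hornFlow α β _
  have hpos : ∀ x, 0 < S.val x S.disc + dist (S.φ x) c := by
    intro x
    have h1 := R.val_disc_nonneg α β x
    rcases (dist_nonneg (x := S.φ x) (y := c)).eq_or_lt with h2 | h2
    · refine add_pos_of_pos_of_nonneg (lt_of_le_of_ne h1 fun h0 => hc ?_) dist_nonneg
      obtain ⟨y, y', hy, h⟩ := R.exists_ad_diag_eq_of_val_disc_eq_zero hα hβ h0.symm
      obtain ⟨g, hg⟩ := R.exists_orbit_spec hα c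
      refine R.mem_singularLocus hα hy h (g := g) ?_
      have h3 : S.φ x = c := dist_eq_zero.1 h2.symm
      rw [hS, φ_hornFlow, ← hg, orbit] at h3
      have h4 := congrArg (ofCoords (n := n) (K := K)) h3
      rw [ofCoords_coords (R.hornSum_mem_herm α β x),
        ofCoords_coords (R.ad_mem_herm _ (diag_mem_herm _))] at h4
      exact h4.symm
    · exact add_pos_of_nonneg_of_pos h1 h2
  obtain ⟨x₀, -, hx₀⟩ := isCompact_univ.exists_isMinOn Set.univ_nonempty hcont.continuousOn
  set η := S.val x₀ S.disc + dist (S.φ x₀) c with hη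
  have hη0 : 0 < η := hpos x₀
  -- On the ball of radius `2 * (η / 4) = η / 2` the distance takes at most half of `η`, leaving
  -- `disc ≥ η / 2`.
  refine S.exists_analyticAt_density ?_ (r := η / 4) (δ := η / 2) (by positivity) (by positivity)
    fun x hx => ?_
  · rw [hS, map_φ_hornFlow]
    exact R.sumLaw_absolutelyContinuous hα hβ
  · have h1 : η ≤ S.val x S.disc + dist (S.φ x) c := hx₀ (Set.mem_univ x)
    rw [Metric.mem_ball] at hx
    linarith

end HornRep

end

section

/-! ### The density of the spectrum of the sum -/

open HornField

namespace HornRep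

variable {n : ℕ} {K : Type*} [Ring K] [StarRing K] [Algebra ℝ K] [TopologicalSpace K]
  [HornField K] [IsTopologicalRing K] [ContinuousStar K] [ContinuousSMul ℝ K] [T2Space K]
  {G : Type*} [Group G] [TopologicalSpace G] (R : HornRep n K G)
  [IsTopologicalGroup G] [CompactSpace G] [SecondCountableTopology G] [MeasurableSpace G]
  [BorelSpace G]

/-- The action of the group in coordinates. -/
def adCoords (h : G) (c : Coord n K → ℝ) : Coord n K → ℝ := coords (R.ad h (ofCoords c))

theorem continuous_adCoords (h : G) : Continuous (R.adCoords h) :=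
  continuous_coords.comp (continuous_const.hornRep_ad continuous_ofCoords R)

theorem adCoords_coords (h : G) {A : Mat n K} (hA : A ∈ herm n K) :
    R.adCoords h (coords A) = coords (R.ad h A) := by rw [adCoords, ofCoords_coords hA]

theorem adCoords_orbit (h g : G) (x : traceless n) :
    R.adCoords h (R.orbit (g, x)) = R.orbit (h * g, x) := by
  rw [orbit, R.adCoords_coords h (R.ad_mem_herm _ (diag_mem_herm _)), ← ad_mul, orbit]

theorem adCoords_inv_adCoords (h : G) (c : Coord n K → ℝ) :
    R.adCoords h⁻¹ (R.adCoords h c) = c := by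
  rw [adCoords, adCoords, ofCoords_coords (R.ad_mem_herm _ (ofCoords_mem c)), ad_inv_ad,
    coords_ofCoords]

theorem spec_adCoords {a : traceless n} (ha : StrictAnti fun i => a.1 i) (h : G)
    (c : Coord n K → ℝ) : spec n K (R.adCoords h c) = spec n K c := by
  obtain ⟨g, x, hx, rfl⟩ := R.exists_orbit_eq ha c
  rw [adCoords_orbit, R.spec_orbit _ hx, R.spec_orbit _ hx]

theorem map_adCoords_weylMeasure (h : G) :
    R.weylMeasure.map (R.adCoords h) = R.weylMeasure := by
  rw [weylMeasure, Measure.map_map (R.continuous_adCoords h).measurable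
    R.continuous_orbit.measurable]
  have hmp : MeasurePreserving (Prod.map (fun g => h * g) id)
      ((haarProb G).prod (chamberMeasure n (deg K))) ((haarProb G).prod (chamberMeasure n (deg K))) :=
    (measurePreserving_mul_left_haarProb h).prod (MeasurePreserving.id _)
  conv_rhs => rw [← hmp.map_eq, Measure.map_map R.continuous_orbit.measurable hmp.measurable]
  congr 1
  funext p
  exact R.adCoords_orbit h p.1 p.2

/-- Left invariance of Haar measure makes the Weyl measure conjugation invariant, and Lebesgue
measure is a multiple of it. -/
theorem measurePreserving_adCoords {a : traceless n} (ha : StrictAnti fun i => a.1 i) (h : G) :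
    MeasurePreserving (R.adCoords h) (volume : Measure (Coord n K → ℝ)) volume := by
  refine ⟨(R.continuous_adCoords h).measurable, ?_⟩
  obtain ⟨κ, hκ, hw⟩ := R.exists_weylMeasure_eq_smul ha
  have h1 := R.map_adCoords_weylMeasure h
  rw [hw, Measure.map_smul] at h1
  have h2 := congrArg (fun μ => κ⁻¹ • μ) h1
  simpa [smul_smul, inv_mul_cancel₀ hκ] using h2

theorem measurable_coords_hornSum (α β : traceless n) :
    Measurable fun x : G × G => coords (hornSum α β (R.π x.1) (R.π x.2)) := by
  have h : Continuous fun x : G × G => R.ad x.1 (diag K α) + R.ad x.2 (diag K β) :=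
    (continuous_fst.hornRep_ad continuous_const R).add
      (continuous_snd.hornRep_ad continuous_const R)
  exact (continuous_coords.comp h).measurable

theorem map_adCoords_sumLaw (α β : traceless n) (h : G) :
    (R.sumLaw α β).map (R.adCoords h) = R.sumLaw α β := by
  rw [sumLaw, Measure.map_map (R.continuous_adCoords h).measurable
    (R.measurable_coords_hornSum α β)]
  have hmp : MeasurePreserving (Prod.map (fun g => h * g) fun g => h * g)
      ((haarProb G).prod (haarProb G)) ((haarProb G).prod (haarProb G)) :=
    (measurePreserving_mul_left_haarProb h).prod (measurePreserving_mul_left_haarProb h)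
  conv_rhs => rw [← hmp.map_eq, Measure.map_map (R.measurable_coords_hornSum α β) hmp.measurable]
  congr 1
  funext x
  simp only [Function.comp_apply]
  rw [R.adCoords_coords h (R.hornSum_mem_herm α β x)]
  simp only [hornSum, ← ad_apply, map_add, Prod.map_fst, Prod.map_snd, ad_mul]

instance isProbabilityMeasure_sumLaw (α β : traceless n) : IsProbabilityMeasure (R.sumLaw α β) :=
  Measure.isProbabilityMeasure_map (R.measurable_coords_hornSum α β).aemeasurable

/-- The density of the law of the sum, in a version that is analytic off the singular locus. -/
theorem exists_density {α β : traceless n} (hα : StrictAnti fun i => α.1 i)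
    (hβ : StrictAnti fun i => β.1 i) :
    ∃ f : (Coord n K → ℝ) → ℝ, Measurable f ∧ (∀ y, 0 ≤ f y) ∧
      R.sumLaw α β = volume.withDensity (fun y => ENNReal.ofReal (f y)) ∧
      (∀ c, spec n K c ∉ singularLocus α β → AnalyticAt ℝ f c) ∧
      ∀ c, spec n K c ∉ singularLocus α β → ∀ h : G, f (R.adCoords h c) = f c := by
  obtain ⟨f, mf, hf, hff, ha⟩ := exists_analytic_version (μ := volume)
    (f := fun y => ((R.sumLaw α β).rnDeriv volume y).toReal)
    (Measure.measurable_rnDeriv _ _).ennreal_toReal (fun _ => ENNReal.toReal_nonneg)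
    (s := {c | spec n K c ∉ singularLocus α β})
    (fun c hc => R.exists_analyticAt_density hα hβ hc)
  have hd : R.sumLaw α β = volume.withDensity (fun y => ENNReal.ofReal (f y)) := by
    rw [← Measure.withDensity_rnDeriv_eq _ _ (R.sumLaw_absolutelyContinuous hα hβ)]
    refine withDensity_congr_ae ?_
    filter_upwards [hff, Measure.rnDeriv_lt_top (R.sumLaw α β) volume] with y hy hy'
    rw [hy, ENNReal.ofReal_toReal hy'.ne]
  refine ⟨f, mf, hf, hd, ha, fun c hc h => ?_⟩
  have hmp := R.measurePreserving_adCoords hα h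
  have hmF : Measurable fun y => ENNReal.ofReal (f y) := mf.ennreal_ofReal
  -- Both the law of the sum and Lebesgue measure are conjugation invariant, so `f` composed with a
  -- conjugation is another density of the same law.
  have hinv : volume.withDensity (fun y => ENNReal.ofReal (f (R.adCoords h y))) =
      volume.withDensity (fun y => ENNReal.ofReal (f y)) := by
    ext s hs
    have hs' : MeasurableSet (R.adCoords h⁻¹ ⁻¹' s) := (R.continuous_adCoords _).measurable hs
    have hpre : R.adCoords h ⁻¹' (R.adCoords h⁻¹ ⁻¹' s) = s := by
      ext y
      simp [adCoords_inv_adCoords]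
    rw [withDensity_apply _ hs]
    conv_lhs => rw [← hpre]
    rw [hmp.setLIntegral_comp_preimage hs' hmF, ← withDensity_apply _ hs', ← hd,
      ← Measure.map_apply (R.continuous_adCoords _).measurable hs, map_adCoords_sumLaw]
  have hae : ∀ᵐ y, f (R.adCoords h y) = f y := by
    have hfin : ∫⁻ y, ENNReal.ofReal (f (R.adCoords h y)) ≠ ⊤ := by
      rw [← setLIntegral_univ, ← withDensity_apply _ MeasurableSet.univ, hinv, ← hd]
      exact measure_ne_top _ _
    have := (withDensity_eq_iff (hmF.comp hmp.measurable).aemeasurable hmF.aemeasurable hfin).1 hinv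
    filter_upwards [this] with y hy
    exact (ENNReal.ofReal_eq_ofReal_iff (hf _) (hf _)).1 hy
  have hc' : spec n K (R.adCoords h c) ∉ singularLocus α β := by rwa [R.spec_adCoords hα]
  -- Almost everywhere equality becomes equality at `c`, because `f` is continuous at `c` and at its
  -- conjugate, which has the same spectrum.
  refine eq_of_ae_eq_of_continuousAt (μ := volume) (r := 1)
    (b := fun y => f (R.adCoords h y)) (b' := f)
    ((ha _ hc').continuousAt.comp (R.continuous_adCoords h).continuousAt) (ha c hc).continuousAt
    one_pos ?_
  filter_upwards [hae] with y hy _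
  exact hy

/-- The law of the spectrum of the sum. -/
def spectrumLaw (R : HornRep n K G) (α β : traceless n) : Measure (traceless n) :=
  ((haarProb G).prod (haarProb G)).map fun x => sortedSpectrum (hornSum α β (R.π x.1) (R.π x.2))

theorem spectrumLaw_eq_map {α : traceless n} (hα : StrictAnti fun i => α.1 i) (β : traceless n) :
    R.spectrumLaw α β = (R.sumLaw α β).map (spec n K) := by
  rw [sumLaw, Measure.map_map (R.continuous_spec hα).measurable (R.measurable_coords_hornSum α β),
    spectrumLaw]
  congr 1
  funext x
  simp only [Function.comp_apply, spec]
  rw [ofCoords_coords (R.hornSum_mem_herm α β x)]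

theorem lintegral_eq_lintegral_chamber {a : traceless n} (ha : StrictAnti fun i => a.1 i) :
    ∃ κ : ℝ, 0 ≤ κ ∧ ∀ F : (Coord n K → ℝ) → ENNReal, Measurable F →
      ∫⁻ y, F y = ∫⁻ x in chamber n, ENNReal.ofReal (κ * weight (deg K) x) *
        ∫⁻ g, F (R.orbit (g, x)) ∂haarProb G := by
  obtain ⟨κ, hκ, hw⟩ := R.exists_weylMeasure_eq_smul ha
  refine ⟨(κ⁻¹ : NNReal), NNReal.coe_nonneg _, fun F hF => ?_⟩
  have hv : (volume : Measure (Coord n K → ℝ)) = κ⁻¹ • R.weylMeasure := by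
    rw [hw, smul_smul, inv_mul_cancel₀ hκ, one_smul]
  have hFo : Measurable fun p => F (R.orbit p) := hF.comp R.continuous_orbit.measurable
  have hFx : Measurable fun x => ∫⁻ g, F (R.orbit (g, x)) ∂haarProb G := hFo.lintegral_prod_left'
  rw [hv, lintegral_smul_measure, weylMeasure, lintegral_map hF R.continuous_orbit.measurable,
    lintegral_prod_symm _ hFo.aemeasurable, chamberMeasure,
    lintegral_withDensity_eq_lintegral_mul _ (continuous_weight _).measurable.ennreal_ofReal hFx]
  rw [ENNReal.smul_def, smul_eq_mul, ← lintegral_const_mul]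
  · refine lintegral_congr fun x => ?_
    rw [ENNReal.ofReal_mul (NNReal.coe_nonneg _), ENNReal.ofReal_coe_nnreal, Pi.mul_apply, mul_assoc]
  · exact (continuous_weight _).measurable.ennreal_ofReal.mul hFx

/-- By the integration formula the density at `x` is the weight times the average of `f` over the
conjugates of `diag x`. Off the singular locus `f` is constant on these, so the average is a single
value of `f`. -/
theorem exists_spectrum_density {α β : traceless n} (hα : StrictAnti fun i => α.1 i)
    (hβ : StrictAnti fun i => β.1 i) :
    ∃ p : traceless n → ℝ, Measurable p ∧ (∀ γ, 0 ≤ p γ) ∧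
      R.spectrumLaw α β =
        (volume.restrict (chamber n)).withDensity (fun γ => ENNReal.ofReal (p γ)) ∧
      AnalyticOn ℝ p (chamber n \ singularLocus α β) := by
  obtain ⟨f, mf, hf, hd, ha, hinv⟩ := R.exists_density hα hβ
  obtain ⟨κ, hκ, hκF⟩ := R.lintegral_eq_lintegral_chamber hα
  have hmF : Measurable fun y => ENNReal.ofReal (f y) := mf.ennreal_ofReal
  set q : traceless n → ENNReal := fun x => ENNReal.ofReal (κ * weight (deg K) x) *
    ∫⁻ g, ENNReal.ofReal (f (R.orbit (g, x))) ∂haarProb G with hq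
  have hmq : Measurable q := by
    have h1 : Measurable fun p => ENNReal.ofReal (f (R.orbit p)) :=
      hmF.comp R.continuous_orbit.measurable
    exact ((continuous_weight _).measurable.const_mul κ).ennreal_ofReal.mul h1.lintegral_prod_left'
  have hspec := (R.continuous_spec hα).measurable
  have hν : R.spectrumLaw α β = (volume.restrict (chamber n)).withDensity q := by
    ext s hs
    rw [R.spectrumLaw_eq_map hα, Measure.map_apply hspec hs, hd, withDensity_apply _ (hspec hs),
      ← lintegral_indicator (hspec hs), hκF _ (hmF.indicator (hspec hs)), withDensity_apply _ hs,
      ← lintegral_indicator hs]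
    refine setLIntegral_congr_fun isClosed_chamber.measurableSet fun x hx => ?_
    have h1 : ∀ g, (spec n K ⁻¹' s).indicator (fun y => ENNReal.ofReal (f y)) (R.orbit (g, x)) =
        s.indicator (fun _ => ENNReal.ofReal (f (R.orbit (g, x)))) x := by
      intro g
      have h0 : R.orbit (g, x) ∈ spec n K ⁻¹' s ↔ x ∈ s := by
        rw [Set.mem_preimage, R.spec_orbit g hx]
      by_cases hxs : x ∈ s
      · rw [Set.indicator_of_mem (h0.2 hxs), Set.indicator_of_mem hxs]
      · rw [Set.indicator_of_notMem (mt h0.1 hxs), Set.indicator_of_notMem hxs]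
    simp only [h1]
    by_cases hxs : x ∈ s
    · simp [hxs, hq]
    · simp [hxs]
  have hqtop : ∀ᵐ x ∂volume.restrict (chamber n), q x < ⊤ := by
    refine ae_lt_top hmq ?_
    rw [← setLIntegral_univ, ← withDensity_apply _ MeasurableSet.univ, ← hν,
      R.spectrumLaw_eq_map hα, Measure.map_apply hspec MeasurableSet.univ]
    exact measure_ne_top _ _
  refine ⟨fun x => (q x).toReal, hmq.ennreal_toReal, fun _ => ENNReal.toReal_nonneg, ?_, ?_⟩
  · rw [hν]
    refine withDensity_congr_ae ?_
    filter_upwards [hqtop] with x hx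
    rw [ENNReal.ofReal_toReal hx.ne]
  -- The comparison function is analytic in a full neighbourhood of each such point of the
  -- hyperplane, walls included, since `f` is analytic on the matrix space; on the chamber it equals
  -- the density.
  · have h1 : AnalyticOn ℝ (fun x => κ * weight (deg K) x * f (R.orbitL 1 x))
        (chamber n \ singularLocus α β) := by
      intro x hx
      refine AnalyticAt.analyticWithinAt ?_
      refine ((analyticAt_const (v := κ)).fun_mul (analyticAt_weight (deg K) x)).fun_mul ?_
      refine AnalyticAt.fun_comp (g := f) (f := R.orbitL 1) (ha _ ?_) ((R.orbitL 1).analyticAt x)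
      rw [orbitL_apply, R.spec_orbit 1 hx.1]
      exact hx.2
    refine h1.congr fun x hx => ?_
    have h2 : ∀ g, f (R.orbit (g, x)) = f (R.orbit (1, x)) := by
      intro g
      rw [← hinv (R.orbit (1, x)) (by rw [R.spec_orbit 1 hx.1]; exact hx.2) g, adCoords_orbit,
        mul_one]
    simp only [hq, h2, lintegral_const, measure_univ, mul_one, ENNReal.toReal_mul]
    rw [ENNReal.toReal_ofReal (mul_nonneg hκ (weight_nonneg _ hx.1)), ENNReal.toReal_ofReal (hf _),
      orbitL_apply]

end HornRep

end

section

/-! ### The three families of groups -/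

open HornField

instance hornFieldReal : HornField ℝ where
  re := LinearMap.id
  deg := 1
  deg_pos := one_pos
  e := fun _ => 1
  re_mul_comm x y := mul_comm x y
  re_star x := rfl
  re_one := rfl
  eq_of_star_eq x _ := rfl
  expand x := by simp
  star_e_mul k := by simp
  e_mul_star k := by simp
  re_star_mul_self_nonneg x := mul_self_nonneg x
  eq_zero_of_re x h := mul_self_eq_zero.1 h
  star_smul_real r x := by simp
  continuous_re := continuous_id

instance hornFieldComplex : HornField ℂ where
  re := Complex.reLm
  deg := 2
  deg_pos := two_pos
  e := ![1, Complex.I]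
  re_mul_comm x y := by rw [mul_comm]
  re_star x := rfl
  re_one := rfl
  eq_of_star_eq x h := (Complex.conj_eq_iff_re.1 h).symm
  expand x := by
    apply Complex.ext <;> simp [Fin.sum_univ_two]
  star_e_mul k := by fin_cases k <;> simp
  e_mul_star k := by fin_cases k <;> simp
  re_star_mul_self_nonneg x := by
    simpa using add_nonneg (mul_self_nonneg x.re) (mul_self_nonneg x.im)
  eq_zero_of_re x h := by
    have h1 : x.re * x.re + x.im * x.im = 0 := by simpa using h
    have h2 := mul_self_nonneg x.re
    have h3 := mul_self_nonneg x.im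
    exact Complex.ext (mul_self_eq_zero.1 (by linarith)) (mul_self_eq_zero.1 (by linarith))
  star_smul_real r x := by apply Complex.ext <;> simp
  continuous_re := Complex.continuous_re

/-- The quaternion with given components. -/
def quat (a b c d : ℝ) : ℍ[ℝ] := ⟨a, b, c, d⟩

theorem quat_re (a b c d : ℝ) : (quat a b c d).re = a := rfl

theorem quat_imI (a b c d : ℝ) : (quat a b c d).imI = b := rfl

theorem quat_imJ (a b c d : ℝ) : (quat a b c d).imJ = c := rfl

theorem quat_imK (a b c d : ℝ) : (quat a b c d).imK = d := rfl

/-- The real part of a quaternion as a linear map. -/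
def quatRe : ℍ[ℝ] →ₗ[ℝ] ℝ where
  toFun x := x.re
  map_add' _ _ := rfl
  map_smul' _ _ := rfl

theorem quatRe_apply (x : ℍ[ℝ]) : quatRe x = x.re := rfl

instance hornFieldQuaternion : HornField ℍ[ℝ] where
  re := quatRe
  deg := 4
  deg_pos := four_pos
  e := ![1, quat 0 1 0 0, quat 0 0 1 0, quat 0 0 0 1]
  re_mul_comm x y := by
    simp only [quatRe_apply, Quaternion.re_mul]
    ring
  re_star x := by simp only [quatRe_apply, Quaternion.re_star]
  re_one := rfl
  eq_of_star_eq x h := by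
    have h1 : -x.imI = x.imI := congrArg (fun q : ℍ[ℝ] => q.imI) h
    have h2 : -x.imJ = x.imJ := congrArg (fun q : ℍ[ℝ] => q.imJ) h
    have h3 : -x.imK = x.imK := congrArg (fun q : ℍ[ℝ] => q.imK) h
    apply Quaternion.ext
    · rfl
    · change x.imI = 0
      linarith
    · change x.imJ = 0
      linarith
    · change x.imK = 0
      linarith
  expand x := by
    apply Quaternion.ext <;> simp [Fin.sum_univ_four, quatRe_apply, quat_re, quat_imI, quat_imJ, quat_imK]
  star_e_mul k := by fin_cases k <;> apply Quaternion.ext <;> simp [quat_re, quat_imI, quat_imJ, quat_imK]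
  e_mul_star k := by fin_cases k <;> apply Quaternion.ext <;> simp [quat_re, quat_imI, quat_imJ, quat_imK]
  re_star_mul_self_nonneg x := by
    change 0 ≤ (star x * x).re
    rw [Quaternion.star_mul_self]
    exact Quaternion.normSq_nonneg
  eq_zero_of_re x h := by
    change (star x * x).re = 0 at h
    rw [Quaternion.star_mul_self] at h
    exact Quaternion.normSq_eq_zero.1 h
  star_smul_real r x := by apply Quaternion.ext <;> simp
  continuous_re := Quaternion.continuous_re

/-- Plane rotations over a commutative ring have determinant one. -/
theorem det_rot {n : ℕ} {K : Type*} [CommRing K] [StarRing K] [Algebra ℝ K] [TopologicalSpace K]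
    [HornField K] {i j : Fin n} (hij : i ≠ j) (k : Fin (deg K)) (t : ℝ) :
    (rot i j k t : Mat n K).det = 1 := by
  set c : K := algebraMap ℝ K (Real.cos t) with hc
  set s : K := algebraMap ℝ K (Real.sin t) with hs
  have hcs : c * c + s * s = 1 := by
    rw [hc, hs, ← map_mul, ← map_mul, ← map_add, ← sq, ← sq, Real.cos_sq_add_sin_sq, map_one]
  -- The rotation is the identity plus `A M A'`, factored through the plane. As `A' A = 1`,
  -- exchanging the factors reduces the determinant to that of the two by two matrix `1 + M`.
  let A : Matrix (Fin n) (Fin 2) K := single i 0 1 + single j 1 1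
  let A' : Matrix (Fin 2) (Fin n) K := single 0 i 1 + single 1 j 1
  let M : Matrix (Fin 2) (Fin 2) K :=
    single 0 0 (c - 1) + single 0 1 (s * e k) + single 1 0 (-(s * star (e k))) + single 1 1 (c - 1)
  have hsub : ∀ (a b : Fin n) (x y : K), single a b (x - y) = single a b x - single a b y := by
    intro a b x y
    ext p q
    simp only [single_apply, Matrix.sub_apply]
    split_ifs <;> simp
  have hneg : ∀ (a b : Fin n) (x : K), single a b (-x) = -single a b x := by
    intro a b x
    ext p q
    simp only [single_apply, Matrix.neg_apply]
    split_ifs <;> simp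
  have h1 : (rot i j k t : Mat n K) = 1 + A * (M * A') := by
    have e1 : Real.cos t • planeProj n K i j = single i i c + single j j c := by
      rw [planeProj, smul_add, smul_single, smul_single, ← Algebra.algebraMap_eq_smul_one]
    have e2 : Real.sin t • (rotGen i j k : Mat n K) =
        single i j (s * e k) - single j i (s * star (e k)) := by
      rw [rotGen, smul_sub, smul_single, smul_single, Algebra.smul_def, Algebra.smul_def]
    have e3 : A * (M * A') = single i i (c - 1) + single i j (s * e k) +
        single j i (-(s * star (e k))) + single j j (c - 1) := by
      simp [A, A', M, Matrix.mul_add, Matrix.add_mul, single_mul_single_of_ne]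
      abel
    rw [rot, e1, e2, e3, hsub, hsub, hneg, planeProj]
    abel
  have h2 : A' * A = 1 := by
    have h3 : A' * A = single 0 0 1 + single 1 1 1 := by
      simp [A, A', Matrix.mul_add, Matrix.add_mul, single_mul_single_of_ne, hij, hij.symm]
    rw [h3]
    ext a b
    fin_cases a <;> fin_cases b <;> simp
  rw [h1, det_one_add_mul_comm, Matrix.mul_assoc, h2, Matrix.mul_one, det_fin_two]
  simp [M]
  have := e_mul_star k
  linear_combination hcs + s * s * this

theorem secondCountableTopology_submonoid {n : ℕ} {K : Type*} [Ring K] [TopologicalSpace K]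
    [SecondCountableTopology K] (S : Submonoid (Matrix (Fin n) (Fin n) K)) :
    SecondCountableTopology S :=
  have : SecondCountableTopology (Matrix (Fin n) (Fin n) K) :=
    inferInstanceAs (SecondCountableTopology (Fin n → Fin n → K))
  TopologicalSpace.Subtype.secondCountableTopology _

/-- `SO(n)` contains the plane rotations. -/
def hornRepSO (n : ℕ) : HornRep n ℝ (SO n) where
  π := (SO n).subtype
  continuous_π := continuous_subtype_val
  mem_unitary g := by
    have h := (mem_SO_iff.1 g.2).1
    have h' : (g : Mat n ℝ) * star (g : Mat n ℝ) = 1 := by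
      rw [star_eq_conjTranspose, conjTranspose_eq_transpose_of_trivial]
      exact h
    exact Unitary.mem_iff.2 ⟨mul_eq_one_comm.1 h', h'⟩
  exists_rot i j hij k t := by
    refine ⟨⟨rot i j k t, mem_SO_iff.2 ⟨?_, det_rot hij k t⟩⟩, rfl⟩
    rw [← conjTranspose_eq_transpose_of_trivial, ← star_eq_conjTranspose]
    exact rot_mul_star hij k t

/-- `SU(n)` contains the plane rotations. -/
def hornRepSU (n : ℕ) : HornRep n ℂ (SU n) where
  π := (SU n).subtype
  continuous_π := continuous_subtype_val
  mem_unitary g := (mem_specialUnitaryGroup_iff.1 g.2).1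
  exists_rot i j hij k t :=
    ⟨⟨rot i j k t, mem_specialUnitaryGroup_iff.2 ⟨rot_mem_unitary hij k t, det_rot hij k t⟩⟩, rfl⟩

/-- `USp(n)` contains the plane rotations. -/
def hornRepUSp (n : ℕ) : HornRep n ℍ[ℝ] (USp n) where
  π := (USp n).subtype
  continuous_π := continuous_subtype_val
  mem_unitary g := g.2
  exists_rot i j hij k t := ⟨⟨rot i j k t, rot_mem_unitary hij k t⟩, rfl⟩

end

end Horn

end

theorem proposition1 (n : ℕ) (α β : Horn.traceless n)
    (hα : StrictAnti fun i => α.1 i) (hβ : StrictAnti fun i => β.1 i) :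
    ∀ ν ∈ ({Horn.hornSO α β, Horn.hornSU α β, Horn.hornUSp α β} :
        Set (Measure (Horn.traceless n))),
      ∃ p : Horn.traceless n → ℝ,
        Measurable p ∧ (∀ γ, 0 ≤ p γ) ∧
        ν = (volume.restrict (Horn.chamber n)).withDensity (fun γ => ENNReal.ofReal (p γ)) ∧
        AnalyticOn ℝ p (Horn.chamber n \ Horn.singularLocus α β) := by
  have h : SecondCountableTopology ℍ[ℝ] := secondCountable_of_proper
  have h₁ := Horn.secondCountableTopology_submonoid (Horn.SO n)
  have h₂ := Horn.secondCountableTopology_submonoid (Horn.SU n)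
  have h₃ := Horn.secondCountableTopology_submonoid (Horn.USp n)
  rintro ν (rfl | rfl | rfl)
  · exact (Horn.hornRepSO n).exists_spectrum_density hα hβ
  · exact (Horn.hornRepSU n).exists_spectrum_density hα hβ
  · exact (Horn.hornRepUSp n).exists_spectrum_density hα hβ
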